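/- **Setting.** Let $\alpha,\beta$ be negative integers and let $\mathbb B=\mathbb Q\oplus\mathbb Q\zeta\oplus\mathbb Q\xi\oplus\mathbb Q\zeta\xi$, $\zeta^2=\alpha$, $\xi^2=\beta$, $\zeta\xi=-\xi\zeta$, be the corresponding definite quaternion algebra, $\mathcal O$ a maximal order, $\mathfrak n=(\mathcal N)$ with $\mathcal N\ge1$ an integer. Let $m\ge2$, $r\ge 0$, $n=2m+r$, $k\in\mathbb N$, and $$G=\{g\in \mathrm{SL}_n(\mathbb B): g^*\phi g=\phi\},\qquad \phi=\begin{pmatrix}0&0&-1_m\\0&\zeta 1_r&0\\1_m&0&0\end{pmatrix}.$$ $K_1(\mathfrak n)\subset G(\mathbb A_{\mathbf h})$ is the group of integral elements of $G(\mathbb A_{\mathbf h})$ (entries, and entries of the inverse, in $\mathcal O\otimes\widehat{\mathbb Z}$) that are congruent modulo $\mathfrak n$ to block upper unipotent matrices (blocks $m,r,m$). Put $J=\begin{pmatrix}0&-1\\1&0\end{pmatrix}$ and $J_m'=\mathrm{diag}[J,\dots,J]$ ($m$ copies). Identify $\mathbb B\otimes\mathbb R$ with the Hamilton quaternions by $\zeta\mapsto\sqrt{|\alpha|}\,\mathbf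 i$, $\xi\mapsto\sqrt{|\beta|}\,\mathbf j$, and embed these in $M_2(\mathbb C)$ by $a+b\mathbf i+c\mathbf j+d\mathbf i\mathbf j\mapsto\begin{pmatrix}a+ci&-(b-di)\\b+di&a-ci\end{pmatrix}$. After conjugation by $\mathrm{diag}[1_m,|\alpha|^{1/4}1_r,1_m]$ and reordering of coordinates this identifies $G(\mathbb R)$ with $$G_\infty=\{g\in \mathrm{GL}_{2n}(\mathbb C): g^*\phi_\infty g=\phi_\infty,\ {}^tg\psi_\infty g=\psi_\infty\},$$ where, in block sizes $2m,r,r,2m$, $\phi_\infty$ is antidiagonal with entries $-1_{2m},-1_r,1_r,1_{2m}$ (from top to bottom), and $\psi_\infty$ has entries $J_m'$ at $(1,4)$, $-J_m'$ at $(4,1)$, $1_r$ at $(2,2)$ and $(3,3)$, and zeros elsewhere. With $u_0=\begin{pmatrix}0&1_r\\1_{2m}&0\end{pmatrix}$, the group $G_\infty$ acts on $$\mathfrak Z=\Big\{z\in M_n(\mathbb C):\ i(z^*-z)>0,\ {}^tU(z)\,\psi_\infty U(z)=0\Big\},\qquad U(z)=\begin{pmatrix}z\\u_0\end{pmatrix},$$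 by $gz=(az+bu_0)(cz+du_0)^{-1}u_0$ for $g=\begin{pmatrix}a&b\\c&d\end{pmatrix}$, with automorphy factor $j(g,z)=\det(u_0^{-1}(cz+du_0))$. Let $z_0=i1_n$ and let $K_\infty$ be its stabilizer, so that $\mathfrak Z=G_\infty/K_\infty$. The map $z\mapsto L(z-i)(z+i)^{-1}$, $L=\mathrm{diag}[iJ_m',1_r]$, is a bijection of $\mathfrak Z$ onto $\mathfrak B=\{z\in M_n(\mathbb C):{}^tz=-z,\ z^*z<1\}$, which gives $\mathfrak Z$ its complex structure. The measure $\mathbf dh_\infty$ on $G_\infty/K_\infty$ is the pull-back under $h_\infty\mapsto h_\infty z_0$ and this bijection of the invariant measure $\det(1-z^*z)^{-n+1}\prod_{p<q}\frac i2dz_{pq}\wedge d\bar z_{pq}$ of $\mathfrak B$. Let $\mathbf f:G(\mathbb A)\to\mathbb C$ be a modular form of weight $k$ and level $\mathfrak n$ (in particular it may be a cusp form): $\mathbf f(\gamma g\kappa_\infty\kappa)=j(\kappa_\infty,z_0)^{-k}\mathbf f(g)$ for $\gamma\in G(\mathbb Q)$, $\kappa_\infty\in K_\infty$, $\kappa\in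 K_1(\mathfrak n)$, and for each $g_{\mathbf h}\in G(\mathbb A_{\mathbf h})$ the function $g_\infty z_0\mapsto j(g_\infty,z_0)^k\mathbf f(g_{\mathbf h}g_\infty)$ is holomorphic on $\mathfrak Z$. **Doubling.** For $g,h\in G_\infty$ let $g\times h=R^{-1}\mathrm{diag}[g,h]R$, where, written over the Hamilton quaternions (and then embedded in complex matrices as above) in block sizes $m,r,m,m,r,m$, $$R=\begin{pmatrix}1&0&0&0&0&0\\0&\tfrac12&0&0&-\mathbf i^{-1}&0\\0&0&0&1&0&0\\0&0&-1&0&0&0\\0&-\tfrac12&0&0&-\mathbf i^{-1}&0\\0&0&0&0&0&1\end{pmatrix}.$$ Let $\tilde\tau_m=\tau_m(1_n\times\kappa_m)$, where $\kappa_m=\begin{pmatrix}0&0&-1_m\\0&1_r&0\\1_m&0&0\end{pmatrix}$ and $\tau_m=\begin{pmatrix}1_n&0\\e&1_n\end{pmatrix}$ with $e=\begin{pmatrix}0&0&1_m\\0&0&0\\1_m&0&0\end{pmatrix}$. For $x=\begin{pmatrix}a&b\\c&d\end{pmatrix}$ with complex $2n\times2n$ blocks set $j(x,Z_0)=\det\big(S^{-1}(cZ_0+dS)\big)$,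 where $Z_0=i1_{2n}$ and $S=\mathrm{diag}[1_{2m},\frac12 1_r,\frac12 1_r,1_{2m}]$, and $$\phi_\infty(x,s)=j(x,Z_0)^{-k}\,|j(x,Z_0)|^{k-s}.$$ **Lemma.** For fixed $m,r,k$ there is an entire function $a(s)$ with $a(\lambda)\in\overline{\mathbb Q}$ for all $\lambda\in\mathbb Q$ such that, with $$c_k(s)=a(s)\,\pi^{\frac{n(n-1)}2}\,\frac{\Gamma(s+k-2n+3)\Gamma(s+k-2n+5)\cdots\Gamma(s+k-1)}{\Gamma(s+k-n+2)\Gamma(s+k-n+3)\cdots\Gamma(s+k)},$$ the following holds for all $\mathbb B,\mathcal O,\mathfrak n,\mathbf f$ as above, all $h_{\mathbf h}\in G(\mathbb A_{\mathbf h})$, $g_\infty\in G_\infty$ and all $s\in\mathbb C$ with $k+\mathrm{Re}(s)>2n+1$. Whenever the integral converges absolutely, $$\int_{G_\infty/K_\infty}\phi_\infty(\tilde\tau_m(g_\infty\times h_\infty),s)\,\mathbf f(h_{\mathbf h}h_\infty)\,\mathbf dh_\infty=c_k(s)\,\mathbf f(h_{\mathbf h}g_\infty).$$ Moreover, it does converge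 absolutely if $\mathrm{Re}(s)>2n-3$ and $h_\infty\mapsto\mathbf f(h_{\mathbf h}h_\infty)$ is bounded on $G_\infty$ (as is the case for cusp forms). -/

import Mathlib

open scoped Quaternion Kronecker ComplexOrder
open MeasureTheory IsDedekindDomain

noncomputable section

namespace QMF

/-! ### Quaternionic matrices and the quaternionic unitary group -/

/-- The index set of the rows of `n × n` matrices, `n = 2m + r`, cut into blocks of sizes
`m, r, m`. -/
abbrev Idx (m r : ℕ) : Type := Fin m ⊕ Fin r ⊕ Fin m

/-- The `(m, r, m) × (m, r, m)` block matrix with rows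
`(a, 0, b)`, `(0, c, 0)`, `(d, 0, e)`, each entry standing for a multiple of an identity block. -/
def blk {R : Type*} [Zero R] (m r : ℕ) (a b c d e : R) : Matrix (Idx m r) (Idx m r) R :=
  Matrix.of fun
    | .inl p, .inl q => if p = q then a else 0
    | .inl p, .inr (.inr q) => if p = q then b else 0
    | .inr (.inl p), .inr (.inl q) => if p = q then c else 0
    | .inr (.inr p), .inl q => if p = q then d else 0
    | .inr (.inr p), .inr (.inr q) => if p = q then e else 0
    | _, _ => 0

/-- `𝔹 ⊗ A` for the quaternion algebra `𝔹 = ℚ + ℚζ + ℚξ + ℚζξ`, `ζ² = α`, `ξ² = β`, `ζξ = -ξζ`. -/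
abbrev Quat (α β : ℤ) (A : Type) [CommRing A] : Type := ℍ[A, (α : A), (β : A)]

/-- The embedding
`a + bζ + cξ + dζξ ↦ [[a + cξ, α(b - dξ)], [b + dξ, a - cξ]]` into `M₂(A[ξ])`, `ξ² = β`. -/
def emb (α β : ℤ) (A : Type) [CommRing A] :
    Quat α β A →+* Matrix (Fin 2) (Fin 2) (QuadraticAlgebra A (β : A) 0) where
  toFun x := !![⟨x.re, x.imJ⟩, ⟨(α : A) * x.imI, -((α : A) * x.imK)⟩;
                ⟨x.imI, x.imK⟩, ⟨x.re, -x.imJ⟩]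
  map_one' := by
    ext i j <;> fin_cases i <;> fin_cases j <;> simp <;> rfl
  map_mul' x y := by
    ext i j <;> fin_cases i <;> fin_cases j <;> simp [Matrix.mul_apply, Fin.sum_univ_two] <;> ring
  map_zero' := by
    ext i j <;> fin_cases i <;> fin_cases j <;> simp
  map_add' x y := by
    ext i j <;> fin_cases i <;> fin_cases j <;> simp <;> ring

/-- The reduced norm on `M_n(𝔹 ⊗ A)`: the determinant of the image under `emb`. -/
def nrd (α β : ℤ) (m r : ℕ) (A : Type) [CommRing A] :
    Matrix (Idx m r) (Idx m r) (Quat α β A) →* QuadraticAlgebra A (β : A) 0 :=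
  (Matrix.detMonoidHom (n := Idx m r × Fin 2)).comp
    ((Matrix.compRingEquiv (Idx m r) (Fin 2) (QuadraticAlgebra A (β : A) 0)).toRingHom.comp
      (emb α β A).mapMatrix).toMonoidHom

/-- The skew-hermitian form `φ` with rows `(0, 0, -1_m)`, `(0, ζ 1_r, 0)`, `(1_m, 0, 0)`. -/
def form (α β : ℤ) (m r : ℕ) (A : Type) [CommRing A] :
    Matrix (Idx m r) (Idx m r) (Quat α β A) :=
  blk m r 0 (-1) ⟨0, 1, 0, 0⟩ 1 0

/-- `G(A) = {g ∈ SL_n(𝔹 ⊗ A) : g^* φ g = φ}`. -/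
def G (α β : ℤ) (m r : ℕ) (A : Type) [CommRing A] :
    Subgroup (Matrix (Idx m r) (Idx m r) (Quat α β A))ˣ where
  carrier := {g | (g.val).conjTranspose * form α β m r A * g.val = form α β m r A ∧
    nrd α β m r A g.val = 1}
  one_mem' := by simp
  mul_mem' := by
    rintro a b ⟨ha, ha'⟩ ⟨hb, hb'⟩
    refine ⟨?_, by simp [ha', hb']⟩
    have : ((a * b).val).conjTranspose * form α β m r A * (a * b).val =
        (b.val).conjTranspose * ((a.val).conjTranspose * form α β m r A * a.val) * b.val := by
      simp [Matrix.conjTranspose_mul, Matrix.mul_assoc]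
    rw [this, ha, hb]
  inv_mem' := by
    rintro a ⟨ha, ha'⟩
    have h1 : a.val * (a⁻¹).val = 1 := by simp
    constructor
    · have h2 : ((a⁻¹).val).conjTranspose * (a.val).conjTranspose = 1 := by
        rw [← Matrix.conjTranspose_mul, h1, Matrix.conjTranspose_one]
      calc ((a⁻¹).val).conjTranspose * form α β m r A * (a⁻¹).val
          = ((a⁻¹).val).conjTranspose * ((a.val).conjTranspose * form α β m r A * a.val)
              * (a⁻¹).val := by rw [ha]
        _ = (((a⁻¹).val).conjTranspose * (a.val).conjTranspose) * form α β m r A *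
              (a.val * (a⁻¹).val) := by simp only [Matrix.mul_assoc]
        _ = form α β m r A := by rw [h1, h2, one_mul, mul_one]
    · have h3 := congrArg (nrd α β m r A) h1
      rwa [map_mul, map_one, ha', one_mul] at h3

/-! ### Finite adeles, orders, and the level -/

/-- The ring of finite adeles of `ℚ`. -/
abbrev AH : Type := FiniteAdeleRing ℤ ℚ

/-- The map `𝔹 → 𝔹 ⊗ A`. -/
def baseChange (α β : ℤ) (A : Type) [CommRing A] [Algebra ℚ A] (x : Quat α β ℚ) : Quat α β A :=
  ⟨algebraMap ℚ A x.re, algebraMap ℚ A x.imI, algebraMap ℚ A x.imJ, algebraMap ℚ A x.imK⟩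

/-- Orders of `𝔹`: subrings that are finitely generated over `ℤ` and span `𝔹` over `ℚ`. -/
def IsOrder {α β : ℤ} (O : Subring (Quat α β ℚ)) : Prop :=
  O.toAddSubgroup.FG ∧ Submodule.span ℚ (O : Set (Quat α β ℚ)) = ⊤

/-- Maximal orders of `𝔹`. -/
def IsMaximalOrder {α β : ℤ} (O : Subring (Quat α β ℚ)) : Prop :=
  IsOrder O ∧ ∀ O' : Subring (Quat α β ℚ), IsOrder O' → O ≤ O' → O' = O

/-- `Ô = O ⊗ Ẑ = ∏_v O_v` inside `𝔹 ⊗ AH`. -/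
def hatOrder {α β : ℤ} (O : Subring (Quat α β ℚ)) : AddSubgroup (Quat α β AH) :=
  AddSubgroup.closure {y | ∃ a : AH, (∀ v, a v ∈ v.adicCompletionIntegers ℚ) ∧
    ∃ x ∈ O, y = a • baseChange α β AH x}

/-- The ideal `𝔫 Ô` for `𝔫 = (N)`. -/
def hatIdeal {α β : ℤ} (O : Subring (Quat α β ℚ)) (N : ℕ) : Set (Quat α β AH) :=
  {y | ∃ x ∈ hatOrder O, y = N • x}

/-- `K_1(𝔫) = ∏_v K_v`: the elements of `G(Ô)` that modulo `𝔫` are block upper triangular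
(block sizes `m, r, m`) with identity blocks on the diagonal. -/
def K1 {α β : ℤ} (m r : ℕ) (O : Subring (Quat α β ℚ)) (N : ℕ) : Set (G α β m r AH) :=
  {γ | (∀ p q, γ.val.val p q ∈ hatOrder O) ∧ (∀ p q, (γ⁻¹).val.val p q ∈ hatOrder O) ∧
    (∀ p q : Fin m, (γ.val.val - 1) (.inl p) (.inl q) ∈ hatIdeal O N) ∧
    (∀ p q : Fin r, (γ.val.val - 1) (.inr (.inl p)) (.inr (.inl q)) ∈ hatIdeal O N) ∧
    (∀ p q : Fin m, (γ.val.val - 1) (.inr (.inr p)) (.inr (.inr q)) ∈ hatIdeal O N) ∧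
    (∀ (p : Fin r) (q : Fin m), γ.val.val (.inr (.inl p)) (.inl q) ∈ hatIdeal O N) ∧
    (∀ p q : Fin m, γ.val.val (.inr (.inr p)) (.inl q) ∈ hatIdeal O N) ∧
    (∀ (p : Fin m) (q : Fin r), γ.val.val (.inr (.inr p)) (.inr (.inl q)) ∈ hatIdeal O N)}

/-! ### The archimedean group and its symmetric space -/

/-- `J = [[0, -1], [1, 0]]`, the image of the quaternion unit `𝐢`. -/
def J : Matrix (Fin 2) (Fin 2) ℂ := !![0, -1; 1, 0]

/-- `𝔹 ⊗ ℝ ≅ ℍ → M₂(ℂ)`: first `ζ ↦ √|α| 𝐢`, `ξ ↦ √|β| 𝐣`, then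
`a + b𝐢 + c𝐣 + d𝐢𝐣 ↦ [[a + c i, -(b - d i)], [b + d i, a - c i]]`. -/
def ham {α β : ℤ} (x : Quat α β ℝ) : Matrix (Fin 2) (Fin 2) ℂ :=
  let a : ℂ := (x.re : ℝ)
  let b : ℂ := (√|(α : ℝ)| * x.imI : ℝ)
  let c : ℂ := (√|(β : ℝ)| * x.imJ : ℝ)
  let d : ℂ := (√|(α : ℝ)| * √|(β : ℝ)| * x.imK : ℝ)
  !![a + c * Complex.I, -(b - d * Complex.I); b + d * Complex.I, a - c * Complex.I]

/-- The scaling `diag(1_m, |α|^{1/4} 1_r, 1_m)` that turns the middle block `√|α| 𝐢 1_r` of the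
form `φ` over `ℝ` into `𝐢 1_r`. -/
def scal (α : ℤ) (m r : ℕ) : Idx m r → ℝ
  | .inr (.inl _) => √√|(α : ℝ)|
  | _ => 1

/-- The identification of `G(ℝ)` with the group
`G_∞ = {g ∈ GL_{2n}(ℂ) : g^* φ_∞ g = φ_∞, ᵗg ψ_∞ g = ψ_∞}`, given on all matrices. -/
def arch {α β : ℤ} {m r : ℕ} (g : Matrix (Idx m r) (Idx m r) (Quat α β ℝ)) :
    Matrix (Fin 2 × Idx m r) (Fin 2 × Idx m r) ℂ :=
  Matrix.of fun p q => (scal α m r p.2 : ℂ) * ham (g p.2 q.2) p.1 q.1 * ((scal α m r q.2 : ℂ))⁻¹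

/-- The index set of `z ∈ 𝔷 ⊆ M_n(ℂ)`, with blocks of sizes `2m, r`. -/
abbrev ZIdx (m r : ℕ) : Type := (Fin 2 × Fin m) ⊕ Fin r

/-- In the block order `(2m, r, r, 2m)` of the complex coordinates, the first two blocks are the
upper half and the last two the lower half. The rows of the lower half are labelled so that the
matrix `u_0` with rows `(0, 1_r)`, `(1_{2m}, 0)` becomes the identity matrix. -/
def label (m r : ℕ) : ZIdx m r ⊕ ZIdx m r → Fin 2 × Idx m r
  | .inl (.inl (a, p)) => (a, .inl p)
  | .inl (.inr p) => (0, .inr (.inl p))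
  | .inr (.inr p) => (1, .inr (.inl p))
  | .inr (.inl (a, p)) => (a, .inr (.inr p))

/-- `g ∈ G(ℝ)` as a complex `2n × 2n` matrix cut into four `n × n` blocks. -/
def cplx {α β : ℤ} {m r : ℕ} (g : G α β m r ℝ) :
    Matrix (ZIdx m r ⊕ ZIdx m r) (ZIdx m r ⊕ ZIdx m r) ℂ :=
  (arch g.val.val).submatrix (label m r) (label m r)

/-- `λ(g, z) = u_0⁻¹ (c z + d u_0)`. -/
def lam {α β : ℤ} {m r : ℕ} (g : G α β m r ℝ) (z : Matrix (ZIdx m r) (ZIdx m r) ℂ) :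
    Matrix (ZIdx m r) (ZIdx m r) ℂ :=
  (cplx g).toBlocks₂₁ * z + (cplx g).toBlocks₂₂

/-- The action `g z = (a z + b u_0)(c z + d u_0)⁻¹ u_0`. -/
def act {α β : ℤ} {m r : ℕ} (g : G α β m r ℝ) (z : Matrix (ZIdx m r) (ZIdx m r) ℂ) :
    Matrix (ZIdx m r) (ZIdx m r) ℂ :=
  ((cplx g).toBlocks₁₁ * z + (cplx g).toBlocks₁₂) * (lam g z)⁻¹

/-- The factor of automorphy `j(g, z) = det λ(g, z)`. -/
def j {α β : ℤ} {m r : ℕ} (g : G α β m r ℝ) (z : Matrix (ZIdx m r) (ZIdx m r) ℂ) : ℂ :=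
  (lam g z).det

/-- The origin `z_0 = i 1_n` of `𝔷`. -/
def z0 (m r : ℕ) : Matrix (ZIdx m r) (ZIdx m r) ℂ := Complex.I • 1

/-- `K_∞`, the stabilizer of `z_0`. -/
def Kinf (α β : ℤ) (m r : ℕ) : Set (G α β m r ℝ) := {g | act g (z0 m r) = z0 m r}

/-! ### The bounded realization, complex structure and invariant measure -/

/-- Coordinates of a skew-symmetric `n × n` matrix: the entries above the diagonal. -/
abbrev Coord (n : ℕ) : Type := {p : Fin n × Fin n // p.1 < p.2} → ℂ

/-- The skew-symmetric matrix with the given entries above the diagonal. -/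
def skew {n : ℕ} (v : Coord n) : Matrix (Fin n) (Fin n) ℂ :=
  Matrix.of fun p q => if h : p < q then v ⟨(p, q), h⟩ else
    if h : q < p then -v ⟨(q, p), h⟩ else 0

/-- The bounded domain `𝔅 = {z ∈ M_n(ℂ) : ᵗz = -z, z^* z < 1}`, in coordinates. -/
def ball (n : ℕ) : Set (Coord n) := {v | (1 - (skew v).conjTranspose * skew v).PosDef}

/-- The invariant measure `δ(z)^{-n+1} ∏_{h<k} (i/2) dz_{hk} ∧ dz̄_{hk}` of `𝔅`, where
`δ(z) = det(1 - z^* z)`. -/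
def invMeasure (n : ℕ) : Measure (Coord n) :=
  (volume.restrict (ball n)).withDensity fun v =>
    ENNReal.ofReal ((1 - (skew v).conjTranspose * skew v).det.re ^ (1 - (n : ℤ)))

/-- The numbering of the rows of `z ∈ 𝔷`. -/
def num (m r : ℕ) : ZIdx m r ≃ Fin (2 * m + r) :=
  (Equiv.sumCongr finProdFinEquiv (Equiv.refl _)).trans finSumFinEquiv

/-- The unitary matrix `L = diag[i J'_m, 1_r]`, `J'_m = diag[J, …, J]`. -/
def L (m r : ℕ) : Matrix (ZIdx m r) (ZIdx m r) ℂ :=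
  Matrix.fromBlocks (Complex.I • (J ⊗ₖ (1 : Matrix (Fin m) (Fin m) ℂ))) 0 0 1

/-- The inverse `𝔅 → 𝔷` of the Cayley transform `𝔷 → 𝔅`, `z ↦ L (z - i)(z + i)⁻¹`. -/
def toZ {m r : ℕ} (v : Coord (2 * m + r)) : Matrix (ZIdx m r) (ZIdx m r) ℂ :=
  let c := (L m r).conjTranspose * (skew v).submatrix (num m r) (num m r)
  Complex.I • ((1 + c) * (1 - c)⁻¹)

open scoped Classical in
/-- Some `g ∈ G(ℝ)` with `g z_0 = z`, for `z ∈ 𝔷`. It is used only inside expressions that do not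
depend on the choice. -/
def lift (α β : ℤ) {m r : ℕ} (z : Matrix (ZIdx m r) (ZIdx m r) ℂ) : G α β m r ℝ :=
  if h : ∃ g : G α β m r ℝ, act g (z0 m r) = z then h.choose else 1

/-- `∫_{G_∞/K_∞} Φ(h) dh` converges absolutely, for a right `K_∞`-invariant `Φ`, where
`G_∞/K_∞ = 𝔷` through `h ↦ h z_0`, and `dh = d(h z_0)` is the invariant measure of `𝔷`,
transported from `𝔅`. -/
def IntegrableGK {α β : ℤ} {m r : ℕ} (Φ : G α β m r ℝ → ℂ) : Prop :=
  Integrable (fun v : Coord (2 * m + r) => Φ (lift α β (toZ v))) (invMeasure (2 * m + r))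

/-- The integral `∫_{G_∞/K_∞} Φ(h) dh`, for a right `K_∞`-invariant `Φ`. -/
def integralGK {α β : ℤ} {m r : ℕ} (Φ : G α β m r ℝ → ℂ) : ℂ :=
  ∫ v : Coord (2 * m + r), Φ (lift α β (toZ v)) ∂(invMeasure (2 * m + r))

/-! ### Modular forms -/

/-- Quaternionic modular forms of weight `k` and level `𝔫 = (N)`, as functions on
`G(𝔸) = G(𝔸_h) × G(ℝ)`. -/
structure IsModularForm {α β : ℤ} {m r : ℕ} (k : ℕ) (O : Subring (Quat α β ℚ)) (N : ℕ)
    (f : G α β m r AH × G α β m r ℝ → ℂ) : Prop where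
  /-- `f(g_h, z) = j(g_z, z_0)^k f(g_h g_z)`, `z = g_z z_0`, is holomorphic in `z ∈ 𝔷`. -/
  holomorphic : ∀ gh : G α β m r AH, DifferentiableOn ℂ
    (fun v : Coord (2 * m + r) =>
      j (lift α β (toZ v)) (z0 m r) ^ k * f (gh, lift α β (toZ v))) (ball (2 * m + r))
  /-- `f(γ g κ_∞ κ) = j(κ_∞, z_0)^{-k} f(g)` for `γ ∈ G(ℚ)`, with images `γh` and `γi` in
  `G(𝔸_h)` and `G(ℝ)`, `κ_∞ ∈ K_∞` and `κ ∈ K_1(𝔫)`. -/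
  equivariant : ∀ (γ : G α β m r ℚ) (γh : G α β m r AH) (γi : G α β m r ℝ),
    γh.val.val = γ.val.val.map (baseChange α β AH) →
    γi.val.val = γ.val.val.map (baseChange α β ℝ) →
    ∀ (gh : G α β m r AH) (gi : G α β m r ℝ), ∀ κ ∈ K1 m r O N, ∀ κi ∈ Kinf α β m r,
      f (γh * gh * κ, γi * gi * κi) = (j κi (z0 m r) ^ k)⁻¹ * f (gh, gi)

/-! ### The doubling embedding and the archimedean section -/

/-- The index set of each half of the complex coordinates of `G_{N,∞}`, `N = 2n`. -/
abbrev NIdx (m r : ℕ) : Type := Fin 2 × Idx m r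

/-- A complex `n × n` matrix, as a quaternionic one with entries in the centre. -/
def cent {m r : ℕ} (A : Matrix (Idx m r) (Idx m r) ℂ) : Matrix (NIdx m r) (NIdx m r) ℂ :=
  (1 : Matrix (Fin 2) (Fin 2) ℂ) ⊗ₖ A

/-- The matrix `R_∞`; over the quaternions, with block sizes `(m, r, m, m, r, m)`, its rows are
`(1,0,0,0,0,0)`, `(0,1/2,0,0,-𝐢⁻¹,0)`, `(0,0,0,1,0,0)`, `(0,0,-1,0,0,0)`,
`(0,-1/2,0,0,-𝐢⁻¹,0)`, `(0,0,0,0,0,1)`. -/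
def Rinf (m r : ℕ) : Matrix (NIdx m r ⊕ NIdx m r) (NIdx m r ⊕ NIdx m r) ℂ :=
  Matrix.fromBlocks
    (cent (blk m r 1 0 (1 / 2) 0 0)) (cent (blk m r 0 0 0 1 0) + J ⊗ₖ blk m r 0 0 1 0 0)
    (cent (blk m r 0 (-1) (-1 / 2) 0 0)) (cent (blk m r 0 0 0 0 1) + J ⊗ₖ blk m r 0 0 1 0 0)

/-- The doubling embedding `ρ(g₁, g₂) = R⁻¹ diag[g₁, g₂] R`. -/
def rho {m r : ℕ} (g₁ g₂ : Matrix (NIdx m r) (NIdx m r) ℂ) :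
    Matrix (NIdx m r ⊕ NIdx m r) (NIdx m r ⊕ NIdx m r) ℂ :=
  (Rinf m r)⁻¹ * Matrix.fromBlocks g₁ 0 0 g₂ * Rinf m r

/-- `τ_m`, with lower left block `(0, 0, 1_m)`, `(0, 0, 0)`, `(1_m, 0, 0)`. -/
def tau (m r : ℕ) : Matrix (NIdx m r ⊕ NIdx m r) (NIdx m r ⊕ NIdx m r) ℂ :=
  Matrix.fromBlocks 1 0 (cent (blk m r 0 1 0 1 0)) 1

/-- `κ_m`, with rows `(0, 0, -1_m)`, `(0, 1_r, 0)`, `(1_m, 0, 0)`. -/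
def kappa (m r : ℕ) : Matrix (NIdx m r) (NIdx m r) ℂ := cent (blk m r 0 (-1) 1 1 0)

/-- `τ̃_m = τ_m (1_n × κ_m)`. -/
def tauTilde (m r : ℕ) : Matrix (NIdx m r ⊕ NIdx m r) (NIdx m r ⊕ NIdx m r) ℂ :=
  tau m r * rho 1 (kappa m r)

/-- The normalization `S = diag[1_{2m}, 1/2, 1/2, 1_{2m}]`. -/
def S (m r : ℕ) : Matrix (NIdx m r) (NIdx m r) ℂ := cent (blk m r 1 0 (1 / 2) 0 1)

/-- The factor of automorphy `j(x, Z_0) = det(S⁻¹ (c Z_0 + d S))` of `x = [[a, b], [c, d]]` in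
`G_{N,∞}` at the origin `Z_0 = i 1_N`, the image of `(z_0, z_0)`; here `u_0 = S` in the
realization of the symmetric space of `G_{N,∞}`. -/
def jN {m r : ℕ} (x : Matrix (NIdx m r ⊕ NIdx m r) (NIdx m r ⊕ NIdx m r) ℂ) : ℂ :=
  ((S m r)⁻¹ * (x.toBlocks₂₁ * (Complex.I • 1) + x.toBlocks₂₂ * S m r)).det

/-- The archimedean section `φ_∞(x, s) = j(x, Z_0)^{-k} |j(x, Z_0)|^{k-s}`. -/
def phiInf {m r : ℕ} (k : ℕ) (x : Matrix (NIdx m r ⊕ NIdx m r) (NIdx m r ⊕ NIdx m r) ℂ)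
    (s : ℂ) : ℂ :=
  (jN x ^ k)⁻¹ * ((‖jN x‖ : ℝ) : ℂ) ^ ((k : ℂ) - s)

/-- `h_∞ ↦ φ_∞(τ̃_m (g_∞ × h_∞), s) f(h_h h_∞)`. -/
def integrand {α β : ℤ} {m r : ℕ} (k : ℕ) (f : G α β m r AH × G α β m r ℝ → ℂ)
    (hh : G α β m r AH) (g : G α β m r ℝ) (s : ℂ) (h : G α β m r ℝ) : ℂ :=
  phiInf k (tauTilde m r * rho (arch g.val.val) (arch h.val.val)) s * f (hh, h)

/-- `π^{n(n-1)/2} Γ(s+k-2n+3) Γ(s+k-2n+5) ⋯ Γ(s+k-1) / (Γ(s+k-n+2) Γ(s+k-n+3) ⋯ Γ(s+k))`. -/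
def gammaFactor (n k : ℕ) (s : ℂ) : ℂ :=
  (Real.pi : ℂ) ^ (n * (n - 1) / 2) *
    (∏ i ∈ Finset.Icc 1 (n - 1), Complex.Gamma (s + k - 2 * n + 1 + 2 * i)) /
    ∏ i ∈ Finset.Icc 1 (n - 1), Complex.Gamma (s + k - n + 1 + i)

end QMF

end

open scoped Quaternion Kronecker ComplexOrder
open MeasureTheory IsDedekindDomain
noncomputable section
namespace QMF

/-! ### Entrywise conjugation -/

/-! The statement is archimedean: the finite component stays fixed, and the integral is a
reproducing formula on the bounded domain 𝔅. Put n = 2m + r. A Cayley transform (`cay`) turns G(ℝ)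
into the group of matrices with block rows (A, -C̄), (C, Ā) that preserve the hermitian form diag(1,
-1) (`IsArch.ballCoord_eq`, `exists_isArch`). It acts on skew-symmetric z by z ↦ (C + Āz)(A -
C̄z)⁻¹. The base point goes to 0, and det A is the automorphy factor at 0. It is tied to δ(z) =
det(1 - z*z) by δ(h·0)|det A_h|² = 1 (`norm_det_bA`).

The doubled automorphy factor collapses to (-4)^m times the complex conjugate of det A for the
element g⁻¹h (`jN_arch`). After the substitution h ↦ gh, allowed because the measure is invariant
(`integral_comp_moebV`), the section φ_∞ equals a constant times δ(v)^{(s+k)/2} (det A_h)^k, with v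
= h·0 (`phiInf_eq`). The constant is `archConst`, which is the function a(s). The product (det
A_h)^k f(gh) depends only on v and is holomorphic in v (`IsModularForm.exists_holomorphic`); call it
F. The integral is thus a(s) ∫ δ^{(s+k)/2-n+1} F over 𝔅 with Lebesgue measure.

The domain, δ and Lebesgue measure are invariant under v ↦ e^{iθ}v. Averaging over θ and applying
the mean value property on each disc tv therefore replaces F by F(0) = f(g) (`integral_hua_mul`).
What remains is Hua's integral of a power of δ (`hua_integral`). It is computed by splitting off the
last column: over a point of the smaller domain the fibre is an ellipsoid, the linear image of a
unit ball of ℂⁿ, and δ factors (`exists_join_transform`). Each step contributes a Beta integral over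
that ball (`uball_integral`), and the product is `gammaFactor`.

For convergence, |δ^{k/2}F| is the absolute value of f, so for bounded f the integrand is dominated
by the Hua integrand of weight 0. That one is integrable for Re s > 2n - 3
(`integrable_hua_mul_of_bounded`). -/

/-- The entrywise complex conjugate of a matrix. -/
def cj {ι κ : Type*} (M : Matrix ι κ ℂ) : Matrix ι κ ℂ := M.map (starRingEnd ℂ)

section cj
variable {ι κ l : Type*}

@[simp] lemma cj_apply (M : Matrix ι κ ℂ) (i : ι) (k : κ) : cj M i k = starRingEnd ℂ (M i k) := rfl
@[simp] lemma cj_cj (M : Matrix ι κ ℂ) : cj (cj M) = M := by ext; simp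
@[simp] lemma cj_transpose (M : Matrix ι κ ℂ) : (cj M).transpose = M.conjTranspose := by
  ext; simp [Matrix.conjTranspose_apply]
@[simp] lemma cj_conjTranspose (M : Matrix ι κ ℂ) : (cj M).conjTranspose = M.transpose := by
  ext; simp [Matrix.conjTranspose_apply]
@[simp] lemma transpose_cj (M : Matrix ι κ ℂ) : cj M.transpose = M.conjTranspose := by
  ext; simp [Matrix.conjTranspose_apply]
@[simp] lemma conjTranspose_cj (M : Matrix ι κ ℂ) : cj M.conjTranspose = M.transpose := by
  ext; simp [Matrix.conjTranspose_apply]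
@[simp] lemma conjTranspose_transpose_eq (M : Matrix ι κ ℂ) :
    M.conjTranspose.transpose = cj M := rfl
@[simp] lemma transpose_conjTranspose_eq (M : Matrix ι κ ℂ) :
    M.transpose.conjTranspose = cj M := rfl
@[simp] lemma cj_add (M N : Matrix ι κ ℂ) : cj (M + N) = cj M + cj N := by ext; simp
@[simp] lemma cj_sub (M N : Matrix ι κ ℂ) : cj (M - N) = cj M - cj N := by ext; simp
@[simp] lemma cj_neg (M : Matrix ι κ ℂ) : cj (-M) = -cj M := by ext; simp
@[simp] lemma cj_zero : cj (0 : Matrix ι κ ℂ) = 0 := by ext; simp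
@[simp] lemma cj_smul (c : ℂ) (M : Matrix ι κ ℂ) : cj (c • M) = starRingEnd ℂ c • cj M := by
  ext; simp
@[simp] lemma cj_one [DecidableEq ι] : cj (1 : Matrix ι ι ℂ) = 1 := by
  ext i j; simp [Matrix.one_apply, apply_ite]
@[simp] lemma cj_mul [Fintype κ] (M : Matrix ι κ ℂ) (N : Matrix κ l ℂ) :
    cj (M * N) = cj M * cj N := by
  ext; simp [Matrix.mul_apply]

lemma det_cj [Fintype ι] [DecidableEq ι] (M : Matrix ι ι ℂ) :
    (cj M).det = starRingEnd ℂ M.det := by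
  exact ((starRingEnd ℂ).map_det M).symm

lemma cj_fromBlocks {ι' κ' : Type*} (A : Matrix ι κ ℂ) (B : Matrix ι κ' ℂ) (C : Matrix ι' κ ℂ)
    (D : Matrix ι' κ' ℂ) : cj (Matrix.fromBlocks A B C D) =
      Matrix.fromBlocks (cj A) (cj B) (cj C) (cj D) := by
  simp [cj, Matrix.fromBlocks_map]

end cj

/-! ### The group of the bounded domain -/

section BallPair
variable {ι : Type*} [Fintype ι] [DecidableEq ι]

/-- `(A, C)` is the first block column of an element of the automorphism group of `𝔅`. -/
structure BallPair (A C : Matrix ι ι ℂ) : Prop where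
  unit : A.conjTranspose * A - C.conjTranspose * C = 1
  skew : A.transpose * C + C.transpose * A = 0

/-- The element of the automorphism group of `𝔅` with first block column `(A, C)`. -/
def ballMat (A C : Matrix ι ι ℂ) : Matrix (ι ⊕ ι) (ι ⊕ ι) ℂ :=
  Matrix.fromBlocks A (-cj C) C (cj A)

/-- The denominator of the action on `𝔅`. -/
def den (A C z : Matrix ι ι ℂ) : Matrix ι ι ℂ := A - cj C * z

/-- The numerator of the action on `𝔅`. -/
def numer (A C z : Matrix ι ι ℂ) : Matrix ι ι ℂ := C + cj A * z

/-- The action on `𝔅`. -/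
def moeb (A C z : Matrix ι ι ℂ) : Matrix ι ι ℂ := numer A C z * (den A C z)⁻¹

/-- The bounded domain `𝔅`, as a set of matrices. -/
def IsBall (z : Matrix ι ι ℂ) : Prop :=
  z.transpose = -z ∧ (1 - z.conjTranspose * z).PosDef

variable {A C z : Matrix ι ι ℂ}

lemma BallPair.unit_cj (h : BallPair A C) : A.transpose * cj A - C.transpose * cj C = 1 := by
  simpa using congrArg cj h.unit

lemma BallPair.skew_cj (h : BallPair A C) :
    A.conjTranspose * cj C + C.conjTranspose * cj A = 0 := by
  simpa using congrArg cj h.skew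

/-- `den` and `numer` are the two blocks of `ballMat` applied to the column (1, z), and `ballMat`
preserves the hermitian form diag(1, -1). -/
lemma den_numer_herm (h : BallPair A C) (z : Matrix ι ι ℂ) :
    (den A C z).conjTranspose * den A C z - (numer A C z).conjTranspose * numer A C z =
      1 - z.conjTranspose * z := by
  simp only [den, numer, Matrix.conjTranspose_sub, Matrix.conjTranspose_add,
    Matrix.conjTranspose_mul, cj_conjTranspose]
  linear_combination (norm := noncomm_ring) h.unit - h.skew_cj * z
    - z.conjTranspose * h.skew - z.conjTranspose * h.unit_cj * z

/-- The companion for the invariant symmetric bilinear form: skewness of z says that the column (1,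
z) is isotropic. -/
lemma den_numer_skew (h : BallPair A C) (hz : z.transpose = -z) :
    (den A C z).transpose * numer A C z + (numer A C z).transpose * den A C z = 0 := by
  simp only [den, numer, Matrix.transpose_sub, Matrix.transpose_add,
    Matrix.transpose_mul, cj_transpose, hz]
  linear_combination (norm := noncomm_ring) h.skew + h.unit_cj * z
    - z * h.unit + z * h.skew_cj * z

/-- By `den_numer_herm`, den* den is 1 - z*z plus the positive semidefinite numer* numer, hence
positive definite. -/
lemma det_den_ne_zero (h : BallPair A C) (hz : (1 - z.conjTranspose * z).PosDef) :
    (den A C z).det ≠ 0 := by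
  have h1 : ((den A C z).conjTranspose * den A C z).PosDef := by
    have := den_numer_herm h z
    rw [sub_eq_iff_eq_add] at this
    rw [this]
    exact hz.add_posSemidef (Matrix.posSemidef_conjTranspose_mul_self _)
  have h2 := h1.det_pos.ne'
  rw [Matrix.det_mul] at h2
  exact right_ne_zero_of_mul h2

lemma BallPair.det_ne_zero (h : BallPair A C) : A.det ≠ 0 := by
  have := det_den_ne_zero (z := 0) h (by simpa using Matrix.PosDef.one)
  simpa [den] using this

lemma moeb_mul_den (h : BallPair A C) (hz : (1 - z.conjTranspose * z).PosDef) :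
    moeb A C z * den A C z = numer A C z := by
  rw [moeb, Matrix.mul_assoc, Matrix.nonsing_inv_mul _ (det_den_ne_zero h hz).isUnit,
    Matrix.mul_one]

lemma moeb_herm (h : BallPair A C) (hz : (1 - z.conjTranspose * z).PosDef) :
    1 - (moeb A C z).conjTranspose * moeb A C z =
      ((den A C z)⁻¹).conjTranspose * (1 - z.conjTranspose * z) * (den A C z)⁻¹ := by
  have h1 := Matrix.mul_nonsing_inv _ (det_den_ne_zero h hz).isUnit
  have h2 : ((den A C z)⁻¹).conjTranspose * (den A C z).conjTranspose = 1 := by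
    rw [← Matrix.conjTranspose_mul, h1, Matrix.conjTranspose_one]
  rw [← den_numer_herm h z, moeb, Matrix.conjTranspose_mul]
  calc _ = (((den A C z)⁻¹).conjTranspose * (den A C z).conjTranspose) *
        (den A C z * (den A C z)⁻¹) - ((den A C z)⁻¹).conjTranspose *
        (numer A C z).conjTranspose * (numer A C z * (den A C z)⁻¹) := by rw [h1, h2, Matrix.one_mul]
    _ = _ := by noncomm_ring

lemma moeb_isBall (h : BallPair A C) (hz : IsBall z) : IsBall (moeb A C z) := by
  have hd := (det_den_ne_zero h hz.2).isUnit
  have h1 := Matrix.mul_nonsing_inv _ hd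
  have h2 : ((den A C z)⁻¹).transpose * (den A C z).transpose = 1 := by
    rw [← Matrix.transpose_mul, h1, Matrix.transpose_one]
  refine ⟨?_, ?_⟩
  · rw [moeb, Matrix.transpose_mul, eq_neg_iff_add_eq_zero]
    calc _ = ((den A C z)⁻¹).transpose * (numer A C z).transpose * (den A C z * (den A C z)⁻¹)
          + (((den A C z)⁻¹).transpose * (den A C z).transpose) * numer A C z * (den A C z)⁻¹ := by
          rw [h1, h2]; noncomm_ring
      _ = ((den A C z)⁻¹).transpose * ((den A C z).transpose * numer A C z +
          (numer A C z).transpose * den A C z) * (den A C z)⁻¹ := by noncomm_ring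
      _ = 0 := by rw [den_numer_skew h hz.1]; simp
  · rw [moeb_herm h hz.2]
    refine hz.2.conjTranspose_mul_mul_same ?_
    rw [Matrix.mulVec_injective_iff_isUnit]
    exact (Matrix.isUnit_iff_isUnit_det _).2 (by simpa using hd)

lemma moeb_det (h : BallPair A C) (hz : (1 - z.conjTranspose * z).PosDef) :
    (1 - z.conjTranspose * z).det.re =
      (1 - (moeb A C z).conjTranspose * moeb A C z).det.re * ‖(den A C z).det‖ ^ 2 := by
  have hd := det_den_ne_zero h hz
  have h1 : (1 - z.conjTranspose * z) = (den A C z).conjTranspose *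
      (1 - (moeb A C z).conjTranspose * moeb A C z) * den A C z := by
    have h1 := Matrix.nonsing_inv_mul _ hd.isUnit
    have h2 : (den A C z).conjTranspose * ((den A C z)⁻¹).conjTranspose = 1 := by
      rw [← Matrix.conjTranspose_mul, h1, Matrix.conjTranspose_one]
    rw [moeb_herm h hz]
    calc _ = ((den A C z).conjTranspose * ((den A C z)⁻¹).conjTranspose) *
          (1 - z.conjTranspose * z) * ((den A C z)⁻¹ * den A C z) := by rw [h1, h2]; simp
      _ = _ := by noncomm_ring
  rw [h1, Matrix.det_mul, Matrix.det_mul, Matrix.det_conjTranspose, mul_right_comm,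
    ← Complex.ofReal_re (_ * _)]
  congr 1
  have h3 : star (den A C z).det * (den A C z).det = ((‖(den A C z).det‖ ^ 2 : ℝ) : ℂ) := by
    simpa using Complex.conj_mul' (den A C z).det
  -- The determinant of a hermitian matrix is real, so the real part passes through the product.
  have h4 : (1 - (moeb A C z).conjTranspose * moeb A C z).det =
      ((1 - (moeb A C z).conjTranspose * moeb A C z).det.re : ℂ) := by
    have hH : (1 - (moeb A C z).conjTranspose * moeb A C z).IsHermitian := by
      simp [Matrix.IsHermitian, Matrix.conjTranspose_mul]
    have := hH.det_eq_prod_eigenvalues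
    rw [this]
    simp [← Complex.ofReal_prod]
  rw [h3, h4]
  push_cast
  simp
  ring

/-- The four block identities are the two defining relations and their conjugates. -/
lemma BallPair.ballMat_inv (h : BallPair A C) :
    ballMat A.conjTranspose C.transpose * ballMat A C = 1 := by
  rw [ballMat, ballMat, Matrix.fromBlocks_multiply, ← Matrix.fromBlocks_one]
  simp only [transpose_cj, conjTranspose_cj]
  congr 1
  · rw [← h.unit]; noncomm_ring
  · linear_combination (norm := noncomm_ring) -h.skew_cj
  · linear_combination (norm := noncomm_ring) h.skew
  · linear_combination (norm := noncomm_ring) h.unit_cj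

/-- A left inverse of a square matrix is a right inverse; reading the product in the other order
gives the relations for the inverse pair. -/
lemma BallPair.inv (h : BallPair A C) : BallPair A.conjTranspose C.transpose := by
  have h1 := mul_eq_one_comm.1 h.ballMat_inv
  rw [ballMat, ballMat, Matrix.fromBlocks_multiply, ← Matrix.fromBlocks_one,
    Matrix.fromBlocks_inj] at h1
  simp only [transpose_cj, conjTranspose_cj] at h1
  refine ⟨?_, ?_⟩
  · simp only [Matrix.conjTranspose_conjTranspose, transpose_conjTranspose_eq]
    rw [← h1.1]; noncomm_ring
  · simp only [Matrix.transpose_transpose, conjTranspose_transpose_eq]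
    rw [← h1.2.2.1]; abel

/-- The cocycle relation for the denominator; the pair on the left is the first block column of a
product of two `ballMat`s. -/
lemma den_mul {A' C' : Matrix ι ι ℂ} (h' : BallPair A' C')
    (hz : (1 - z.conjTranspose * z).PosDef) :
    den (A * A' - cj C * C') (C * A' + cj A * C') z =
      den A C (moeb A' C' z) * den A' C' z := by
  have h1 := moeb_mul_den h' hz
  rw [den, den.eq_def A C, Matrix.sub_mul, Matrix.mul_assoc (cj C), h1]
  simp only [den, numer, cj_add, cj_mul, cj_cj]
  noncomm_ring

lemma numer_mul {A' C' : Matrix ι ι ℂ} (h' : BallPair A' C')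
    (hz : (1 - z.conjTranspose * z).PosDef) :
    numer (A * A' - cj C * C') (C * A' + cj A * C') z =
      numer A C (moeb A' C' z) * den A' C' z := by
  have h1 := moeb_mul_den h' hz
  rw [numer, numer.eq_def A C, Matrix.add_mul, Matrix.mul_assoc (cj A), h1]
  simp only [den, numer, cj_sub, cj_mul, cj_cj]
  noncomm_ring

lemma moeb_mul {A' C' : Matrix ι ι ℂ} (h' : BallPair A' C')
    (hz : (1 - z.conjTranspose * z).PosDef) :
    moeb (A * A' - cj C * C') (C * A' + cj A * C') z = moeb A C (moeb A' C' z) := by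
  rw [moeb, den_mul h' hz, numer_mul h' hz, Matrix.mul_inv_rev, Matrix.mul_assoc,
    ← Matrix.mul_assoc (den A' C' z), Matrix.mul_nonsing_inv _ (det_den_ne_zero h' hz).isUnit,
    Matrix.one_mul, moeb.eq_def A C]

lemma moeb_one (z : Matrix ι ι ℂ) : moeb 1 0 z = z := by
  simp [moeb, den, numer]

lemma moeb_inv_moeb (h : BallPair A C) (hz : (1 - z.conjTranspose * z).PosDef) :
    moeb A.conjTranspose C.transpose (moeb A C z) = z := by
  rw [← moeb_mul h hz]
  have h1 := h.ballMat_inv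
  rw [ballMat, ballMat, Matrix.fromBlocks_multiply, ← Matrix.fromBlocks_one,
    Matrix.fromBlocks_inj] at h1
  conv_rhs => rw [← moeb_one z]
  congr 1
  · rw [← h1.1]; noncomm_ring
  · rw [← h1.2.2.1]

/-- The factor on the left of the differential of the action. -/
lemma moeb_left (h : BallPair A C) (hz : IsBall z) :
    (den A C z).transpose * (cj A + moeb A C z * cj C) = 1 := by
  have h1 := moeb_mul_den h hz.2
  have h2 : (den A C z).transpose * moeb A C z = -(numer A C z).transpose := by
    have h3 := congrArg Matrix.transpose h1
    rw [Matrix.transpose_mul, (moeb_isBall h hz).1] at h3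
    rw [← h3]; noncomm_ring
  rw [Matrix.mul_add, ← Matrix.mul_assoc, h2]
  simp only [den, numer, Matrix.transpose_sub, Matrix.transpose_add,
    Matrix.transpose_mul, cj_transpose, hz.1]
  linear_combination (norm := noncomm_ring) h.unit_cj + z * h.skew_cj

lemma IsBall.zero : IsBall (0 : Matrix ι ι ℂ) := ⟨by simp, by simpa using Matrix.PosDef.one⟩

open scoped MatrixOrder in
lemma exists_conjTranspose_mul_self {P : Matrix ι ι ℂ} (hP : P.PosDef) :
    ∃ B : Matrix ι ι ℂ, IsUnit B.det ∧ P = B.conjTranspose * B := by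
  obtain ⟨B, hB⟩ := CStarAlgebra.nonneg_iff_eq_star_mul_self.mp hP.posSemidef.nonneg
  refine ⟨B, ?_, hB⟩
  have h2 := hP.det_pos.ne'
  rw [hB, Matrix.det_mul] at h2
  exact (right_ne_zero_of_mul h2).isUnit

/-- Transitivity: with 1 - z*z = B*B, the choice A = B⁻¹, C = zA gives an element that moves 0 to z.
-/
lemma IsBall.exists_ballPair (hz : IsBall z) :
    ∃ A : Matrix ι ι ℂ, BallPair A (z * A) := by
  obtain ⟨B, hu, hB⟩ := exists_conjTranspose_mul_self hz.2
  have h1 := Matrix.mul_nonsing_inv _ hu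
  have h2 : (B⁻¹).conjTranspose * B.conjTranspose = 1 := by
    rw [← Matrix.conjTranspose_mul, h1, Matrix.conjTranspose_one]
  refine ⟨B⁻¹, ?_, ?_⟩
  · rw [Matrix.conjTranspose_mul]
    calc _ = (B⁻¹).conjTranspose * (1 - z.conjTranspose * z) * B⁻¹ := by noncomm_ring
      _ = ((B⁻¹).conjTranspose * B.conjTranspose) * (B * B⁻¹) := by rw [hB]; noncomm_ring
      _ = 1 := by rw [h1, h2, Matrix.one_mul]
  · rw [Matrix.transpose_mul, hz.1]; noncomm_ring

lemma BallPair.moeb_zero (_h : BallPair A C) : moeb A C 0 = C * A⁻¹ := by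
  simp [moeb, den, numer]

end BallPair

/-! ### Invariance of the measure of the bounded domain -/

section Coord
variable {n : ℕ}

/-- The entries above the diagonal. -/
def unskew (z : Matrix (Fin n) (Fin n) ℂ) : Coord n := fun p => z p.1.1 p.1.2

lemma unskew_skew (v : Coord n) : unskew (skew v) = v := by
  ext p
  simp [unskew, skew, p.2]

lemma skew_transpose (v : Coord n) : (skew v).transpose = -skew v := by
  ext p q
  simp only [skew, Matrix.transpose_apply, Matrix.of_apply, Matrix.neg_apply]
  rcases lt_trichotomy p q with h | h | h
  · simp [h, h.not_gt]
  · simp [h]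
  · simp [h, h.not_gt]

lemma skew_unskew {z : Matrix (Fin n) (Fin n) ℂ} (hz : z.transpose = -z) :
    skew (unskew z) = z := by
  ext p q
  have h1 : ∀ a b, z b a = -z a b := fun a b => congrFun (congrFun hz a) b
  simp only [skew, Matrix.of_apply, unskew]
  rcases lt_trichotomy p q with h | h | h
  · simp [h]
  · subst h
    have := h1 p p
    simp
    linear_combination (-1/2 : ℂ) * this
  · simp [h, h.not_gt, h1 p q]

/-- `skew` as a linear map. -/
def skewLin (n : ℕ) : Coord n →ₗ[ℂ] Matrix (Fin n) (Fin n) ℂ where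
  toFun := skew
  map_add' v w := by
    ext p q
    simp only [skew, Matrix.of_apply, Matrix.add_apply, Pi.add_apply]
    split_ifs <;> ring
  map_smul' c v := by
    ext p q
    simp only [skew, Matrix.of_apply, Matrix.smul_apply, Pi.smul_apply]
    split_ifs <;> simp

/-- `unskew` as a linear map. -/
def unskewLin (n : ℕ) : Matrix (Fin n) (Fin n) ℂ →ₗ[ℂ] Coord n where
  toFun := unskew
  map_add' _ _ := rfl
  map_smul' _ _ := rfl

@[simp] lemma skewLin_apply (v : Coord n) : skewLin n v = skew v := rfl
@[simp] lemma unskewLin_apply (z : Matrix (Fin n) (Fin n) ℂ) : unskewLin n z = unskew z := rfl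
/-- The map `X ↦ ᵗM X M` on skew-symmetric matrices. -/
def congrLin (M : Matrix (Fin n) (Fin n) ℂ) : Coord n →ₗ[ℂ] Coord n where
  toFun v := unskew (M.transpose * skew v * M)
  map_add' v w := by
    rw [← skewLin_apply, map_add, Matrix.mul_add, Matrix.add_mul]; rfl
  map_smul' c v := by
    rw [← skewLin_apply, map_smul, Matrix.mul_smul, Matrix.smul_mul]; rfl

lemma congrLin_apply (M : Matrix (Fin n) (Fin n) ℂ) (v : Coord n) :
    congrLin M v = unskew (M.transpose * skew v * M) := rfl

lemma congrLin_mul (M N : Matrix (Fin n) (Fin n) ℂ) :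
    congrLin (M * N) = congrLin N ∘ₗ congrLin M := by
  refine LinearMap.ext fun v => ?_
  rw [LinearMap.comp_apply, congrLin_apply, congrLin_apply, congrLin_apply, skew_unskew]
  · simp only [Matrix.transpose_mul, Matrix.mul_assoc]
  · simp only [Matrix.transpose_mul, Matrix.mul_assoc, Matrix.transpose_transpose,
      skew_transpose, Matrix.mul_neg, Matrix.neg_mul]

lemma congrLin_one : congrLin (1 : Matrix (Fin n) (Fin n) ℂ) = LinearMap.id := by
  refine LinearMap.ext fun v => ?_
  simp [congrLin_apply, unskew_skew]

lemma det_congrLin_mul (M N : Matrix (Fin n) (Fin n) ℂ) :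
    (congrLin (M * N)).det = (congrLin M).det * (congrLin N).det := by
  rw [congrLin_mul, LinearMap.det_comp, mul_comm]

/-- Every index lies in exactly n - 1 unordered pairs; the proof symmetrizes to ordered pairs p ≠ q
and groups by the first entry. -/
lemma prod_pairs (D : Fin n → ℂ) :
    ∏ p : {p : Fin n × Fin n // p.1 < p.2}, (D p.1.1 * D p.1.2) = (∏ i, D i) ^ (n - 1) := by
  have h1 : ∏ p : Fin n × Fin n, (if p.1 < p.2 then D p.1 * D p.2 else 1) =
      ∏ p : {p : Fin n × Fin n // p.1 < p.2}, (D p.1.1 * D p.1.2) := by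
    rw [Finset.prod_ite, Finset.prod_const_one, mul_one]
    exact (Finset.prod_subtype _ (by simp) _)
  have h2 : ∏ p : Fin n × Fin n, (if p.1 < p.2 then D p.2 else 1) =
      ∏ p : Fin n × Fin n, (if p.2 < p.1 then D p.1 else 1) :=
    Fintype.prod_equiv (Equiv.prodComm _ _) _ _ (fun _ => rfl)
  have h3 : ∏ p : Fin n × Fin n, (if p.1 < p.2 then D p.1 * D p.2 else 1) =
      ∏ p : Fin n × Fin n, (if p.1 ≠ p.2 then D p.1 else 1) := by
    calc _ = ∏ p : Fin n × Fin n, ((if p.1 < p.2 then D p.1 else 1) *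
            (if p.1 < p.2 then D p.2 else 1)) := by
          refine Finset.prod_congr rfl fun p _ => ?_
          split_ifs <;> simp
      _ = _ := by
        rw [Finset.prod_mul_distrib, h2, ← Finset.prod_mul_distrib]
        refine Finset.prod_congr rfl fun p _ => ?_
        rcases lt_trichotomy p.1 p.2 with h | h | h
        · simp [h, h.not_gt, h.ne]
        · simp [h]
        · simp [h, h.not_gt, h.ne']
  rw [← h1, h3, Fintype.prod_prod_type, ← Finset.prod_pow]
  refine Finset.prod_congr rfl fun i _ => ?_
  simp only
  rw [Finset.prod_ite, Finset.prod_const_one, mul_one, Finset.prod_const]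
  congr 1
  simp [Finset.filter_ne]

lemma det_congrLin_diagonal (D : Fin n → ℂ) :
    (congrLin (Matrix.diagonal D)).det = (Matrix.diagonal D).det ^ (n - 1) := by
  have h : congrLin (Matrix.diagonal D) = Matrix.toLin' (Matrix.diagonal
      fun p : {p : Fin n × Fin n // p.1 < p.2} => D p.1.1 * D p.1.2) := by
    refine LinearMap.ext fun v => ?_
    ext p
    rw [Matrix.toLin'_apply, Matrix.mulVec_diagonal, congrLin_apply, unskew,
      Matrix.diagonal_transpose, Matrix.mul_diagonal, Matrix.diagonal_mul]
    simp only [skew, Matrix.of_apply, p.2, dif_pos]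
    ring
  rw [h, LinearMap.det_toLin', Matrix.det_diagonal, Matrix.det_diagonal, prod_pairs]

/-- Conjugation by the diagonal matrix D with a 2 in place i doubles the off-diagonal entry, so D t
D⁻¹ = t². By multiplicativity the determinant x satisfies x = x², and x ≠ 0. -/
lemma det_congrLin_transvection (t : Matrix.TransvectionStruct (Fin n) ℂ) :
    (congrLin t.toMatrix).det = 1 := by
  have h0 : (congrLin t.toMatrix).det ≠ 0 := by
    intro h
    have := det_congrLin_mul t.toMatrix t.inv.toMatrix
    rw [t.mul_inv, congrLin_one, LinearMap.det_id, h, zero_mul] at this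
    exact one_ne_zero this
  set D : Matrix (Fin n) (Fin n) ℂ := Matrix.diagonal fun i => if i = t.i then 2 else 1 with hD
  have h1 : D * t.toMatrix = t.toMatrix * t.toMatrix * D := by
    ext p q
    simp only [hD, Matrix.diagonal_mul, Matrix.mul_diagonal, Matrix.TransvectionStruct.toMatrix,
      Matrix.transvection_mul_transvection_same _ _ t.hij]
    simp only [Matrix.transvection, Matrix.add_apply, Matrix.one_apply, Matrix.single_apply]
    have := t.hij
    by_cases h1 : p = t.i
    · by_cases h2 : q = t.j
      · have h3 : q ≠ t.i := by rw [h2]; exact this.symm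
        have h4 : t.i ≠ t.j := this
        simp [h1, h2, h4, h4.symm]; ring
      · by_cases h3 : q = t.i <;> simp [h1, h3, Ne.symm h2, this.symm]
        simp [Ne.symm h3]
    · by_cases h3 : q = t.i <;> simp [h1, h3, Ne.symm h1]
  have h2 : (congrLin D).det ≠ 0 := by
    rw [hD, det_congrLin_diagonal, Matrix.det_diagonal]
    refine pow_ne_zero _ (Finset.prod_ne_zero_iff.2 fun i _ => ?_)
    split_ifs <;> norm_num
  have h3 := congrArg (fun M => (congrLin M).det) h1
  simp only [det_congrLin_mul] at h3
  have h4 : (congrLin D).det * (congrLin t.toMatrix).det * (1 - (congrLin t.toMatrix).det) = 0 := by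
    linear_combination h3
  rcases mul_eq_zero.1 h4 with h | h
  · exact absurd h (mul_ne_zero h2 h0)
  · exact (sub_eq_zero.1 h).symm

/-- Both sides are multiplicative in M, so diagonal matrices and transvections suffice. -/
lemma det_congrLin (M : Matrix (Fin n) (Fin n) ℂ) :
    (congrLin M).det = M.det ^ (n - 1) := by
  refine Matrix.diagonal_transvection_induction (fun M => (congrLin M).det = M.det ^ (n - 1)) M
    (fun D _ => det_congrLin_diagonal D) (fun t => ?_) (fun A B hA hB => ?_)
  · rw [det_congrLin_transvection, Matrix.TransvectionStruct.det, one_pow]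
  · rw [det_congrLin_mul, hA, hB, Matrix.det_mul, mul_pow]

end Coord

/-! ### Openness of the ball, derivative of the action, change of variables. -/

section Coord
variable {n : ℕ}

lemma mem_ball_iff {v : Coord n} : v ∈ ball n ↔ IsBall (skew v) :=
  ⟨fun h => ⟨skew_transpose v, h⟩, fun h => h.2⟩

/-- The function `det(1 - z^* z)`. -/
def delta (v : Coord n) : ℝ := (1 - (skew v).conjTranspose * skew v).det.re

lemma delta_pos {v : Coord n} (hv : v ∈ ball n) : 0 < delta v :=
  (Complex.pos_iff.1 (Matrix.PosDef.det_pos hv)).1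

lemma continuous_skew : Continuous (skew : Coord n → Matrix (Fin n) (Fin n) ℂ) :=
  (skewLin n).continuous_of_finiteDimensional

lemma continuous_delta : Continuous (delta : Coord n → ℝ) := by
  refine Complex.continuous_re.comp (Continuous.matrix_det ?_)
  exact continuous_const.sub (continuous_skew.matrix_conjTranspose.matrix_mul continuous_skew)

/-- Homogeneity reduces positivity to a compact set of vectors, as the openness of the ball
requires. -/
lemma posDef_iff_sphere {P : Matrix (Fin n) (Fin n) ℂ} (hP : P.IsHermitian) :
    P.PosDef ↔ ∀ x ∈ Metric.sphere (0 : Fin n → ℂ) 1, 0 < (star x ⬝ᵥ P.mulVec x).re := by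
  rw [Matrix.posDef_iff_dotProduct_mulVec]
  constructor
  · rintro ⟨_, h⟩ x hx
    have : x ≠ 0 := by
      rintro rfl
      simp at hx
    exact (Complex.pos_iff.1 (h this)).1
  · refine fun h => ⟨hP, fun x hx => ?_⟩
    have h0 : ‖x‖ ≠ 0 := norm_ne_zero_iff.2 hx
    have h1 := h ((‖x‖ : ℂ)⁻¹ • x) (by simp [norm_smul, h0])
    have h2 : star ((‖x‖ : ℂ)⁻¹ • x) ⬝ᵥ P.mulVec ((‖x‖ : ℂ)⁻¹ • x) =
        ((‖x‖⁻¹ ^ 2 : ℝ) : ℂ) * (star x ⬝ᵥ P.mulVec x) := by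
      rw [Matrix.mulVec_smul, star_smul, smul_dotProduct, dotProduct_smul]
      simp only [smul_eq_mul, star_inv₀, Complex.star_def, Complex.conj_ofReal]
      push_cast
      ring
    rw [h2, Complex.re_ofReal_mul] at h1
    have h3 : (star x ⬝ᵥ P.mulVec x).im = 0 := hP.im_star_dotProduct_mulVec_self x
    exact Complex.pos_iff.2 ⟨pos_of_mul_pos_right h1 (by positivity), h3.symm⟩

lemma isHermitian_one_sub (z : Matrix (Fin n) (Fin n) ℂ) :
    (1 - z.conjTranspose * z).IsHermitian := by
  simp [Matrix.IsHermitian, Matrix.conjTranspose_mul]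

lemma isOpen_ball : IsOpen (ball n) := by
  rw [isOpen_iff_mem_nhds]
  intro v hv
  have h1 := (posDef_iff_sphere (isHermitian_one_sub (skew v))).1 hv
  have hc : Continuous fun p : Coord n × (Fin n → ℂ) =>
      (star p.2 ⬝ᵥ (1 - (skew p.1).conjTranspose * skew p.1).mulVec p.2).re := by
    have h2 : Continuous fun p : Coord n × (Fin n → ℂ) => skew p.1 :=
      continuous_skew.comp continuous_fst
    exact Complex.continuous_re.comp (continuous_snd.star.dotProduct
      ((continuous_const.sub (h2.matrix_conjTranspose.matrix_mul h2)).matrix_mulVec continuous_snd))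
  -- Tube lemma: strict positivity at every point of the compact sphere persists for all nearby v
  -- simultaneously.
  have h2 := (isCompact_sphere (0 : Fin n → ℂ) 1).eventually_forall_of_forall_eventually
    (x₀ := v) (P := fun v x => 0 < (star x ⬝ᵥ (1 - (skew v).conjTranspose * skew v).mulVec x).re)
    (fun x hx => hc.continuousAt.eventually (lt_mem_nhds (h1 x hx)))
  filter_upwards [h2] with w hw
  exact (posDef_iff_sphere (isHermitian_one_sub (skew w))).2 hw

/-- The action on `𝔅`, in coordinates. -/
def moebV (A C : Matrix (Fin n) (Fin n) ℂ) (v : Coord n) : Coord n :=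
  unskew (moeb A C (skew v))

variable {A C : Matrix (Fin n) (Fin n) ℂ}

lemma skew_moebV (h : BallPair A C) {v : Coord n} (hv : v ∈ ball n) :
    skew (moebV A C v) = moeb A C (skew v) :=
  skew_unskew (moeb_isBall h (mem_ball_iff.1 hv)).1

lemma moebV_mem (h : BallPair A C) {v : Coord n} (hv : v ∈ ball n) : moebV A C v ∈ ball n := by
  rw [mem_ball_iff, skew_moebV h hv]
  exact moeb_isBall h (mem_ball_iff.1 hv)

lemma moebV_inv_moebV (h : BallPair A C) {v : Coord n} (hv : v ∈ ball n) :
    moebV A.conjTranspose C.transpose (moebV A C v) = v := by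
  rw [moebV, skew_moebV h hv, moeb_inv_moeb h hv, unskew_skew]

lemma moebV_moebV_inv (h : BallPair A C) {v : Coord n} (hv : v ∈ ball n) :
    moebV A C (moebV A.conjTranspose C.transpose v) = v := by
  simpa using moebV_inv_moebV h.inv hv

lemma moebV_injOn (h : BallPair A C) : Set.InjOn (moebV A C) (ball n) :=
  Set.LeftInvOn.injOn (f₁' := moebV A.conjTranspose C.transpose)
    fun _ hv => moebV_inv_moebV h hv

lemma moebV_image (h : BallPair A C) : moebV A C '' ball n = ball n := by
  refine Set.Subset.antisymm ?_ fun v hv =>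
    ⟨_, moebV_mem h.inv hv, moebV_moebV_inv h hv⟩
  rintro _ ⟨v, hv, rfl⟩
  exact moebV_mem h hv

lemma delta_moebV (h : BallPair A C) {v : Coord n} (hv : v ∈ ball n) :
    delta v = delta (moebV A C v) * ‖(den A C (skew v)).det‖ ^ 2 := by
  rw [delta, delta, skew_moebV h hv]
  exact moeb_det h hv

/-- An exact difference formula, with the left factor supplied by `moeb_left`; the differential at z
is read off by letting w tend to z. -/
lemma moeb_sub (h : BallPair A C) {z w : Matrix (Fin n) (Fin n) ℂ} (hz : IsBall z)
    (hw : IsBall w) : moeb A C w - moeb A C z =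
      ((den A C z)⁻¹).transpose * (w - z) * (den A C w)⁻¹ := by
  have h1 := moeb_left h hz
  have h2 : cj A + moeb A C z * cj C = ((den A C z)⁻¹).transpose := by
    rw [Matrix.transpose_nonsing_inv, Matrix.inv_eq_right_inv h1]
  have h3 : (moeb A C w - moeb A C z) * den A C w = ((den A C z)⁻¹).transpose * (w - z) := by
    rw [← h2, Matrix.sub_mul, moeb_mul_den h hw.2]
    have h4 := moeb_mul_den h hz.2
    simp only [den, numer] at h4 ⊢
    linear_combination (norm := noncomm_ring) -h4
  rw [← h3, Matrix.mul_assoc, Matrix.mul_nonsing_inv _ (det_den_ne_zero h hw.2).isUnit,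
    Matrix.mul_one]

-- In the product rule applied to `moeb_sub`, the derivative of den⁻¹ is multiplied by w - z, which
-- vanishes at the base point, so only X ↦ ᵗM X M with M = den⁻¹ survives. The derivative is taken
-- within the ball because the formula is available only there.
open scoped Matrix.Norms.Operator in
lemma hasFDerivWithinAt_moebV (h : BallPair A C) {v : Coord n} (hv : v ∈ ball n) :
    HasFDerivWithinAt (moebV A C)
      (congrLin (den A C (skew v))⁻¹).toContinuousLinearMap (ball n) v := by
  have hb := mem_ball_iff.1 hv
  have hd := det_den_ne_zero h hb.2
  set M := (den A C (skew v))⁻¹ with hM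
  have e1 : HasFDerivAt (fun w : Coord n => skew w) (skewLin n).toContinuousLinearMap v :=
    (skewLin n).toContinuousLinearMap.hasFDerivAt
  have e2 : HasFDerivAt (fun w : Coord n => M.transpose * (skew w - skew v))
      ((ContinuousLinearMap.mul ℂ _ M.transpose).comp (skewLin n).toContinuousLinearMap) v :=
    (ContinuousLinearMap.mul ℂ _ M.transpose).hasFDerivAt.comp v (e1.sub_const (skew v))
  have e3 : DifferentiableAt ℂ (fun w : Coord n => (den A C (skew w))⁻¹) v := by
    simp only [Matrix.nonsing_inv_eq_ringInverse]
    have hu : IsUnit (den A C (skew v)) := (Matrix.isUnit_iff_isUnit_det _).2 hd.isUnit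
    have : DifferentiableAt ℂ (fun w : Coord n => den A C (skew w)) v :=
      (differentiableAt_const _).sub ((differentiableAt_const _).mul e1.differentiableAt)
    exact DifferentiableAt.comp v
      (differentiableAt_inverse (𝕜 := ℂ) hu) this
  have e4 := e2.mul' e3.hasFDerivAt
  have e5 := ((unskewLin n).toContinuousLinearMap.hasFDerivAt.comp v e4).const_add (moebV A C v)
  refine (e5.hasFDerivWithinAt.congr (fun w hw => ?_) ?_).congr_fderiv ?_
  · have h1 := moeb_sub h hb (mem_ball_iff.1 hw)
    simp only [Function.comp_apply, LinearMap.coe_toContinuousLinearMap', moebV,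
      ← unskewLin_apply]
    rw [← map_add, hM, Pi.mul_apply, ← h1, add_sub_cancel]
  · simp [-unskewLin_apply]
  · ext1 w
    change unskewLin n ((M.transpose * (skew v - skew v)) *
      fderiv ℂ (fun w => (den A C (skew w))⁻¹) v w + (M.transpose * skew w) * M) = _
    rw [sub_self, mul_zero, zero_mul, zero_add]
    rfl

lemma abs_det_congrLin (M : Matrix (Fin n) (Fin n) ℂ) :
    |((congrLin M).toContinuousLinearMap.restrictScalars ℝ).det| =
      (‖M.det‖ ^ 2) ^ (n - 1) := by
  have : ((congrLin M).toContinuousLinearMap.restrictScalars ℝ).det =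
      (((congrLin M).restrictScalars ℝ)).det := rfl
  rw [this, LinearMap.det_restrictScalars, det_congrLin, map_pow, Algebra.norm_complex_apply,
    Complex.normSq_eq_norm_sq, abs_of_nonneg (by positivity)]

/-- This is the invariance of the measure: the real Jacobian |det den|^{-2(n-1)} cancels the change
of δ^{1-n}. -/
lemma delta_zpow_moebV (h : BallPair A C) {v : Coord n} (hv : v ∈ ball n) :
    (‖((den A C (skew v))⁻¹).det‖ ^ 2) ^ (n - 1) * delta (moebV A C v) ^ (1 - (n : ℤ)) =
      delta v ^ (1 - (n : ℤ)) := by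
  have hd := norm_ne_zero_iff.2 (det_den_ne_zero h (mem_ball_iff.1 hv).2)
  have hp := (delta_pos (moebV_mem h hv)).ne'
  rw [delta_moebV h hv, Matrix.det_nonsing_inv, Ring.inverse_eq_inv', norm_inv]
  -- The exponent n - 1 is truncated subtraction while 1 - n is an integer, so they are opposite
  -- only for n > 0.
  rcases Nat.eq_zero_or_pos n with hn | hn
  · subst hn
    simp
  · obtain ⟨k, rfl⟩ := Nat.exists_eq_succ_of_ne_zero hn.ne'
    have : (1 - ((k.succ : ℕ) : ℤ)) = -(k : ℤ) := by push_cast; ring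
    rw [this, zpow_neg, zpow_neg, zpow_natCast, zpow_natCast, mul_pow, mul_inv]
    simp
    ring

variable {E : Type*} [NormedAddCommGroup E] [NormedSpace ℝ E]

lemma measurable_delta_zpow :
    Measurable fun v : Coord n => (delta v ^ (1 - (n : ℤ))).toNNReal :=
  (continuous_delta.measurable.pow_const _).real_toNNReal

lemma integrable_invMeasure {Φ : Coord n → E} :
    Integrable Φ (invMeasure n) ↔
      IntegrableOn (fun v => delta v ^ (1 - (n : ℤ)) • Φ v) (ball n) := by
  have h : invMeasure n = (volume.restrict (ball n)).withDensity fun v =>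
      ((delta v ^ (1 - (n : ℤ))).toNNReal : ENNReal) := rfl
  rw [h, integrable_withDensity_iff_integrable_smul measurable_delta_zpow, IntegrableOn]
  refine integrable_congr ?_
  filter_upwards [ae_restrict_mem isOpen_ball.measurableSet] with v hv
  rw [NNReal.smul_def, Real.coe_toNNReal _ (zpow_pos (delta_pos hv) _).le]

lemma integral_invMeasure (Φ : Coord n → E) :
    ∫ v, Φ v ∂(invMeasure n) = ∫ v in ball n, delta v ^ (1 - (n : ℤ)) • Φ v := by
  have h : invMeasure n = (volume.restrict (ball n)).withDensity fun v =>
      ((delta v ^ (1 - (n : ℤ))).toNNReal : ENNReal) := rfl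
  rw [h, integral_withDensity_eq_integral_smul measurable_delta_zpow]
  refine integral_congr_ae ?_
  filter_upwards [ae_restrict_mem isOpen_ball.measurableSet] with v hv
  rw [NNReal.smul_def, Real.coe_toNNReal _ (zpow_pos (delta_pos hv) _).le]

lemma hasFDerivWithinAt_moebV_real (h : BallPair A C) {v : Coord n} (hv : v ∈ ball n) :
    HasFDerivWithinAt (moebV A C)
      ((congrLin (den A C (skew v))⁻¹).toContinuousLinearMap.restrictScalars ℝ) (ball n) v :=
  (hasFDerivWithinAt_moebV h hv).restrictScalars ℝ

lemma integrable_comp_moebV (h : BallPair A C) (Φ : Coord n → E) :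
    Integrable (fun v => Φ (moebV A C v)) (invMeasure n) ↔ Integrable Φ (invMeasure n) := by
  have h1 := integrableOn_image_iff_integrableOn_abs_det_fderiv_smul volume
    isOpen_ball.measurableSet (fun v hv => hasFDerivWithinAt_moebV_real h hv) (moebV_injOn h)
    (fun v => delta v ^ (1 - (n : ℤ)) • Φ v)
  rw [moebV_image h] at h1
  rw [integrable_invMeasure, integrable_invMeasure, h1]
  refine integrableOn_congr_fun (fun v hv => ?_) isOpen_ball.measurableSet
  rw [smul_smul, abs_det_congrLin, delta_zpow_moebV h hv]

lemma integral_comp_moebV (h : BallPair A C) (Φ : Coord n → E) :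
    ∫ v, Φ (moebV A C v) ∂(invMeasure n) = ∫ v, Φ v ∂(invMeasure n) := by
  have h1 := integral_image_eq_integral_abs_det_fderiv_smul volume
    isOpen_ball.measurableSet (fun v hv => hasFDerivWithinAt_moebV_real h hv) (moebV_injOn h)
    (fun v => delta v ^ (1 - (n : ℤ)) • Φ v)
  rw [moebV_image h] at h1
  rw [integral_invMeasure, integral_invMeasure, h1]
  refine setIntegral_congr_fun isOpen_ball.measurableSet (fun v hv => ?_)
  rw [smul_smul, abs_det_congrLin, delta_zpow_moebV h hv]

end Coord

/-! ### Beta-type integrals over complex unit balls -/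

section Fiber
variable {X Y E : Type*} [NormedAddCommGroup X] [NormedSpace ℝ X] [MeasurableSpace X] [BorelSpace X]
  [FiniteDimensional ℝ X] [MeasurableSpace Y] [NormedAddCommGroup E] [NormedSpace ℝ E]

lemma integral_comp_linearMap (μ : Measure X) [μ.IsAddHaarMeasure] {T : X →ₗ[ℝ] X}
    (hT : LinearMap.det T ≠ 0) (G : X → E) :
    ∫ x, G (T x) ∂μ = |(LinearMap.det T)|⁻¹ • ∫ x, G x ∂μ := by
  have he : MeasurableEmbedding T :=
    (LinearEquiv.ofIsUnitDet (v := Module.finBasis ℝ X) (v' := Module.finBasis ℝ X) (f := T)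
      (by rw [LinearMap.det_toMatrix]; exact hT.isUnit)).toContinuousLinearEquiv.toHomeomorph.measurableEmbedding
  rw [← he.integral_map, Measure.map_linearMap_addHaar_eq_smul_addHaar μ hT,
    integral_smul_measure, ENNReal.toReal_ofReal (abs_nonneg _), abs_inv]

lemma integrable_comp_linearMap (μ : Measure X) [μ.IsAddHaarMeasure] {T : X →ₗ[ℝ] X}
    (hT : LinearMap.det T ≠ 0) {G : X → ℂ} (hG : Integrable G μ) :
    Integrable (fun x => G (T x)) μ := by
  have he : MeasurableEmbedding T :=
    (LinearEquiv.ofIsUnitDet (v := Module.finBasis ℝ X) (v' := Module.finBasis ℝ X) (f := T)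
      (by rw [LinearMap.det_toMatrix]; exact hT.isUnit)).toContinuousLinearEquiv.toHomeomorph.measurableEmbedding
  refine (he.integrable_map_iff (g := G)).1 ?_
  rw [Measure.map_linearMap_addHaar_eq_smul_addHaar μ hT]
  exact hG.smul_measure ENNReal.ofReal_ne_top

/-- Integration over a product whose fibres are linear rescalings of one function. -/
lemma integral_fibered (μ : Measure X) [μ.IsAddHaarMeasure] (ν : Measure Y) [SFinite ν]
    {F : X × Y → ℂ} (hF : AEStronglyMeasurable F (μ.prod ν)) {G : X → ℂ} (hG : Integrable G μ)
    (B : Set Y) (c k : Y → ℂ) (T : Y → X →ₗ[ℝ] X) (hT : ∀ y ∈ B, LinearMap.det (T y) ≠ 0)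
    (hF1 : ∀ y ∈ B, ∀ x, F (x, y) = c y * G (T y x)) (hF0 : ∀ y ∉ B, ∀ x, F (x, y) = 0)
    (hk : Integrable k ν) (hk1 : ∀ y ∈ B, k y = c y * (|LinearMap.det (T y)|⁻¹ : ℝ))
    (hk0 : ∀ y ∉ B, k y = 0) :
    Integrable F (μ.prod ν) ∧ ∫ p, F p ∂(μ.prod ν) = (∫ y, k y ∂ν) * ∫ x, G x ∂μ := by
  have h1 : ∀ y, ∫ x, F (x, y) ∂μ = k y * ∫ x, G x ∂μ := by
    intro y
    by_cases hy : y ∈ B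
    · simp only [hF1 y hy, hk1 y hy]
      rw [integral_const_mul, integral_comp_linearMap μ (hT y hy), Complex.real_smul]
      ring
    · simp [hF0 y hy, hk0 y hy]
  have h2 : ∀ y, ∫ x, ‖F (x, y)‖ ∂μ = ‖k y‖ * ∫ x, ‖G x‖ ∂μ := by
    intro y
    by_cases hy : y ∈ B
    · simp only [hF1 y hy, hk1 y hy, norm_mul]
      rw [integral_const_mul, integral_comp_linearMap μ (hT y hy) (fun x => ‖G x‖), smul_eq_mul,
        Complex.norm_real, Real.norm_of_nonneg (by positivity)]
      ring
    · simp [hF0 y hy, hk0 y hy]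
  have h3 : Integrable F (μ.prod ν) := by
    rw [integrable_prod_iff' hF]
    refine ⟨Filter.Eventually.of_forall fun y => ?_, ?_⟩
    · by_cases hy : y ∈ B
      · simp only [hF1 y hy]
        exact (integrable_comp_linearMap μ (hT y hy) hG).const_mul _
      · simp [hF0 y hy]
    · simp only [h2]
      exact hk.norm.mul_const _
  refine ⟨h3, ?_⟩
  rw [integral_prod_symm _ h3]
  simp only [h1]
  rw [integral_mul_const]

end Fiber

/-- `(1 - t)^μ`, extended by zero to `t ≥ 1`. -/
def cutPow (μ : ℂ) (t : ℝ) : ℂ := if t < 1 then ((1 - t : ℝ) : ℂ) ^ μ else 0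

lemma measurable_cutPow (μ : ℂ) : Measurable (cutPow μ) := by
  refine Measurable.ite measurableSet_Iio ?_ measurable_const
  exact (Complex.measurable_ofReal.comp (measurable_const.sub measurable_id)).pow_const μ

/-- On (0, 1) the function -(1 - r²)^{μ+1} / (2(μ+1)) is an antiderivative, continuous up to r = 1
because Re μ > -1. -/
lemma cutPow_radial {μ : ℂ} (hμ : -1 < μ.re) :
    IntegrableOn (fun r : ℝ => r • cutPow μ (r ^ 2)) (Set.Ioi 0) ∧
      ∫ r in Set.Ioi (0 : ℝ), r • cutPow μ (r ^ 2) = 1 / (2 * (μ + 1)) := by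
  have hd : ∀ (ν : ℂ), ν ≠ -1 → ∀ r ∈ Set.Ioo (0 : ℝ) 1,
      HasDerivAt (fun r : ℝ => -((1 - r ^ 2 : ℝ) : ℂ) ^ (ν + 1) / (2 * (ν + 1)))
        (r * ((1 - r ^ 2 : ℝ) : ℂ) ^ ν) r := by
    intro ν hν r hr
    have hν' : ν + 1 ≠ 0 := fun h => hν (by linear_combination h)
    have hpos : 0 < 1 - r ^ 2 := by nlinarith [hr.1, hr.2]
    have h1 : HasDerivAt (fun r : ℝ => ((1 - r ^ 2 : ℝ) : ℂ)) (-2 * r) r := by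
      have := (((hasDerivAt_id r).pow 2).const_sub 1).ofReal_comp
      simpa using this
    have h2 := (((hasDerivAt_id ((1 - r ^ 2 : ℝ) : ℂ)).cpow_const (c := ν + 1)
      (Or.inl (by rw [id, Complex.ofReal_re]; exact hpos))).comp r h1).neg.div_const
      (2 * (ν + 1))
    refine h2.congr_deriv ?_
    rw [add_sub_cancel_right, id]
    field_simp
  have hc : ∀ (ν : ℂ), -1 < ν.re → ContinuousOn
      (fun r : ℝ => -((1 - r ^ 2 : ℝ) : ℂ) ^ (ν + 1) / (2 * (ν + 1))) (Set.Icc 0 1) := by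
    intro ν hν
    have h0 : 0 < (ν + 1).re := by simp; linarith
    have : Continuous fun r : ℝ => ((1 - r ^ 2 : ℝ) : ℂ) := by fun_prop
    intro r hr
    have h1 : 0 ≤ 1 - r ^ 2 := by nlinarith [hr.1, hr.2]
    have h2 : ContinuousAt (fun x : ℝ => (x : ℂ) ^ (ν + 1)) (1 - r ^ 2) := by
      exact (Complex.continuous_ofReal_cpow_const h0).continuousAt
    have h3 : ContinuousAt (fun r : ℝ => ((1 - r ^ 2 : ℝ) : ℂ) ^ (ν + 1)) r :=
      ContinuousAt.comp (f := fun r : ℝ => 1 - r ^ 2) h2 (by fun_prop)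
    exact (h3.neg.div_const _).continuousWithinAt
  have hne : ∀ {ν : ℂ}, -1 < ν.re → ν ≠ -1 := by
    rintro ν h rfl
    simp at h
  have hcut : ∀ r ∈ Set.Ioo (0 : ℝ) 1, r • cutPow μ (r ^ 2) = r * ((1 - r ^ 2 : ℝ) : ℂ) ^ μ := by
    intro r hr
    have : r ^ 2 < 1 := by nlinarith [hr.1, hr.2]
    rw [cutPow, if_pos this, Complex.real_smul]
  have hcut0 : ∀ r ∈ Set.Ioi (0 : ℝ) \ Set.Ioo 0 1, r • cutPow μ (r ^ 2) = 0 := by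
    intro r hr
    have h1 : 1 ≤ r := by
      by_contra h
      exact hr.2 ⟨hr.1, not_le.1 h⟩
    have : ¬ r ^ 2 < 1 := by nlinarith
    rw [cutPow, if_neg this, smul_zero]
  -- For the real exponent Re μ the integrand is a nonnegative derivative of a function continuous
  -- on [0, 1], hence integrable. It is also the norm of the complex integrand.
  have hreal : IntegrableOn (fun r : ℝ => r * (1 - r ^ 2) ^ μ.re) (Set.Ioc 0 1) := by
    have hcr := (Complex.continuous_re.comp_continuousOn (hc (μ.re : ℂ) (by simpa using hμ)))
    refine intervalIntegral.integrableOn_deriv_of_nonneg hcr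
      (fun r hr => ?_) (fun r hr => ?_)
    · have hpos : 0 < 1 - r ^ 2 := by nlinarith [hr.1, hr.2]
      have h1 := (Complex.reCLM.hasFDerivAt.comp_hasDerivAt r (hd (μ.re : ℂ) (hne (by simpa using hμ)) r hr))
      refine h1.congr_deriv ?_
      rw [← Complex.ofReal_cpow hpos.le, ← Complex.ofReal_mul]
      rfl
    · have hpos : 0 < 1 - r ^ 2 := by nlinarith [hr.1, hr.2]
      have := hr.1
      positivity
  have hint : IntegrableOn (fun r : ℝ => (r : ℂ) * ((1 - r ^ 2 : ℝ) : ℂ) ^ μ) (Set.Ioo 0 1) := by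
    refine Integrable.mono (hreal.mono_set Set.Ioo_subset_Ioc_self) ?_ ?_
    · refine Measurable.aestronglyMeasurable ?_
      exact Complex.measurable_ofReal.mul ((Complex.measurable_ofReal.comp
        (measurable_const.sub (measurable_id.pow_const 2))).pow_const μ)
    · filter_upwards [ae_restrict_mem measurableSet_Ioo] with r hr
      have hpos : 0 < 1 - r ^ 2 := by nlinarith [hr.1, hr.2]
      rw [norm_mul, norm_mul, Complex.norm_cpow_eq_rpow_re_of_pos hpos, Complex.norm_real,
        Real.norm_of_nonneg (Real.rpow_nonneg hpos.le _)]
  have hint2 : IntegrableOn (fun r : ℝ => r • cutPow μ (r ^ 2)) (Set.Ioo 0 1) :=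
    (integrableOn_congr_fun hcut measurableSet_Ioo).2 hint
  constructor
  · refine hint2.of_forall_sdiff_eq_zero measurableSet_Ioi hcut0
  · rw [setIntegral_eq_of_subset_of_forall_sdiff_eq_zero measurableSet_Ioi
      Set.Ioo_subset_Ioi_self hcut0, setIntegral_congr_fun measurableSet_Ioo hcut]
    have h1 := intervalIntegral.integral_eq_sub_of_hasDerivAt_of_le zero_le_one (hc μ hμ)
      (hd μ (hne hμ)) ((intervalIntegrable_iff_integrableOn_Ioo_of_le zero_le_one).2 hint)
    rw [intervalIntegral.integral_of_le zero_le_one, integral_Ioc_eq_integral_Ioo] at h1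
    rw [h1]
    have h0 : μ + 1 ≠ 0 := fun h => hne hμ (by linear_combination h)
    rw [show (1 : ℝ) - 1 ^ 2 = 0 by norm_num, show (1 : ℝ) - 0 ^ 2 = 1 by norm_num,
      Complex.ofReal_zero, Complex.zero_cpow h0, Complex.ofReal_one, Complex.one_cpow]
    ring

lemma disc_integral {μ : ℂ} (hμ : -1 < μ.re) :
    Integrable (fun x : ℂ => cutPow μ (‖x‖ ^ 2)) ∧
      ∫ x : ℂ, cutPow μ (‖x‖ ^ 2) = Real.pi / (μ + 1) := by
  obtain ⟨h1, h2⟩ := cutPow_radial hμ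
  constructor
  · have := (integrable_fun_norm_addHaar (volume : Measure ℂ) (f := fun r => cutPow μ (r ^ 2))).2
      (by simpa using h1)
    exact this
  · have := integral_fun_norm_addHaar (volume : Measure ℂ) (fun r => cutPow μ (r ^ 2))
    rw [this]
    simp only [Complex.finrank_real_complex, Nat.add_one_sub_one, pow_one, h2, Measure.real,
      Complex.volume_ball]
    have h0 : μ + 1 ≠ 0 := by
      intro h
      have := congrArg Complex.re h
      simp at this
      linarith
    simp
    field_simp

/-- The squared euclidean norm. -/
def sqn {d : ℕ} (w : Fin d → ℂ) : ℝ := ∑ i, ‖w i‖ ^ 2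

lemma continuous_sqn {d : ℕ} : Continuous (sqn : (Fin d → ℂ) → ℝ) := by
  unfold sqn; fun_prop

/-- For fixed w with |w| < 1 the first coordinate runs over a disc of radius √(1 - |w|²). Rescaling
it contributes π/(μ+1) and raises the exponent of 1 - |w|² to μ + 1, so the induction must keep μ
free. -/
lemma uball_integral (d : ℕ) : ∀ {μ : ℂ}, -1 < μ.re →
    Integrable (fun w : Fin d → ℂ => cutPow μ (sqn w)) ∧
      ∫ w : Fin d → ℂ, cutPow μ (sqn w) =
        (Real.pi : ℂ) ^ d * (Complex.Gamma (μ + 1) / Complex.Gamma (μ + d + 1)) := by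
  induction d with
  | zero =>
    intro μ hμ
    have h0 : Complex.Gamma (μ + 1) ≠ 0 :=
      Complex.Gamma_ne_zero_of_re_pos (by simp; linarith)
    simp [sqn, cutPow, h0, Measure.volume_pi_eq_dirac (fun i : Fin 0 => (0 : ℂ))]
  | succ d ih =>
    intro μ hμ
    have hpres := volume_preserving_piFinSuccAbove (fun _ : Fin (d + 1) => ℂ) 0
    have hF := integral_fibered (volume : Measure ℂ) (volume : Measure (Fin d → ℂ))
      (F := fun p => cutPow μ (‖p.1‖ ^ 2 + sqn p.2)) ?_ (disc_integral hμ).1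
      {w | sqn w < 1} (fun w => cutPow μ (sqn w)) (fun w => cutPow (μ + 1) (sqn w))
      (fun w => (√(1 - sqn w))⁻¹ • LinearMap.id) ?_ ?_ ?_
      (ih (μ := μ + 1) (by simp; linarith)).1 ?_ ?_
    · have e : (fun w : Fin (d + 1) → ℂ => cutPow μ (sqn w)) =
          (fun p : ℂ × (Fin d → ℂ) => cutPow μ (‖p.1‖ ^ 2 + sqn p.2)) ∘
            (MeasurableEquiv.piFinSuccAbove (fun _ : Fin (d + 1) => ℂ) 0) := by
        funext w
        simp [sqn, Fin.sum_univ_succ, MeasurableEquiv.piFinSuccAbove, Fin.insertNthEquiv,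
          Fin.tail]
      rw [e]
      refine ⟨hpres.integrable_comp_of_integrable hF.1, ?_⟩
      have h2 := hpres.integral_comp (MeasurableEquiv.measurableEmbedding _)
        (fun p : ℂ × (Fin d → ℂ) => cutPow μ (‖p.1‖ ^ 2 + sqn p.2))
      refine h2.trans (hF.2.trans ?_)
      rw [(ih (μ := μ + 1) (by simp; linarith)).2, (disc_integral hμ).2]
      have h0 : μ + 1 ≠ 0 := by
        intro h
        have := congrArg Complex.re h
        simp at this
        linarith
      rw [Complex.Gamma_add_one (μ + 1) h0]
      push_cast
      rw [show μ + 1 + d + 1 = μ + (d + 1) + 1 by ring, pow_succ]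
      field_simp
    · exact ((measurable_cutPow μ).comp ((measurable_fst.norm.pow_const 2).add
        (continuous_sqn.measurable.comp measurable_snd))).aestronglyMeasurable
    · intro w hw
      have : 0 < 1 - sqn w := sub_pos.2 hw
      rw [LinearMap.det_smul, LinearMap.det_id]
      positivity
    · intro w hw x
      have hw : sqn w < 1 := hw
      have hp : 0 < 1 - sqn w := sub_pos.2 hw
      have h1 : ‖((√(1 - sqn w))⁻¹ • (LinearMap.id : ℂ →ₗ[ℝ] ℂ)) x‖ ^ 2 =
          ‖x‖ ^ 2 / (1 - sqn w) := by
        rw [LinearMap.smul_apply, LinearMap.id_apply, norm_smul, mul_pow, norm_inv, inv_pow,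
          Real.norm_of_nonneg (Real.sqrt_nonneg _), Real.sq_sqrt hp.le]
        field_simp
      rw [h1]
      simp only [cutPow]
      rw [if_pos hw]
      by_cases h : ‖x‖ ^ 2 + sqn w < 1
      · have h2 : ‖x‖ ^ 2 / (1 - sqn w) < 1 := by rw [div_lt_one hp]; linarith
        rw [if_pos h, if_pos h2, ← Complex.mul_cpow_ofReal_nonneg hp.le (by linarith),
          ← Complex.ofReal_mul]
        congr 2
        field_simp
        ring
      · have h2 : ¬ ‖x‖ ^ 2 / (1 - sqn w) < 1 := by rw [div_lt_one hp]; linarith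
        rw [if_neg h, if_neg h2, mul_zero]
    · intro w hw x
      have hw : ¬ sqn w < 1 := hw
      have : ¬ ‖x‖ ^ 2 + sqn w < 1 := by nlinarith [sq_nonneg ‖x‖]
      simp [cutPow, this]
    · intro w hw
      have hw : sqn w < 1 := hw
      have hp : 0 < 1 - sqn w := sub_pos.2 hw
      simp only [cutPow]
      rw [if_pos hw, if_pos hw, LinearMap.det_smul, LinearMap.det_id, mul_one,
        Complex.finrank_real_complex, inv_pow, Real.sq_sqrt hp.le, abs_inv, inv_inv,
        abs_of_pos hp, Complex.cpow_add _ _ (by exact_mod_cast hp.ne'), Complex.cpow_one]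
    · intro w hw
      have hw : ¬ sqn w < 1 := hw
      simp [cutPow, hw]

/-! ### The integral of `det(1 - z^* z)^λ` over `𝔅` -/

lemma fromBlocks_sub {l m n o : Type*} (A A' : Matrix n l ℂ) (B B' : Matrix n m ℂ)
    (C C' : Matrix o l ℂ) (D D' : Matrix o m ℂ) :
    Matrix.fromBlocks A B C D - Matrix.fromBlocks A' B' C' D' =
      Matrix.fromBlocks (A - A') (B - B') (C - C') (D - D') := by
  ext (i | i) (j | j) <;> rfl

section Join
variable {n : ℕ}

/-- The column with entries `u`. -/
def col (u : Fin n → ℂ) : Matrix (Fin n) (Fin 1) ℂ := Matrix.of fun i _ => u i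

/-- The skew-symmetric block matrix with blocks `z₁`, `u`, `-ᵗu`, `0`. -/
def joinMat (z₁ : Matrix (Fin n) (Fin n) ℂ) (u : Fin n → ℂ) :
    Matrix (Fin n ⊕ Fin 1) (Fin n ⊕ Fin 1) ℂ :=
  Matrix.fromBlocks z₁ (col u) (-(col u).transpose) 0

lemma sqn_eq (w : Fin n → ℂ) : (col w).conjTranspose * col w = (sqn w : ℂ) • 1 := by
  ext i j
  have : i = j := Subsingleton.elim _ _
  subst this
  simp only [Matrix.mul_apply, Matrix.conjTranspose_apply, col, Matrix.of_apply, sqn,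
    Matrix.smul_apply, Matrix.one_apply_eq, smul_eq_mul, mul_one, Complex.ofReal_sum,
    Complex.ofReal_pow]
  exact Finset.sum_congr rfl fun k _ => Complex.conj_mul' _

/-- An alternating form vanishes on equal arguments: the 1 × 1 matrix is its own transpose and also
the negative of it. -/
lemma skew_form_col {P : Matrix (Fin n) (Fin n) ℂ} (hP : P + P.transpose = 0) (u : Fin n → ℂ) :
    (col u).transpose * P * col u = 0 := by
  have h1 : ((col u).transpose * P * col u).transpose = (col u).transpose * P * col u := by
    ext i j
    rw [Subsingleton.elim i j]; rfl
  have h2 : ((col u).transpose * P * col u).transpose = -((col u).transpose * P * col u) := by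
    rw [Matrix.transpose_mul, Matrix.transpose_mul, Matrix.transpose_transpose,
      ← neg_eq_of_add_eq_zero_right hP, Matrix.neg_mul, Matrix.mul_neg, Matrix.mul_assoc]
  rw [h1] at h2
  ext i j
  have := congrFun (congrFun h2 i) j
  rw [Matrix.neg_apply] at this
  rw [Matrix.zero_apply]
  linear_combination (1 / 2 : ℂ) * this

lemma joinMat_zero_herm (w : Fin n → ℂ) :
    1 - (joinMat 0 w).conjTranspose * joinMat 0 w =
      Matrix.fromBlocks (1 - cj (col w) * (col w).transpose) 0 0 (((1 - sqn w : ℝ) : ℂ) • 1) := by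
  rw [joinMat, Matrix.fromBlocks_conjTranspose, Matrix.fromBlocks_multiply, ← Matrix.fromBlocks_one,
    fromBlocks_sub]
  simp only [Matrix.conjTranspose_zero, Matrix.zero_mul, Matrix.mul_zero, zero_add, add_zero,
    sub_zero, Matrix.conjTranspose_neg, transpose_conjTranspose_eq, Matrix.neg_mul, Matrix.mul_neg,
    neg_neg, neg_zero, sub_zero, sqn_eq]
  congr 1
  push_cast
  rw [sub_smul, one_smul]

/-- Each diagonal block contributes one factor 1 - |w|²: the rank-one block by det(1 - XY) = det(1 -
YX), the corner directly. -/
lemma joinMat_zero_det (w : Fin n → ℂ) :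
    (1 - (joinMat 0 w).conjTranspose * joinMat 0 w).det = ((1 - sqn w : ℝ) : ℂ) ^ 2 := by
  rw [joinMat_zero_herm, Matrix.det_fromBlocks_zero₂₁, Matrix.det_one_sub_mul_comm,
    ← conjTranspose_transpose_eq, ← Matrix.transpose_mul, sqn_eq, Matrix.det_smul, sq]
  simp

lemma joinMat_zero_isBall (w : Fin n → ℂ) : IsBall (joinMat 0 w) ↔ sqn w < 1 := by
  constructor
  · intro h
    have h1 := h.2.diag_pos (i := Sum.inr 0)
    rw [joinMat_zero_herm] at h1
    simp only [Matrix.fromBlocks_apply₂₂, Matrix.smul_apply, Matrix.one_apply_eq, smul_eq_mul,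
      mul_one] at h1
    have := Complex.zero_lt_real.1 h1
    linarith
  · intro h
    have hs : (joinMat 0 w).transpose = -joinMat 0 w := by
      simp [joinMat, Matrix.fromBlocks_transpose, Matrix.fromBlocks_neg]
    refine ⟨hs, ?_⟩
    have hps : (1 - (joinMat 0 w).conjTranspose * joinMat 0 w).PosSemidef := by
      -- The rank-one matrix W below satisfies W² = |w|² W, so 1 - W has the hermitian square root 1
      -- - W/(1 + t). This exhibits the form as Q*Q; the nonzero determinant then upgrades it to
      -- positive definite.
      set t : ℝ := √(1 - sqn w) with ht
      have ht2 : t ^ 2 = 1 - sqn w := Real.sq_sqrt (by linarith)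
      have ht0 : (1 + t : ℂ) ≠ 0 := by
        have : (1 + t : ℝ) ≠ 0 := by positivity
        exact_mod_cast this
      have ht3 : (t : ℂ) ^ 2 = 1 - sqn w := by exact_mod_cast ht2
      set W := cj (col w) * (col w).transpose with hW
      have hWH : W.conjTranspose = W := by
        rw [hW, Matrix.conjTranspose_mul, cj_conjTranspose, transpose_conjTranspose_eq]
      have hWW : W * W = (sqn w : ℂ) • W := by
        have h1 : (col w).transpose * cj (col w) = (sqn w : ℂ) • 1 := by
          simpa [Matrix.transpose_mul] using congrArg Matrix.transpose (sqn_eq w)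
        rw [hW, Matrix.mul_assoc, ← Matrix.mul_assoc (col w).transpose, h1]
        simp
      have hQ : 1 - (joinMat 0 w).conjTranspose * joinMat 0 w =
          (Matrix.fromBlocks (1 - ((1 + t : ℂ)⁻¹) • W) 0 0 ((t : ℂ) • 1)).conjTranspose *
            Matrix.fromBlocks (1 - ((1 + t : ℂ)⁻¹) • W) 0 0 ((t : ℂ) • 1) := by
        rw [joinMat_zero_herm, Matrix.fromBlocks_conjTranspose, Matrix.fromBlocks_multiply]
        simp only [Matrix.conjTranspose_zero, Matrix.zero_mul, Matrix.mul_zero, add_zero, zero_add,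
          Matrix.conjTranspose_sub, Matrix.conjTranspose_one, Matrix.conjTranspose_smul, hWH]
        have hst : star ((1 + t : ℂ)⁻¹) = (1 + t : ℂ)⁻¹ := by simp
        have hst' : star (t : ℂ) = t := by simp
        rw [hst, hst']
        congr 1
        · rw [← hW, Matrix.sub_mul, Matrix.mul_sub, Matrix.mul_sub, Matrix.smul_mul,
            Matrix.smul_mul, Matrix.mul_smul, Matrix.mul_smul, hWW]
          simp only [Matrix.one_mul, Matrix.mul_one, smul_smul]
          have : (1 + t : ℂ)⁻¹ * ((1 + t : ℂ)⁻¹ * sqn w) = 2 * (1 + t : ℂ)⁻¹ - 1 := by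
            rw [show (sqn w : ℂ) = 1 - t ^ 2 by rw [ht3]; ring]
            field_simp
            ring
          rw [this]
          module
        · simp only [Matrix.smul_mul, Matrix.mul_smul, Matrix.one_mul, smul_smul]
          congr 1
          push_cast
          linear_combination -ht3
      rw [hQ]
      exact Matrix.posSemidef_conjTranspose_mul_self _
    rw [hps.posDef_iff_det_ne_zero, joinMat_zero_det]
    have : (1 - sqn w : ℝ) ≠ 0 := by linarith
    exact pow_ne_zero _ (by exact_mod_cast this)

variable {A C z₁ : Matrix (Fin n) (Fin n) ℂ}

lemma BallPair.extend (h : BallPair A C) :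
    BallPair (Matrix.fromBlocks A 0 0 (1 : Matrix (Fin 1) (Fin 1) ℂ))
      (Matrix.fromBlocks C 0 0 (0 : Matrix (Fin 1) (Fin 1) ℂ)) := by
  constructor
  · rw [Matrix.fromBlocks_conjTranspose, Matrix.fromBlocks_multiply,
      Matrix.fromBlocks_conjTranspose, Matrix.fromBlocks_multiply, fromBlocks_sub]
    simp [h.unit]
  · rw [Matrix.fromBlocks_transpose, Matrix.fromBlocks_multiply,
      Matrix.fromBlocks_transpose, Matrix.fromBlocks_multiply, Matrix.fromBlocks_add]
    simp [h.skew]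

/-- Extending the element by 1 on the last coordinate makes it act on the larger domain. It moves z₁
to 0 and the column u to Āu, and `den_numer_herm` then compares the two hermitian matrices. -/
lemma joinMat_transform (h : BallPair A C) (hz : IsBall z₁) (h0 : moeb A C z₁ = 0)
    (u : Fin n → ℂ) :
    1 - (joinMat z₁ u).conjTranspose * joinMat z₁ u =
      (Matrix.fromBlocks (den A C z₁) (-(cj C * col u)) 0 1).conjTranspose *
        (1 - (joinMat 0 ((cj A).mulVec u)).conjTranspose * joinMat 0 ((cj A).mulVec u)) *
        Matrix.fromBlocks (den A C z₁) (-(cj C * col u)) 0 1 := by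
  have e1 : den (Matrix.fromBlocks A 0 0 (1 : Matrix (Fin 1) (Fin 1) ℂ))
      (Matrix.fromBlocks C 0 0 0) (joinMat z₁ u) =
      Matrix.fromBlocks (den A C z₁) (-(cj C * col u)) 0 1 := by
    rw [den, joinMat, cj_fromBlocks, Matrix.fromBlocks_multiply, fromBlocks_sub]
    simp [den]
  have hn : C + cj A * z₁ = 0 := by
    have := moeb_mul_den h hz.2
    rw [h0, Matrix.zero_mul] at this
    exact this.symm
  have hl : (den A C z₁).transpose * cj A = 1 := by
    have := moeb_left h hz
    rwa [h0, Matrix.zero_mul, add_zero] at this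
  have hl' : A.conjTranspose * den A C z₁ = 1 := by
    simpa [Matrix.transpose_mul] using congrArg Matrix.transpose hl
  have hcol : col ((cj A).mulVec u) = cj A * col u := by
    ext i j; simp [col, Matrix.mul_apply, Matrix.mulVec, dotProduct]
  have e2 : numer (Matrix.fromBlocks A 0 0 (1 : Matrix (Fin 1) (Fin 1) ℂ))
      (Matrix.fromBlocks C 0 0 0) (joinMat z₁ u) =
      joinMat 0 ((cj A).mulVec u) * Matrix.fromBlocks (den A C z₁) (-(cj C * col u)) 0 1 := by
    rw [numer, joinMat, joinMat, cj_fromBlocks, Matrix.fromBlocks_multiply, Matrix.fromBlocks_add,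
      Matrix.fromBlocks_multiply, hcol, Matrix.transpose_mul, cj_transpose]
    -- The corner of the image is the alternating form A*C̄ evaluated on u, which is why the image
    -- again has the shape `joinMat`.
    have h5 : (col u).transpose * A.conjTranspose * (cj C * col u) = 0 := by
      have := skew_form_col (P := A.conjTranspose * cj C)
        (by simpa [Matrix.transpose_mul] using h.skew_cj) u
      rw [← this]; simp only [Matrix.mul_assoc]
    simp only [cj_zero, cj_one, Matrix.zero_mul, Matrix.mul_zero, zero_add, add_zero,
      Matrix.one_mul, Matrix.mul_one, Matrix.neg_mul, Matrix.mul_neg, neg_zero, h5, hn]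
    rw [Matrix.mul_assoc, hl', Matrix.mul_one]
  have h3 := den_numer_herm h.extend (joinMat z₁ u)
  rw [e1, e2, Matrix.conjTranspose_mul] at h3
  rw [← h3]
  noncomm_ring

lemma joinMat_transpose (hz : z₁.transpose = -z₁) (u : Fin n → ℂ) :
    (joinMat z₁ u).transpose = -joinMat z₁ u := by
  simp [joinMat, Matrix.fromBlocks_transpose, Matrix.fromBlocks_neg, hz]

lemma joinMat_isBall (h : BallPair A C) (hz : IsBall z₁) (h0 : moeb A C z₁ = 0)
    (u : Fin n → ℂ) : IsBall (joinMat z₁ u) ↔ sqn ((cj A).mulVec u) < 1 := by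
  rw [← joinMat_zero_isBall]
  have hd : IsUnit (Matrix.fromBlocks (den A C z₁) (-(cj C * col u)) 0
      (1 : Matrix (Fin 1) (Fin 1) ℂ)) := by
    rw [Matrix.isUnit_iff_isUnit_det, Matrix.det_fromBlocks_zero₂₁]
    simpa using det_den_ne_zero h hz.2
  rw [IsBall, IsBall, joinMat_transform h hz h0 u]
  have h1 := joinMat_transpose (z₁ := (0 : Matrix (Fin n) (Fin n) ℂ)) (by simp)
    ((cj A).mulVec u)
  simp only [joinMat_transpose hz.1, h1, true_and]
  exact Matrix.IsUnit.posDef_star_left_conjugate_iff hd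

lemma joinMat_det (h : BallPair A C) (hz : IsBall z₁) (h0 : moeb A C z₁ = 0)
    (u : Fin n → ℂ) : (1 - (joinMat z₁ u).conjTranspose * joinMat z₁ u).det.re =
      (1 - z₁.conjTranspose * z₁).det.re * (1 - sqn ((cj A).mulVec u)) ^ 2 := by
  have h1 := moeb_det h hz.2
  rw [h0] at h1
  rw [h1, joinMat_transform h hz h0 u, Matrix.det_mul, Matrix.det_mul, joinMat_zero_det,
    Matrix.det_conjTranspose, Matrix.det_fromBlocks_zero₂₁, mul_right_comm]
  have h3 : star (den A C z₁).det * (den A C z₁).det = ((‖(den A C z₁).det‖ ^ 2 : ℝ) : ℂ) := by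
    simpa using Complex.conj_mul' (den A C z₁).det
  simp only [Matrix.det_one, mul_one, h3]
  rw [← Complex.ofReal_pow, ← Complex.ofReal_mul, Complex.ofReal_re]
  simp

end Join

/-! ### Recursion for Hua's integral by removing the last column. -/

section Hua
variable {n : ℕ}

/-- The pairs `p < q` in `Fin (n + 1)`, sorted by whether `q` is the last index. -/
def pairEquiv (n : ℕ) : Fin n ⊕ {p : Fin n × Fin n // p.1 < p.2} ≃
    {p : Fin (n + 1) × Fin (n + 1) // p.1 < p.2} :=
  Equiv.ofBijective
    (Sum.elim (fun i => ⟨(i.castSucc, Fin.last n), Fin.castSucc_lt_last i⟩)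
      fun p => ⟨(p.1.1.castSucc, p.1.2.castSucc), by simpa using p.2⟩) <| by
    constructor
    · rintro (i | ⟨⟨p, q⟩, h⟩) (i' | ⟨⟨p', q'⟩, h'⟩) hh
      · simpa using hh
      · simp only [Sum.elim_inl, Sum.elim_inr, Subtype.mk.injEq, Prod.mk.injEq] at hh
        exact absurd hh.2.symm (Fin.castSucc_lt_last _).ne
      · simp only [Sum.elim_inl, Sum.elim_inr, Subtype.mk.injEq, Prod.mk.injEq] at hh
        exact absurd hh.2 (Fin.castSucc_lt_last _).ne
      · simpa using hh
    · rintro ⟨⟨p, q⟩, h⟩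
      obtain ⟨i, rfl⟩ := Fin.exists_castSucc_eq.2 (h.trans_le (Fin.le_last q)).ne
      rcases Fin.eq_castSucc_or_eq_last q with ⟨k, rfl⟩ | rfl
      · exact ⟨.inr ⟨(i, k), by simpa using h⟩, rfl⟩
      · exact ⟨.inl i, rfl⟩

/-- Skew-symmetric matrices of size `n + 1` as pairs of a vector and a skew-symmetric matrix. -/
def joinEquiv (n : ℕ) : (Fin n → ℂ) × Coord n ≃ᵐ Coord (n + 1) :=
  (MeasurableEquiv.sumPiEquivProdPi (fun _ : Fin n ⊕ {p : Fin n × Fin n // p.1 < p.2} => ℂ)).symm.trans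
    (MeasurableEquiv.piCongrLeft (fun _ => ℂ) (pairEquiv n))

lemma joinEquiv_preserving (n : ℕ) : MeasurePreserving (joinEquiv n) :=
  (volume_measurePreserving_sumPiEquivProdPi_symm _).trans
    (volume_measurePreserving_piCongrLeft _ (pairEquiv n))

lemma joinEquiv_last (u : Fin n → ℂ) (v : Coord n) (i : Fin n) (h) :
    joinEquiv n (u, v) ⟨(i.castSucc, Fin.last n), h⟩ = u i :=
  MeasurableEquiv.piCongrLeft_apply_apply (pairEquiv n) (β := fun _ => ℂ) _ (Sum.inl i)

lemma joinEquiv_castSucc (u : Fin n → ℂ) (v : Coord n) (i k : Fin n) (h : i < k) (h') :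
    joinEquiv n (u, v) ⟨(i.castSucc, k.castSucc), h'⟩ = v ⟨(i, k), h⟩ :=
  MeasurableEquiv.piCongrLeft_apply_apply (pairEquiv n) (β := fun _ => ℂ) _ (Sum.inr ⟨(i, k), h⟩)

lemma skew_joinEquiv (u : Fin n → ℂ) (v : Coord n) :
    (skew (joinEquiv n (u, v))).submatrix finSumFinEquiv finSumFinEquiv = joinMat (skew v) u := by
  have e1 : ∀ i : Fin n, finSumFinEquiv (Sum.inl i : Fin n ⊕ Fin 1) = i.castSucc := fun _ => rfl
  have e2 : ∀ i : Fin 1, finSumFinEquiv (Sum.inr i : Fin n ⊕ Fin 1) = Fin.last n := by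
    intro i; rw [Subsingleton.elim i 0]; rfl
  ext (i | i) (k | k)
  · simp only [Matrix.submatrix_apply, e1, joinMat, Matrix.fromBlocks_apply₁₁, skew,
      Matrix.of_apply, Fin.castSucc_lt_castSucc_iff]
    split_ifs with h1 h2
    · exact joinEquiv_castSucc u v i k h1 _
    · rw [joinEquiv_castSucc u v k i h2 _]
    · rfl
  · simp only [Matrix.submatrix_apply, e1, e2, joinMat, Matrix.fromBlocks_apply₁₂, skew,
      Matrix.of_apply, Fin.castSucc_lt_last, dif_pos]
    exact joinEquiv_last u v i _
  · have h : ¬ (Fin.last n < k.castSucc) := (Fin.castSucc_lt_last k).not_gt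
    simp only [Matrix.submatrix_apply, e1, e2, joinMat, Matrix.fromBlocks_apply₂₁, skew,
      Matrix.of_apply, Fin.castSucc_lt_last, dif_pos, h, not_false_eq_true, dif_neg]
    rw [joinEquiv_last u v k _]
    rfl
  · simp only [Matrix.submatrix_apply, e2, joinMat, Matrix.fromBlocks_apply₂₂, skew,
      Matrix.of_apply, lt_irrefl, not_false_eq_true, dif_neg]
    rfl

section Reindex
variable {ι κ : Type*} [Fintype ι] [DecidableEq ι] [Fintype κ] [DecidableEq κ]

lemma one_sub_submatrix (e : κ ≃ ι) (z : Matrix ι ι ℂ) :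
    (1 - z.conjTranspose * z).submatrix e e =
      1 - (z.submatrix e e).conjTranspose * z.submatrix e e := by
  ext i k
  rw [Matrix.conjTranspose_submatrix, Matrix.submatrix_mul_equiv]
  simp [Matrix.one_apply]

lemma IsBall.submatrix (e : κ ≃ ι) {z : Matrix ι ι ℂ} (h : IsBall z) :
    IsBall (z.submatrix e e) := by
  refine ⟨?_, ?_⟩
  · rw [Matrix.transpose_submatrix, h.1]; rfl
  · rw [← one_sub_submatrix]
    exact h.2.submatrix e.injective

lemma isBall_submatrix (e : κ ≃ ι) (z : Matrix ι ι ℂ) : IsBall (z.submatrix e e) ↔ IsBall z :=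
  ⟨fun h => by simpa using h.submatrix e.symm, fun h => h.submatrix e⟩

lemma det_one_sub_submatrix (e : κ ≃ ι) (z : Matrix ι ι ℂ) :
    (1 - (z.submatrix e e).conjTranspose * z.submatrix e e).det =
      (1 - z.conjTranspose * z).det := by
  rw [← one_sub_submatrix, Matrix.det_submatrix_equiv_self]

end Reindex

/-- `det(1 - z^* z)^λ` on `𝔅`, extended by zero. -/
def huaFun (n : ℕ) (l : ℂ) : Coord n → ℂ := (ball n).indicator fun v => (delta v : ℂ) ^ l

lemma measurable_huaFun (l : ℂ) : Measurable (huaFun n l) :=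
  ((Complex.measurable_ofReal.comp continuous_delta.measurable).pow_const l).indicator
    isOpen_ball.measurableSet

lemma mem_ball_join {u : Fin n → ℂ} {v : Coord n} :
    joinEquiv n (u, v) ∈ ball (n + 1) ↔ IsBall (joinMat (skew v) u) := by
  rw [mem_ball_iff, ← skew_joinEquiv, isBall_submatrix]

lemma delta_join (u : Fin n → ℂ) (v : Coord n) : delta (joinEquiv n (u, v)) =
    (1 - (joinMat (skew v) u).conjTranspose * joinMat (skew v) u).det.re := by
  rw [delta, ← skew_joinEquiv, det_one_sub_submatrix]

/-- The upper left block of 1 - Z*Z for the joined matrix Z is 1 - z*z minus a positive semidefinite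
rank-one term, which is added back. -/
lemma isBall_of_joinMat {u : Fin n → ℂ} {z : Matrix (Fin n) (Fin n) ℂ} (hz : z.transpose = -z)
    (h : IsBall (joinMat z u)) : IsBall z := by
  refine ⟨hz, ?_⟩
  have h1 := h.2.submatrix (e := Sum.inl) Sum.inl_injective
  have h2 := h1.add_posSemidef
    (Matrix.posSemidef_conjTranspose_mul_self (col u).transpose)
  convert h2 using 1
  ext i k
  simp [joinMat, Matrix.fromBlocks_conjTranspose, Matrix.fromBlocks_multiply, Matrix.one_apply]
  ring

lemma exists_moeb_eq_zero {z : Matrix (Fin n) (Fin n) ℂ} (hz : IsBall z) :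
    ∃ A C : Matrix (Fin n) (Fin n) ℂ, BallPair A C ∧ moeb A C z = 0 := by
  obtain ⟨A, hA⟩ := hz.exists_ballPair
  have h0 : moeb A (z * A) 0 = z := by
    rw [hA.moeb_zero, Matrix.mul_assoc, Matrix.mul_nonsing_inv _ hA.det_ne_zero.isUnit,
      Matrix.mul_one]
  refine ⟨_, _, hA.inv, ?_⟩
  have := moeb_inv_moeb hA IsBall.zero.2
  rwa [h0] at this

/-- T is multiplication by Ā for an element that moves v to 0. There ᵗden · Ā = 1 and δ(v) = |det
den|², while the real determinant of T is |det A|²; hence the volume factor δ(v). -/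
lemma exists_join_transform (v : Coord n) (hv : v ∈ ball n) :
    ∃ T : (Fin n → ℂ) →ₗ[ℝ] (Fin n → ℂ), |LinearMap.det T|⁻¹ = delta v ∧
      ∀ u, (IsBall (joinMat (skew v) u) ↔ sqn (T u) < 1) ∧
        delta (joinEquiv n (u, v)) = delta v * (1 - sqn (T u)) ^ 2 := by
  have hz := mem_ball_iff.1 hv
  obtain ⟨A, C, h, h0⟩ := exists_moeb_eq_zero hz
  refine ⟨(Matrix.toLin' (cj A)).restrictScalars ℝ, ?_, fun u =>
    ⟨joinMat_isBall h hz h0 u, ?_⟩⟩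
  · rw [LinearMap.det_restrictScalars, LinearMap.det_toLin', Algebra.norm_complex_apply,
      Complex.normSq_eq_norm_sq, abs_of_nonneg (by positivity), delta, moeb_det h hz.2, h0]
    have hl := moeb_left h hz
    rw [h0, Matrix.zero_mul, add_zero] at hl
    have := congrArg (fun M => ‖Matrix.det M‖) hl
    simp only [Matrix.det_mul, Matrix.det_transpose, norm_mul, Matrix.det_one, norm_one] at this
    simp only [Matrix.conjTranspose_zero, Matrix.mul_zero, sub_zero, Matrix.det_one,
      Complex.one_re, one_mul]
    rw [← inv_pow]
    congr 1
    exact inv_eq_of_mul_eq_one_left this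
  · rw [delta_join]
    exact joinMat_det h hz h0 u

/-- Along a fibre δ^l becomes δ(v)^l (1 - |Tu|²)^{2l}, which explains the parameter 2l of the ball
integral; the Jacobian adds one to the exponent of δ(v). -/
lemma hua_step {l : ℂ} (hl : -1 < (2 * l).re) (ih : Integrable (huaFun n (l + 1))) :
    Integrable (huaFun (n + 1) l) ∧ ∫ v, huaFun (n + 1) l v = (∫ v, huaFun n (l + 1) v) *
      ((Real.pi : ℂ) ^ n * (Complex.Gamma (2 * l + 1) / Complex.Gamma (2 * l + n + 1))) := by
  classical
  choose! T hT1 hT2 using exists_join_transform (n := n)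
  have hu := uball_integral n hl
  have hF := integral_fibered (volume : Measure (Fin n → ℂ)) (volume : Measure (Coord n))
    (F := fun p => huaFun (n + 1) l (joinEquiv n p))
    ((measurable_huaFun l).comp (joinEquiv n).measurable).aestronglyMeasurable hu.1
    (ball n) (fun v => (delta v : ℂ) ^ l) (huaFun n (l + 1)) T ?_ ?_ ?_ ih ?_ ?_
  · constructor
    · exact ((joinEquiv_preserving n).integrable_comp_emb (joinEquiv n).measurableEmbedding).1 hF.1
    · rw [← hu.2, ← hF.2]
      exact ((joinEquiv_preserving n).integral_comp (joinEquiv n).measurableEmbedding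
        (huaFun (n + 1) l)).symm
  · intro v hv h0
    have := hT1 v hv
    rw [h0, abs_zero, inv_zero] at this
    exact (delta_pos hv).ne this
  · intro v hv u
    obtain ⟨h1, h2⟩ := hT2 v hv u
    rw [← mem_ball_join] at h1
    simp only [huaFun, cutPow]
    by_cases h : sqn (T v u) < 1
    · have hp : 0 < 1 - sqn (T v u) := by linarith
      rw [Set.indicator_of_mem (h1.2 h), if_pos h, h2, Complex.ofReal_mul,
        Complex.mul_cpow_ofReal_nonneg (delta_pos hv).le (by positivity)]
      congr 1
      rw [sq, Complex.ofReal_mul, Complex.mul_cpow_ofReal_nonneg hp.le hp.le,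
        ← Complex.cpow_add _ _ (by exact_mod_cast hp.ne'), ← two_mul]
    · rw [Set.indicator_of_notMem (fun hh => h (h1.1 hh)), if_neg h, mul_zero]
  · intro v hv u
    refine Set.indicator_of_notMem (fun hh => hv ?_) _
    exact mem_ball_iff.2 (isBall_of_joinMat (skew_transpose v) (mem_ball_join.1 hh))
  · intro v hv
    rw [huaFun, Set.indicator_of_mem hv, hT1 v hv, Complex.cpow_add _ _
      (by exact_mod_cast (delta_pos hv).ne'), Complex.cpow_one]
  · intro v hv
    exact Set.indicator_of_notMem hv _

/-- Passing to n + 1 shifts the running index by one and adds the factor i = 1. For n = 0 both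
products stay empty and the new quotient is Γ/Γ at s + k + 1, where the hypothesis excludes a zero
denominator. -/
lemma gammaFactor_succ (n k : ℕ) (s : ℂ) (h : 0 < (s + k + 1).re) :
    gammaFactor (n + 1) k s = gammaFactor n k s *
      ((Real.pi : ℂ) ^ n * (Complex.Gamma (s + k - 2 * n + 1) / Complex.Gamma (s + k - n + 1))) := by
  rcases n with _ | n
  · have : Complex.Gamma (s + k + 1) ≠ 0 := Complex.Gamma_ne_zero_of_re_pos h
    simp [gammaFactor, this]
  · have e1 : (n + 1 + 1) * (n + 1 + 1 - 1) / 2 = (n + 1) * (n + 1 - 1) / 2 + (n + 1) := by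
      rw [show (n + 1 + 1) * (n + 1 + 1 - 1) = (n + 1) * (n + 1 - 1) + (n + 1) * 2 by
        simp only [Nat.add_sub_cancel]; ring]
      exact Nat.add_mul_div_right _ _ (by norm_num)
    rw [gammaFactor, gammaFactor, e1]
    simp only [Nat.add_sub_cancel]
    have e2 : ∀ (m : ℕ) (g : ℕ → ℂ), ∏ i ∈ Finset.Icc 1 m, g i = ∏ i ∈ Finset.range m, g (i + 1) := by
      intro m g
      rw [← Finset.Ico_add_one_right_eq_Icc, Finset.prod_Ico_eq_prod_range]
      simp [add_comm]
    simp only [e2]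
    rw [Finset.prod_range_succ', Finset.prod_range_succ']
    have e3 : ∏ i ∈ Finset.range n, Complex.Gamma
        (s + k - 2 * ((n + 1 + 1 : ℕ) : ℂ) + 1 + 2 * ((i + 1 + 1 : ℕ) : ℂ)) =
        ∏ i ∈ Finset.range n, Complex.Gamma
        (s + k - 2 * ((n + 1 : ℕ) : ℂ) + 1 + 2 * ((i + 1 : ℕ) : ℂ)) :=
      Finset.prod_congr rfl fun i _ => by congr 1; push_cast; ring
    have e4 : ∏ i ∈ Finset.range n, Complex.Gamma
        (s + k - ((n + 1 + 1 : ℕ) : ℂ) + 1 + ((i + 1 + 1 : ℕ) : ℂ)) =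
        ∏ i ∈ Finset.range n, Complex.Gamma
        (s + k - ((n + 1 : ℕ) : ℂ) + 1 + ((i + 1 : ℕ) : ℂ)) :=
      Finset.prod_congr rfl fun i _ => by congr 1; push_cast; ring
    rw [e3, e4, pow_add]
    have e5 : s + k - 2 * ((n + 1 + 1 : ℕ) : ℂ) + 1 + 2 * ((0 + 1 : ℕ) : ℂ) =
      s + k - 2 * ((n + 1 : ℕ) : ℂ) + 1 := by push_cast; ring
    have e6 : s + k - ((n + 1 + 1 : ℕ) : ℂ) + 1 + ((0 + 1 : ℕ) : ℂ) =
      s + k - ((n + 1 : ℕ) : ℂ) + 1 := by push_cast; ring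
    rw [e5, e6]
    ring

/-- The exponent is arranged so that adding 1 to it in size n + 1 gives the exponent in size n. The
last step needs Re(s + k) - 2n > -1, which is the stated bound in size n + 1. -/
lemma hua_integral (n k : ℕ) (s : ℂ) (h : 0 < (s + k).re + 1) (h' : 2 * (n : ℝ) - 3 < (s + k).re) :
    Integrable (huaFun n ((s + k) / 2 - n + 1)) ∧
      ∫ v, huaFun n ((s + k) / 2 - n + 1) v = gammaFactor n k s := by
  induction n with
  | zero =>
    have e : huaFun 0 ((s + k) / 2 - (0 : ℕ) + 1) = fun _ => 1 := by
      funext v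
      have hv : v ∈ ball 0 := by
        rw [mem_ball_iff, Subsingleton.elim (skew v) 0]
        exact IsBall.zero
      rw [huaFun, Set.indicator_of_mem hv, delta]
      simp
    rw [e]
    have : (volume : Measure (Coord 0)) = Measure.dirac 0 :=
      Measure.volume_pi_eq_dirac _
    rw [this]
    simp [gammaFactor]
  | succ n ih =>
    have h1 := ih (by push_cast at h'; linarith)
    have e : (s + k) / 2 - ((n + 1 : ℕ) : ℂ) + 1 + 1 = (s + k) / 2 - n + 1 := by push_cast; ring
    have e2 : 2 * ((s + k) / 2 - ((n + 1 : ℕ) : ℂ) + 1) = s + k - 2 * n := by push_cast; ring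
    have h2 := hua_step (n := n) (l := (s + k) / 2 - ((n + 1 : ℕ) : ℂ) + 1) ?_ (by rw [e]; exact h1.1)
    · refine ⟨h2.1, ?_⟩
      rw [h2.2, e, h1.2, e2, gammaFactor_succ n k s (by simpa using h)]
      congr 4
      ring
    · rw [e2]
      push_cast at h'
      simp at h' ⊢
      linarith

end Hua

/-! ### The mean value property -/

section MeanValue
variable {n : ℕ}

lemma skew_smul (c : ℂ) (v : Coord n) : skew (c • v) = c • skew v := (skewLin n).map_smul c v

/-- 1 - |c|² z*z differs from 1 - z*z by the positive semidefinite matrix (1 - |c|²) z*z. -/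
lemma smul_mem_ball {v : Coord n} (hv : v ∈ ball n) {c : ℂ} (hc : ‖c‖ ≤ 1) :
    c • v ∈ ball n := by
  have h0 : star c * c = ((‖c‖ ^ 2 : ℝ) : ℂ) := by
    simpa using Complex.conj_mul' c
  have h1 : (0 : ℂ) ≤ ((1 - ‖c‖ ^ 2 : ℝ) : ℂ) := by
    rw [Complex.zero_le_real]
    nlinarith [norm_nonneg c]
  have h2 : 1 - (skew (c • v)).conjTranspose * skew (c • v) =
      (1 - (skew v).conjTranspose * skew v) +
        ((1 - ‖c‖ ^ 2 : ℝ) : ℂ) • ((skew v).conjTranspose * skew v) := by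
    rw [skew_smul, Matrix.conjTranspose_smul, Matrix.smul_mul, Matrix.mul_smul, smul_smul, h0]
    push_cast
    module
  change (1 - (skew (c • v)).conjTranspose * skew (c • v)).PosDef
  rw [h2]
  exact Matrix.PosDef.add_posSemidef hv
    ((Matrix.posSemidef_conjTranspose_mul_self (skew v)).smul h1)

lemma smul_mem_ball_iff {v : Coord n} {c : ℂ} (hc : ‖c‖ = 1) : c • v ∈ ball n ↔ v ∈ ball n := by
  have h0 : c ≠ 0 := by rintro rfl; simp at hc
  refine ⟨fun h => ?_, fun h => smul_mem_ball h hc.le⟩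
  have := smul_mem_ball h (c := c⁻¹) (by simp [hc])
  rwa [smul_smul, inv_mul_cancel₀ h0, one_smul] at this

lemma delta_smul (v : Coord n) {c : ℂ} (hc : ‖c‖ = 1) : delta (c • v) = delta v := by
  have h0 : star c * c = 1 := by
    simpa [hc] using Complex.conj_mul' c
  rw [delta, delta, skew_smul, Matrix.conjTranspose_smul, Matrix.smul_mul, Matrix.mul_smul,
    smul_smul, h0, one_smul]

lemma huaFun_smul (l : ℂ) (v : Coord n) {c : ℂ} (hc : ‖c‖ = 1) :
    huaFun n l (c • v) = huaFun n l v := by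
  by_cases hv : v ∈ ball n
  · rw [huaFun, Set.indicator_of_mem hv, Set.indicator_of_mem ((smul_mem_ball_iff hc).2 hv),
      delta_smul v hc]
  · rw [huaFun, Set.indicator_of_notMem hv,
      Set.indicator_of_notMem (fun h => hv ((smul_mem_ball_iff hc).1 h))]

lemma measurePreserving_unit_smul {c : ℂ} (hc : ‖c‖ = 1) :
    MeasurePreserving (fun v : Coord n => c • v) := by
  refine ⟨(continuous_const_smul c).measurable, ?_⟩
  have hd : LinearMap.det ((c • LinearMap.id : Coord n →ₗ[ℂ] Coord n).restrictScalars ℝ) = 1 := by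
    rw [LinearMap.det_restrictScalars, LinearMap.det_smul, LinearMap.det_id, mul_one, map_pow,
      Algebra.norm_complex_apply, Complex.normSq_eq_norm_sq, hc, one_pow, one_pow]
  have := Measure.map_linearMap_addHaar_eq_smul_addHaar (volume : Measure (Coord n))
    (f := (c • LinearMap.id : Coord n →ₗ[ℂ] Coord n).restrictScalars ℝ) (by rw [hd]; exact one_ne_zero)
  rw [hd, inv_one, abs_one, ENNReal.ofReal_one, one_smul] at this
  exact this

/-- The closed unit disc maps into the ball under t ↦ tv, so the one-variable mean value property
applies at radius exactly 1. -/
lemma circleAverage_smul {F : Coord n → ℂ} (hF : DifferentiableOn ℂ F (ball n)) {v : Coord n}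
    (hv : v ∈ ball n) : ∫ θ in (0)..(2 * Real.pi), F (circleMap 0 1 θ • v) =
      2 * Real.pi * F 0 := by
  have hd : DifferentiableOn ℂ (fun t : ℂ => F (t • v)) (Metric.closedBall 0 1) := by
    refine hF.comp (by fun_prop) fun t ht => smul_mem_ball hv ?_
    simpa using ht
  have h1 : DiffContOnCl ℂ (fun t : ℂ => F (t • v)) (Metric.ball 0 1) := by
    refine ⟨hd.mono Metric.ball_subset_closedBall, ?_⟩
    rw [closure_ball _ one_ne_zero]
    exact hd.continuousOn
  have h2 := DiffContOnCl.circleAverage (c := 0) (R := 1) (f := fun t : ℂ => F (t • v))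
    (by simpa using h1)
  rw [Real.circleAverage, zero_smul] at h2
  rw [← h2, Complex.real_smul]
  push_cast
  have := Real.pi_ne_zero
  field_simp

/-- Rotations by unit scalars change neither δ^l nor the measure. Integrating over θ and exchanging
the integrals leaves the circle averages of F, all equal to F(0). -/
lemma integral_hua_mul {F : Coord n → ℂ} (hF : DifferentiableOn ℂ F (ball n)) {l : ℂ}
    (hi : Integrable fun v => huaFun n l v * F v) :
    ∫ v, huaFun n l v * F v = (∫ v, huaFun n l v) * F 0 := by
  set g : Coord n → ℂ := fun v => huaFun n l v * F v with hg
  have hcm : ∀ θ, ‖circleMap 0 1 θ‖ = 1 := fun θ => by simp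
  have h2pi : (0 : ℝ) ≤ 2 * Real.pi := by positivity
  -- The rotation by a varying angle preserves the product measure, which transfers the
  -- integrability of g to the two-variable function needed for Fubini.
  have hmp : MeasurePreserving (fun p : ℝ × Coord n => (p.1, circleMap 0 1 p.1 • p.2))
      ((volume.restrict (Set.Ioc 0 (2 * Real.pi))).prod volume)
      ((volume.restrict (Set.Ioc 0 (2 * Real.pi))).prod volume) := by
    refine MeasurePreserving.skew_product (g := fun θ (v : Coord n) => circleMap 0 1 θ • v)
      (MeasurePreserving.id _) ?_ ?_
    · exact (((continuous_circleMap 0 1).comp continuous_fst).smul continuous_snd).measurable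
    · exact Filter.Eventually.of_forall fun θ => (measurePreserving_unit_smul (hcm θ)).map_eq
  have hint : Integrable (fun p : ℝ × Coord n => g (circleMap 0 1 p.1 • p.2))
      ((volume.restrict (Set.Ioc 0 (2 * Real.pi))).prod volume) :=
    hmp.integrable_comp_of_integrable (hi.comp_snd (volume.restrict (Set.Ioc 0 (2 * Real.pi))))
  have h1 : ∀ θ, ∫ v, g (circleMap 0 1 θ • v) = ∫ v, g v := fun θ => by
    have he : MeasurableEmbedding (fun v : Coord n => circleMap 0 1 θ • v) :=
      measurableEmbedding_const_smul₀ (by intro h; have := hcm θ; rw [h] at this; simp at this)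
    exact (measurePreserving_unit_smul (hcm θ)).integral_comp he g
  have h2 : ∀ v, ∫ θ in Set.Ioc 0 (2 * Real.pi), g (circleMap 0 1 θ • v) =
      huaFun n l v * (2 * Real.pi * F 0) := fun v => by
    simp only [hg, huaFun_smul l v (hcm _)]
    rw [integral_const_mul]
    by_cases hv : v ∈ ball n
    · rw [← circleAverage_smul hF hv, intervalIntegral.integral_of_le h2pi]
    · rw [huaFun, Set.indicator_of_notMem hv, zero_mul, zero_mul]
  have h3 := integral_integral_swap (f := fun θ v => g (circleMap 0 1 θ • v)) hint
  simp only [h1, h2] at h3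
  rw [integral_mul_const, setIntegral_const] at h3
  simp only [Measure.real, Real.volume_Ioc, sub_zero, ENNReal.toReal_ofReal h2pi,
    Complex.real_smul] at h3
  have hpi : (2 * Real.pi : ℂ) ≠ 0 := by
    have := Real.pi_ne_zero
    exact_mod_cast (by positivity : (2 * Real.pi : ℝ) ≠ 0)
  push_cast at h3
  apply mul_left_cancel₀ hpi
  rw [h3]
  ring

end MeanValue

/-! ### The archimedean group in complex coordinates -/

section Arch
variable {α β : ℤ} {m r : ℕ}

lemma ofReal_sqrt_abs_sq {a : ℤ} (ha : a < 0) :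
    ((√|(a : ℝ)| : ℝ) : ℂ) * ((√|(a : ℝ)| : ℝ) : ℂ) = -(a : ℂ) := by
  rw [← Complex.ofReal_mul, Real.mul_self_sqrt (abs_nonneg _),
    abs_of_neg (by exact_mod_cast ha)]
  push_cast; rfl

/-- `ham` as a ring homomorphism. -/
def hamHom (hα : α < 0) (hβ : β < 0) : Quat α β ℝ →+* Matrix (Fin 2) (Fin 2) ℂ where
  toFun := ham
  map_one' := by
    ext i k; fin_cases i <;> fin_cases k <;> simp [ham]
  map_zero' := by
    ext i k; fin_cases i <;> fin_cases k <;> simp [ham]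
  map_add' x y := by
    ext i k; fin_cases i <;> fin_cases k <;> simp [ham] <;> ring
  map_mul' x y := by
    have hA : (α : ℂ) = -(((√|(α : ℝ)| : ℝ) : ℂ) * ((√|(α : ℝ)| : ℝ) : ℂ)) := by
      rw [ofReal_sqrt_abs_sq hα, neg_neg]
    have hB : (β : ℂ) = -(((√|(β : ℝ)| : ℝ) : ℂ) * ((√|(β : ℝ)| : ℝ) : ℂ)) := by
      rw [ofReal_sqrt_abs_sq hβ, neg_neg]
    ext i k
    fin_cases i <;> fin_cases k <;> simp [ham, Matrix.mul_apply, Fin.sum_univ_two] <;>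
    · simp only [hA, hB]
      ring_nf
      simp only [Complex.I_sq]
      ring

lemma ham_star (x : Quat α β ℝ) : ham (star x) = (ham x).conjTranspose := by
  ext i k
  fin_cases i <;> fin_cases k <;> simp [ham, Matrix.conjTranspose_apply] <;> ring

lemma ham_injective (hα : α < 0) (hβ : β < 0) :
    Function.Injective (ham : Quat α β ℝ → Matrix (Fin 2) (Fin 2) ℂ) := by
  intro x y h
  have ha : √|(α : ℝ)| ≠ 0 := Real.sqrt_ne_zero'.2 (abs_pos.2 (by exact_mod_cast hα.ne))
  have hb : √|(β : ℝ)| ≠ 0 := Real.sqrt_ne_zero'.2 (abs_pos.2 (by exact_mod_cast hβ.ne))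
  have h1 := congrFun (congrFun h 0) 0
  have h2 := congrFun (congrFun h 1) 0
  simp [ham, Complex.ext_iff, ha, hb] at h1 h2
  ext
  · exact h1.1
  · exact h2.1
  · exact h1.2
  · exact h2.2

/-- The Hamilton quaternions inside M₂(ℂ) are cut out by this antilinear condition; `exists_ham_eq`
is the converse. -/
lemma ham_struct (x : Quat α β ℝ) : J * cj (ham x) = ham x * J := by
  ext i k
  fin_cases i <;> fin_cases k <;> simp [ham, J, Matrix.mul_apply, Fin.sum_univ_two] <;> ring

lemma exists_ham_eq (hα : α < 0) (hβ : β < 0) {X : Matrix (Fin 2) (Fin 2) ℂ}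
    (h : J * cj X = X * J) : ∃ x : Quat α β ℝ, ham x = X := by
  have ha : √|(α : ℝ)| ≠ 0 := Real.sqrt_ne_zero'.2 (abs_pos.2 (by exact_mod_cast hα.ne))
  have hb : √|(β : ℝ)| ≠ 0 := Real.sqrt_ne_zero'.2 (abs_pos.2 (by exact_mod_cast hβ.ne))
  have h1 := congrFun (congrFun h 0) 0
  have h2 := congrFun (congrFun h 1) 0
  simp [J, Matrix.mul_apply, Fin.sum_univ_two] at h1 h2
  refine ⟨⟨(X 0 0).re, (X 1 0).re / √|(α : ℝ)|, (X 0 0).im / √|(β : ℝ)|,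
    (X 1 0).im / (√|(α : ℝ)| * √|(β : ℝ)|)⟩, ?_⟩
  have e1 : √|(α : ℝ)| * ((X 1 0).re / √|(α : ℝ)|) = (X 1 0).re := by field_simp
  have e2 : √|(β : ℝ)| * ((X 0 0).im / √|(β : ℝ)|) = (X 0 0).im := by field_simp
  have e3 : √|(α : ℝ)| * √|(β : ℝ)| * ((X 1 0).im / (√|(α : ℝ)| * √|(β : ℝ)|)) = (X 1 0).im := by
    field_simp
  simp only [ham, e1, e2, e3]
  ext i k
  fin_cases i <;> fin_cases k <;> simp [Complex.re_add_im, ← h1, ← h2, Complex.ext_iff]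

/-- The complex matrix of a quaternionic one, without rescaling. -/
def hamMat (g : Matrix (Idx m r) (Idx m r) (Quat α β ℝ)) : Matrix (NIdx m r) (NIdx m r) ℂ :=
  Matrix.of fun p q => ham (g p.2 q.2) p.1 q.1

lemma hamMat_mul (hα : α < 0) (hβ : β < 0) (g h : Matrix (Idx m r) (Idx m r) (Quat α β ℝ)) :
    hamMat (g * h) = hamMat g * hamMat h := by
  ext p q
  have h1 : ∀ x : Quat α β ℝ, ham x = hamHom hα hβ x := fun _ => rfl
  simp only [hamMat, Matrix.of_apply, Matrix.mul_apply, h1, map_sum, map_mul, Matrix.sum_apply,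
    Fintype.sum_prod_type]
  exact Finset.sum_comm

lemma hamMat_one (hα : α < 0) (hβ : β < 0) :
    hamMat (1 : Matrix (Idx m r) (Idx m r) (Quat α β ℝ)) = 1 := by
  ext ⟨a, p⟩ ⟨b, q⟩
  have h1 : ∀ x : Quat α β ℝ, ham x = hamHom hα hβ x := fun _ => rfl
  by_cases h : p = q
  · simp [hamMat, h, Matrix.one_apply, h1]
  · simp [hamMat, h, Matrix.one_apply, h1]

lemma hamMat_injective (hα : α < 0) (hβ : β < 0) :
    Function.Injective (hamMat : Matrix (Idx m r) (Idx m r) (Quat α β ℝ) → _) := by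
  intro g h e
  ext1 p q
  refine ham_injective hα hβ ?_
  ext a b
  exact congrFun (congrFun e (a, p)) (b, q)

lemma hamMat_conjTranspose (g : Matrix (Idx m r) (Idx m r) (Quat α β ℝ)) :
    hamMat g.conjTranspose = (hamMat g).conjTranspose := by
  ext ⟨a, p⟩ ⟨b, q⟩
  simp only [hamMat, Matrix.of_apply, Matrix.conjTranspose_apply, ham_star]

/-- The diagonal matrix of scaling factors. -/
def scalMat (α : ℤ) (m r : ℕ) : Matrix (NIdx m r) (NIdx m r) ℂ :=
  Matrix.diagonal fun p => (scal α m r p.2 : ℂ)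

/-- The inverse of `scalMat`. -/
def scalInv (α : ℤ) (m r : ℕ) : Matrix (NIdx m r) (NIdx m r) ℂ :=
  Matrix.diagonal fun p => (scal α m r p.2 : ℂ)⁻¹

lemma scal_pos (hα : α < 0) (p : Idx m r) : 0 < scal α m r p := by
  have : 0 < |(α : ℝ)| := abs_pos.2 (by exact_mod_cast hα.ne)
  rcases p with p | p | p
  · exact one_pos
  · exact Real.sqrt_pos.2 (Real.sqrt_pos.2 this)
  · exact one_pos

lemma scal_mul_inv (hα : α < 0) : scalMat α m r * scalInv α m r = 1 := by
  rw [scalMat, scalInv, Matrix.diagonal_mul_diagonal, ← Matrix.diagonal_one]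
  congr 1
  funext p
  exact mul_inv_cancel₀ (by exact_mod_cast (scal_pos hα p.2).ne')

lemma scal_inv_mul (hα : α < 0) : scalInv α m r * scalMat α m r = 1 :=
  mul_eq_one_comm.1 (scal_mul_inv hα)

lemma scalMat_conjTranspose : (scalMat α m r).conjTranspose = scalMat α m r := by
  rw [scalMat, Matrix.diagonal_conjTranspose]
  congr 1
  funext p
  simp

lemma scalInv_conjTranspose : (scalInv α m r).conjTranspose = scalInv α m r := by
  rw [scalInv, Matrix.diagonal_conjTranspose]
  congr 1
  funext p
  simp

lemma arch_eq (g : Matrix (Idx m r) (Idx m r) (Quat α β ℝ)) :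
    arch g = scalMat α m r * hamMat g * scalInv α m r := by
  ext p q
  rw [scalMat, scalInv, Matrix.mul_diagonal, Matrix.diagonal_mul]
  rfl

lemma arch_mul (hα : α < 0) (hβ : β < 0) (g h : Matrix (Idx m r) (Idx m r) (Quat α β ℝ)) :
    arch (g * h) = arch g * arch h := by
  rw [arch_eq, arch_eq, arch_eq, hamMat_mul hα hβ]
  calc _ = scalMat α m r * hamMat g * 1 * hamMat h * scalInv α m r := by
        simp only [Matrix.mul_assoc, Matrix.one_mul]
    _ = _ := by rw [← scal_inv_mul hα]; simp only [Matrix.mul_assoc]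

lemma arch_one (hα : α < 0) (hβ : β < 0) :
    arch (1 : Matrix (Idx m r) (Idx m r) (Quat α β ℝ)) = 1 := by
  rw [arch_eq, hamMat_one hα hβ, Matrix.mul_one, scal_mul_inv hα]

lemma arch_injective (hα : α < 0) (hβ : β < 0) :
    Function.Injective (arch : Matrix (Idx m r) (Idx m r) (Quat α β ℝ) → _) := by
  intro g h e
  refine hamMat_injective hα hβ ?_
  rw [arch_eq, arch_eq] at e
  have := congrArg (fun X => scalInv α m r * X * scalMat α m r) e
  calc hamMat g = scalInv α m r * scalMat α m r * hamMat g * (scalInv α m r * scalMat α m r) := by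
        rw [scal_inv_mul hα]; simp
    _ = scalInv α m r * scalMat α m r * hamMat h * (scalInv α m r * scalMat α m r) := by
        simpa only [Matrix.mul_assoc] using this
    _ = _ := by rw [scal_inv_mul hα]; simp

/-- The form `φ_∞` in the coordinates of `arch`. -/
def archForm (m r : ℕ) : Matrix (NIdx m r) (NIdx m r) ℂ :=
  cent (blk m r 0 (-1) 0 1 0) + J ⊗ₖ blk m r 0 0 1 0 0

/-- ζ becomes √|α| J, and the two scaling factors |α|^{-1/4} remove the √|α| from the middle block.
-/
lemma archForm_eq (hα : α < 0) (hβ : β < 0) : archForm m r =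
    scalInv α m r * hamMat (form α β m r ℝ) * scalInv α m r := by
  have h1 : ∀ x : Quat α β ℝ, ham x = hamHom hα hβ x := fun _ => rfl
  have h2 : 0 < |(α : ℝ)| := abs_pos.2 (by exact_mod_cast hα.ne)
  have h3 : ((√√|(α : ℝ)| : ℝ) : ℂ) * ((√√|(α : ℝ)| : ℝ) : ℂ) = ((√|(α : ℝ)| : ℝ) : ℂ) := by
    rw [← Complex.ofReal_mul, Real.mul_self_sqrt (Real.sqrt_nonneg _)]
  have h4 : ((√√|(α : ℝ)| : ℝ) : ℂ) ≠ 0 := by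
    exact_mod_cast (Real.sqrt_pos.2 (Real.sqrt_pos.2 h2)).ne'
  ext ⟨a, p⟩ ⟨b, q⟩
  rw [scalInv, Matrix.mul_diagonal, Matrix.diagonal_mul, archForm, cent, Matrix.add_apply,
    Matrix.kroneckerMap_apply, Matrix.kroneckerMap_apply, hamMat, Matrix.of_apply]
  rcases p with p | p | p <;> rcases q with q | q | q <;>
    simp only [form, blk, Matrix.of_apply, scal, h1, map_zero, mul_zero, zero_mul,
      Matrix.zero_apply, add_zero, zero_add, Complex.ofReal_one, inv_one, one_mul, mul_one,
      ite_self]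
  · by_cases h : p = q <;> simp [h, Matrix.one_apply]
  · by_cases h : p = q
    · simp only [h, if_true]
      fin_cases a <;> fin_cases b <;> simp [← h1, ham, J] <;> field_simp <;> rw [sq, h3]
    · simp [h]
  · by_cases h : p = q <;> simp [h, Matrix.one_apply]

lemma arch_form_iff (hα : α < 0) (hβ : β < 0) (g : Matrix (Idx m r) (Idx m r) (Quat α β ℝ)) :
    g.conjTranspose * form α β m r ℝ * g = form α β m r ℝ ↔
      (arch g).conjTranspose * archForm m r * arch g = archForm m r := by
  have h1 : (arch g).conjTranspose * archForm m r * arch g =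
      scalInv α m r * hamMat (g.conjTranspose * form α β m r ℝ * g) * scalInv α m r := by
    rw [archForm_eq hα hβ, arch_eq, Matrix.conjTranspose_mul, Matrix.conjTranspose_mul,
      scalMat_conjTranspose, scalInv_conjTranspose, hamMat_mul hα hβ, hamMat_mul hα hβ,
      hamMat_conjTranspose]
    calc _ = scalInv α m r * (hamMat g).conjTranspose * (scalMat α m r * scalInv α m r) *
          hamMat (form α β m r ℝ) * (scalInv α m r * scalMat α m r) * hamMat g * scalInv α m r := by
          simp only [Matrix.mul_assoc]
      _ = _ := by rw [scal_mul_inv hα, scal_inv_mul hα]; simp only [Matrix.mul_one, Matrix.mul_assoc]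
  rw [h1]
  constructor
  · intro h
    rw [h, ← archForm_eq hα hβ]
  · intro h
    rw [archForm_eq hα hβ] at h
    refine hamMat_injective hα hβ ?_
    have := congrArg (fun X => scalMat α m r * X * scalMat α m r) h
    generalize hamMat (g.conjTranspose * form α β m r ℝ * g) = X at *
    generalize hamMat (form α β m r ℝ) = Y at *
    calc X = (scalMat α m r * scalInv α m r) * X * (scalInv α m r * scalMat α m r) := by
          rw [scal_inv_mul hα, scal_mul_inv hα]; simp
      _ = (scalMat α m r * scalInv α m r) * Y * (scalInv α m r * scalMat α m r) := by
          simpa only [Matrix.mul_assoc] using this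
      _ = Y := by rw [scal_inv_mul hα, scal_mul_inv hα]; simp

/-- The real structure of the quaternions in the coordinates of `arch`. -/
def archJ (m r : ℕ) : Matrix (NIdx m r) (NIdx m r) ℂ := J ⊗ₖ (1 : Matrix (Idx m r) (Idx m r) ℂ)

lemma archJ_mul_apply (X : Matrix (NIdx m r) (NIdx m r) ℂ) (a : Fin 2) (p : Idx m r)
    (q : NIdx m r) : (archJ m r * X) (a, p) q = ∑ b, J a b * X (b, p) q := by
  simp only [archJ, Matrix.mul_apply, Fintype.sum_prod_type, Matrix.kroneckerMap_apply,
    Matrix.one_apply, mul_ite, mul_one, mul_zero, ite_mul, zero_mul, Finset.sum_ite_eq,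
    Finset.mem_univ, if_true]

lemma mul_archJ_apply (X : Matrix (NIdx m r) (NIdx m r) ℂ) (p : NIdx m r) (b : Fin 2)
    (q : Idx m r) : (X * archJ m r) p (b, q) = ∑ a, X p (a, q) * J a b := by
  simp only [archJ, Matrix.mul_apply, Fintype.sum_prod_type, Matrix.kroneckerMap_apply,
    Matrix.one_apply, mul_ite, mul_one, mul_zero, Finset.sum_ite_eq',
    Finset.mem_univ, if_true]

lemma arch_struct (g : Matrix (Idx m r) (Idx m r) (Quat α β ℝ)) :
    archJ m r * cj (arch g) = arch g * archJ m r := by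
  ext ⟨a, p⟩ ⟨b, q⟩
  have h := congrFun (congrFun (ham_struct (g p q)) a) b
  rw [archJ_mul_apply, mul_archJ_apply]
  rw [Matrix.mul_apply, Matrix.mul_apply] at h
  simp only [cj_apply, arch, Matrix.of_apply, map_mul, map_inv₀, Complex.conj_ofReal] at h ⊢
  simp only [Fin.sum_univ_two] at h ⊢
  linear_combination (scal α m r p : ℂ) * (scal α m r q : ℂ)⁻¹ * h

lemma exists_arch_eq (hα : α < 0) (hβ : β < 0) {X : Matrix (NIdx m r) (NIdx m r) ℂ}
    (h : archJ m r * cj X = X * archJ m r) :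
    ∃ g : Matrix (Idx m r) (Idx m r) (Quat α β ℝ), arch g = X := by
  have hs : ∀ p : Idx m r, (scal α m r p : ℂ) ≠ 0 := fun p => by
    exact_mod_cast (scal_pos hα p).ne'
  have h1 : ∀ p q, ∃ x : Quat α β ℝ, ham x =
      Matrix.of fun a b => (scal α m r p : ℂ)⁻¹ * X (a, p) (b, q) * (scal α m r q : ℂ) := by
    intro p q
    refine exists_ham_eq hα hβ ?_
    ext a b
    have h2 := congrFun (congrFun h (a, p)) (b, q)
    rw [archJ_mul_apply, mul_archJ_apply] at h2
    rw [Matrix.mul_apply, Matrix.mul_apply]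
    simp only [cj_apply, Matrix.of_apply, map_mul, map_inv₀, Complex.conj_ofReal] at h2 ⊢
    simp only [Fin.sum_univ_two] at h2 ⊢
    linear_combination (scal α m r p : ℂ)⁻¹ * (scal α m r q : ℂ) * h2
  choose g hg using h1
  refine ⟨Matrix.of g, ?_⟩
  ext ⟨a, p⟩ ⟨b, q⟩
  simp only [arch, Matrix.of_apply, hg]
  have := hs p
  have := hs q
  field_simp

end Arch

/-! ### The reduced norm as a complex determinant, and the image of G(ℝ). -/

section Det
variable {α β : ℤ} {m r : ℕ}

/-- The embedding of `ℝ[ξ]`, `ξ² = β < 0`, into `ℂ`. -/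
def quadHom (hβ : β < 0) : QuadraticAlgebra ℝ (β : ℝ) 0 →+* ℂ where
  toFun x := (x.re : ℂ) + (√|(β : ℝ)| * x.im : ℝ) * Complex.I
  map_one' := by simp [QuadraticAlgebra.re_one, QuadraticAlgebra.im_one]
  map_zero' := by simp
  map_add' x y := by simp; ring
  map_mul' x y := by
    have hB : (β : ℂ) = -(((√|(β : ℝ)| : ℝ) : ℂ) * ((√|(β : ℝ)| : ℝ) : ℂ)) := by
      rw [ofReal_sqrt_abs_sq hβ, neg_neg]
    simp
    simp only [hB]
    ring_nf
    simp only [Complex.I_sq]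
    ring

lemma quadHom_apply (hβ : β < 0) (x : QuadraticAlgebra ℝ (β : ℝ) 0) :
    quadHom hβ x = (x.re : ℂ) + (√|(β : ℝ)| * x.im : ℝ) * Complex.I := rfl

lemma quadHom_injective (hβ : β < 0) : Function.Injective (quadHom hβ) := by
  intro x y h
  have hb : √|(β : ℝ)| ≠ 0 := Real.sqrt_ne_zero'.2 (abs_pos.2 (by exact_mod_cast hβ.ne))
  simp [quadHom_apply, Complex.ext_iff, hb] at h
  exact QuadraticAlgebra.ext h.1 h.2

/-- The two embeddings into 2 × 2 matrices are conjugate by diag(1, √|α|), so they give the same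
determinants. -/
lemma ham_eq_emb (hα : α < 0) (hβ : β < 0) (x : Quat α β ℝ) (a b : Fin 2) :
    ham x a b = ((if a = 0 then 1 else √|(α : ℝ)| : ℝ) : ℂ) * quadHom hβ (emb α β ℝ x a b) *
      ((if b = 0 then 1 else √|(α : ℝ)| : ℝ) : ℂ)⁻¹ := by
  have ha : ((√|(α : ℝ)| : ℝ) : ℂ) ≠ 0 := by
    have : √|(α : ℝ)| ≠ 0 := Real.sqrt_ne_zero'.2 (abs_pos.2 (by exact_mod_cast hα.ne))
    exact Complex.ofReal_ne_zero.2 this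
  have hA : (α : ℂ) = -(((√|(α : ℝ)| : ℝ) : ℂ) * ((√|(α : ℝ)| : ℝ) : ℂ)) := by
    rw [ofReal_sqrt_abs_sq hα, neg_neg]
  fin_cases a <;> fin_cases b <;> simp [ham, emb, quadHom_apply]
  · simp only [hA]
    field_simp
    ring
  · field_simp
  · field_simp
    ring

lemma det_arch (hα : α < 0) (hβ : β < 0) (g : Matrix (Idx m r) (Idx m r) (Quat α β ℝ)) :
    (arch g).det = quadHom hβ (nrd α β m r ℝ g) := by
  have h1 : (arch g).det = (hamMat g).det := by
    rw [arch_eq, Matrix.det_mul, Matrix.det_mul, mul_right_comm, ← Matrix.det_mul,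
      scal_mul_inv hα, Matrix.det_one, one_mul]
  have h2 : quadHom hβ (nrd α β m r ℝ g) = (Matrix.of fun p q : Idx m r × Fin 2 =>
      quadHom hβ (emb α β ℝ (g p.1 q.1) p.2 q.2)).det :=
    (quadHom hβ).map_det _
  have ha : ∀ a : Fin 2, ((if a = 0 then 1 else √|(α : ℝ)| : ℝ) : ℂ) ≠ 0 := by
    intro a
    have : √|(α : ℝ)| ≠ 0 := Real.sqrt_ne_zero'.2 (abs_pos.2 (by exact_mod_cast hα.ne))
    split_ifs
    · simp
    · exact Complex.ofReal_ne_zero.2 this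
  have h3 : hamMat g = Matrix.diagonal (fun p : NIdx m r => ((if p.1 = 0 then 1 else √|(α : ℝ)| : ℝ) : ℂ)) *
      ((Matrix.of fun p q : Idx m r × Fin 2 =>
      quadHom hβ (emb α β ℝ (g p.1 q.1) p.2 q.2)).submatrix (Equiv.prodComm _ _)
        (Equiv.prodComm _ _)) *
      Matrix.diagonal (fun p : NIdx m r => ((if p.1 = 0 then 1 else √|(α : ℝ)| : ℝ) : ℂ)⁻¹) := by
    ext p q
    rw [Matrix.mul_diagonal, Matrix.diagonal_mul]
    exact ham_eq_emb hα hβ _ _ _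
  rw [h1, h2, h3, Matrix.det_mul, Matrix.det_mul, mul_right_comm, ← Matrix.det_mul,
    Matrix.diagonal_mul_diagonal, Matrix.det_submatrix_equiv_self]
  simp only [mul_inv_cancel₀ (ha _), Matrix.diagonal_one, Matrix.det_one, one_mul]

/-- The conditions defining the image of `G(ℝ)` in complex matrices. -/
structure IsArch (X : Matrix (NIdx m r) (NIdx m r) ℂ) : Prop where
  form : X.conjTranspose * archForm m r * X = archForm m r
  struct : archJ m r * cj X = X * archJ m r
  det : X.det = 1

lemma isArch_arch (hα : α < 0) (hβ : β < 0) (g : G α β m r ℝ) : IsArch (arch g.val.val) := by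
  refine ⟨(arch_form_iff hα hβ _).1 g.2.1, arch_struct _, ?_⟩
  rw [det_arch hα hβ, g.2.2, map_one]

/-- X⁻¹ satisfies the same quaternionic reality condition, so it too comes from a quaternionic
matrix; injectivity of `arch` makes the two preimages mutually inverse. -/
lemma IsArch.exists_eq (hα : α < 0) (hβ : β < 0) {X : Matrix (NIdx m r) (NIdx m r) ℂ}
    (h : IsArch X) : ∃ g : G α β m r ℝ, arch g.val.val = X := by
  obtain ⟨g, hg⟩ := exists_arch_eq hα hβ h.struct
  have hu : IsUnit X.det := by rw [h.det]; exact isUnit_one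
  have hJ : IsUnit (archJ m r).det := by
    have : archJ m r * archJ m r = -1 := by
      have hJJ : J * J = -1 := by
        ext i k; fin_cases i <;> fin_cases k <;> simp [J]
      rw [archJ, ← Matrix.mul_kronecker_mul, hJJ, Matrix.mul_one, ← neg_one_smul ℂ (1 : Matrix (Fin 2) (Fin 2) ℂ),
        Matrix.smul_kronecker, Matrix.one_kronecker_one, neg_one_smul]
    have h1 : archJ m r * (-archJ m r) = 1 := by rw [Matrix.mul_neg, this, neg_neg]
    exact Matrix.isUnit_det_of_right_inverse h1
  have hX := Matrix.mul_nonsing_inv X hu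
  have hX' := Matrix.nonsing_inv_mul X hu
  have hs : archJ m r * cj X⁻¹ = X⁻¹ * archJ m r := by
    have h1 : cj X * cj X⁻¹ = 1 := by rw [← cj_mul, hX, cj_one]
    calc archJ m r * cj X⁻¹ = (X⁻¹ * X) * archJ m r * cj X⁻¹ := by rw [hX', Matrix.one_mul]
      _ = X⁻¹ * (X * archJ m r) * cj X⁻¹ := by simp only [Matrix.mul_assoc]
      _ = X⁻¹ * archJ m r * (cj X * cj X⁻¹) := by rw [← h.struct]; simp only [Matrix.mul_assoc]
      _ = _ := by rw [h1, Matrix.mul_one]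
  obtain ⟨g', hg'⟩ := exists_arch_eq (α := α) hα hβ hs
  have e1 : g * g' = 1 := by
    refine arch_injective hα hβ ?_
    rw [arch_mul hα hβ, hg, hg', hX, arch_one hα hβ]
  have e2 : g' * g = 1 := by
    refine arch_injective hα hβ ?_
    rw [arch_mul hα hβ, hg, hg', hX', arch_one hα hβ]
  refine ⟨⟨⟨g, g', e1, e2⟩, (arch_form_iff hα hβ g).2 (by rw [hg]; exact h.form), ?_⟩, hg⟩
  refine quadHom_injective hβ ?_
  rw [← det_arch hα hβ, map_one]
  exact (congrArg Matrix.det hg).trans h.det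

lemma det_ballMat {ι : Type*} [Fintype ι] [DecidableEq ι] {A C : Matrix ι ι ℂ}
    (h : BallPair A C) : (ballMat A C).det = 1 := by
  have h1 := mul_eq_one_comm.1 h.ballMat_inv
  rw [ballMat, ballMat, Matrix.fromBlocks_multiply, ← Matrix.fromBlocks_one,
    Matrix.fromBlocks_inj] at h1
  simp only [transpose_cj, conjTranspose_cj] at h1
  -- The second block column here is that of the inverse, so the product is block triangular and
  -- both sides have determinants involving only det A.
  have h2 : ballMat A C * Matrix.fromBlocks 1 (-C.conjTranspose) 0 A.transpose =
      Matrix.fromBlocks A 0 C 1 := by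
    rw [ballMat, Matrix.fromBlocks_multiply, h1.2.1, h1.2.2.2]
    simp
  have h3 := congrArg Matrix.det h2
  rw [Matrix.det_mul, Matrix.det_fromBlocks_zero₂₁, Matrix.det_fromBlocks_zero₁₂,
    Matrix.det_transpose, Matrix.det_one, one_mul, mul_one] at h3
  exact mul_right_cancel₀ h.det_ne_zero (h3.trans (one_mul _).symm)

end Det

/-! ### The Cayley transform -/

section Cayley
variable {m r : ℕ}

lemma J_mul_J : J * J = -1 := by
  ext i k; fin_cases i <;> fin_cases k <;> simp [J]

lemma cj_J : cj J = J := by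
  ext i k; fin_cases i <;> fin_cases k <;> simp [J]

lemma J_conjTranspose : J.conjTranspose = -J := by
  ext i k; fin_cases i <;> fin_cases k <;> simp [J]

/-- `J'_m` -/
def Jm (m : ℕ) : Matrix (Fin 2 × Fin m) (Fin 2 × Fin m) ℂ :=
  J ⊗ₖ (1 : Matrix (Fin m) (Fin m) ℂ)

lemma Jm_mul_Jm : Jm m * Jm m = -1 := by
  rw [Jm, ← Matrix.mul_kronecker_mul, J_mul_J, Matrix.mul_one,
    ← neg_one_smul ℂ (1 : Matrix (Fin 2) (Fin 2) ℂ),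
    Matrix.smul_kronecker, Matrix.one_kronecker_one, neg_one_smul]

lemma Jm_conjTranspose : (Jm m).conjTranspose = -Jm m := by
  rw [Jm, Matrix.conjTranspose_kronecker, J_conjTranspose, Matrix.conjTranspose_one,
    ← neg_one_smul ℂ J, Matrix.smul_kronecker, neg_one_smul]

lemma cj_Jm : cj (Jm m) = Jm m := by
  ext ⟨a, p⟩ ⟨b, q⟩
  have := congrFun (congrFun cj_J a) b
  rw [cj_apply] at this
  rw [cj_apply, Jm, Matrix.kroneckerMap_apply, map_mul, this, Matrix.one_apply]
  split_ifs <;> simp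

lemma L_eq : L m r = Matrix.fromBlocks (Complex.I • Jm m) 0 0 1 := rfl

lemma L_mul_L : L m r * L m r = 1 := by
  rw [L_eq, Matrix.fromBlocks_multiply, ← Matrix.fromBlocks_one]
  simp [Jm_mul_Jm, smul_smul]

lemma L_conjTranspose : (L m r).conjTranspose = L m r := by
  rw [L_eq, Matrix.fromBlocks_conjTranspose]
  simp [Jm_conjTranspose, Matrix.conjTranspose_smul]

/-- The columns are bases of the two eigenspaces of the form `φ_∞` at `z_0`. -/
def cay (m r : ℕ) : Matrix (ZIdx m r ⊕ ZIdx m r) (ZIdx m r ⊕ ZIdx m r) ℂ :=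
  Matrix.fromBlocks (Complex.I • 1) (Complex.I • L m r) 1 (-L m r)

/-- The inverse of `cay`. -/
def cayInv (m r : ℕ) : Matrix (ZIdx m r ⊕ ZIdx m r) (ZIdx m r ⊕ ZIdx m r) ℂ :=
  Matrix.fromBlocks ((-(Complex.I / 2)) • 1) ((1 / 2 : ℂ) • 1) ((-(Complex.I / 2)) • L m r)
    ((-(1 / 2) : ℂ) • L m r)

lemma half_I_mul_I : Complex.I / 2 * Complex.I = -(1 / 2) := by
  rw [div_mul_eq_mul_div, Complex.I_mul_I]; norm_num

lemma cayInv_mul_cay : cayInv m r * cay m r = 1 := by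
  refine Eq.trans ?_ Matrix.fromBlocks_one
  rw [cayInv, cay, Matrix.fromBlocks_multiply]
  have hI : Complex.I * (Complex.I / 2) = -(1 / 2) := by rw [mul_comm, half_I_mul_I]
  simp only [Matrix.smul_mul, Matrix.mul_smul, Matrix.one_mul, Matrix.mul_one,
    L_mul_L, smul_smul, mul_neg, hI]
  congr 1
  · module
  · module
  · module
  · module

lemma cay_mul_cayInv : cay m r * cayInv m r = 1 := mul_eq_one_comm.1 cayInv_mul_cay

/-- The form `φ_∞` in the coordinates of `cplx`. -/
def zForm (m r : ℕ) : Matrix (ZIdx m r ⊕ ZIdx m r) (ZIdx m r ⊕ ZIdx m r) ℂ :=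
  Matrix.fromBlocks 0 (-1) 1 0

/-- The quaternionic structure in the coordinates of `cplx`. -/
def zStruct (m r : ℕ) : Matrix (ZIdx m r ⊕ ZIdx m r) (ZIdx m r ⊕ ZIdx m r) ℂ :=
  Matrix.fromBlocks (Matrix.fromBlocks (Jm m) 0 0 0) (Matrix.fromBlocks 0 0 0 (-1))
    (Matrix.fromBlocks 0 0 0 1) (Matrix.fromBlocks (Jm m) 0 0 0)

/-- The form of signature `(n, n)`. -/
def ballForm (m r : ℕ) : Matrix (ZIdx m r ⊕ ZIdx m r) (ZIdx m r ⊕ ZIdx m r) ℂ :=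
  Matrix.fromBlocks 1 0 0 (-1)

/-- The quaternionic structure in the coordinates of the ball. -/
def ballStruct (m r : ℕ) : Matrix (ZIdx m r ⊕ ZIdx m r) (ZIdx m r ⊕ ZIdx m r) ℂ :=
  Matrix.fromBlocks 0 ((-Complex.I) • 1) (Complex.I • 1) 0

lemma cay_form : (cay m r).conjTranspose * zForm m r * cay m r =
    (2 * Complex.I) • ballForm m r := by
  rw [cay, zForm, ballForm, Matrix.fromBlocks_conjTranspose, Matrix.fromBlocks_multiply,
    Matrix.fromBlocks_multiply, Matrix.fromBlocks_smul]
  simp only [Matrix.conjTranspose_smul, Matrix.conjTranspose_one, Matrix.conjTranspose_neg,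
    L_conjTranspose, Matrix.smul_mul, Matrix.mul_smul, Matrix.one_mul, Matrix.mul_one,
    Matrix.mul_neg, Matrix.neg_mul, Matrix.mul_zero, zero_add, add_zero, neg_neg, L_mul_L,
    Complex.star_def, Complex.conj_I, smul_neg, smul_zero, neg_smul]
  congr 1
  · module
  · module
  · module
  · module

lemma cay_struct : zStruct m r * cj (cay m r) = cay m r * ballStruct m r := by
  have hI : (-Complex.I * Complex.I) = 1 := by rw [neg_mul, Complex.I_mul_I, neg_neg]
  -- L = iP + Q with P, Q real, PQ = QP = 0, Q² = Q and P² = Q - 1. Conjugation only changes the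
  -- sign of iP, so the identity follows from these relations alone.
  have hL : L m r = Complex.I • Matrix.fromBlocks (Jm m) 0 0 (0 : Matrix (Fin r) (Fin r) ℂ) +
      Matrix.fromBlocks 0 0 0 1 := by
    rw [L_eq, Matrix.fromBlocks_smul, Matrix.fromBlocks_add]; simp
  have hcL : cj (L m r) = -(Complex.I • Matrix.fromBlocks (Jm m) 0 0 (0 : Matrix (Fin r) (Fin r) ℂ)) +
      Matrix.fromBlocks 0 0 0 1 := by
    rw [hL]; simp [cj_fromBlocks, cj_Jm]
  have hPP : Matrix.fromBlocks (Jm m) 0 0 (0 : Matrix (Fin r) (Fin r) ℂ) *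
      Matrix.fromBlocks (Jm m) 0 0 (0 : Matrix (Fin r) (Fin r) ℂ) =
        Matrix.fromBlocks 0 0 0 1 - 1 := by
    rw [Matrix.fromBlocks_multiply, ← Matrix.fromBlocks_one, fromBlocks_sub]
    simp [Jm_mul_Jm]
  have hQQ : (Matrix.fromBlocks 0 0 0 1 * Matrix.fromBlocks 0 0 0 1 :
      Matrix (ZIdx m r) (ZIdx m r) ℂ) = Matrix.fromBlocks 0 0 0 1 := by
    rw [Matrix.fromBlocks_multiply]
    simp
  have hPQ : Matrix.fromBlocks (Jm m) 0 0 (0 : Matrix (Fin r) (Fin r) ℂ) *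
      Matrix.fromBlocks 0 0 0 1 = 0 := by
    simp [Matrix.fromBlocks_multiply]
  have hQP : Matrix.fromBlocks 0 0 0 1 *
      Matrix.fromBlocks (Jm m) 0 0 (0 : Matrix (Fin r) (Fin r) ℂ) = 0 := by
    simp [Matrix.fromBlocks_multiply]
  have hQ : (Matrix.fromBlocks 0 0 0 (-1) : Matrix (ZIdx m r) (ZIdx m r) ℂ) =
      -Matrix.fromBlocks 0 0 0 1 := by simp [Matrix.fromBlocks_neg]
  rw [zStruct, cay, cj_fromBlocks, ballStruct, Matrix.fromBlocks_multiply,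
    Matrix.fromBlocks_multiply, hQ]
  simp only [cj_smul, cj_one, cj_neg, hcL, Complex.conj_I]
  rw [hL]
  generalize (Matrix.fromBlocks (Jm m) 0 0 (0 : Matrix (Fin r) (Fin r) ℂ)) = P at *
  generalize (Matrix.fromBlocks 0 0 0 1 : Matrix (ZIdx m r) (ZIdx m r) ℂ) = Q at *
  simp only [Matrix.mul_add, Matrix.neg_mul, Matrix.mul_smul, hPQ, hQP, hPP, hQQ, hI,
    smul_smul, Matrix.mul_one, Matrix.mul_zero, smul_add, smul_neg, neg_smul, add_zero, zero_add,
    neg_neg, Complex.I_mul_I, one_smul, neg_add, neg_zero, mul_neg, smul_zero, smul_sub]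
  congr 1 <;> abel

/-- `label` as an equivalence. -/
def labelEquiv (m r : ℕ) : ZIdx m r ⊕ ZIdx m r ≃ NIdx m r where
  toFun := label m r
  invFun
    | (a, .inl p) => .inl (.inl (a, p))
    | (0, .inr (.inl p)) => .inl (.inr p)
    | (1, .inr (.inl p)) => .inr (.inr p)
    | (a, .inr (.inr p)) => .inr (.inl (a, p))
  left_inv := by
    rintro ((⟨a, p⟩ | p) | (⟨a, p⟩ | p)) <;> rfl
  right_inv := by
    rintro ⟨a, p | p | p⟩
    · rfl
    · fin_cases a <;> rfl
    · rfl

lemma archForm_submatrix :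
    (archForm m r).submatrix (labelEquiv m r) (labelEquiv m r) = zForm m r := by
  ext ((⟨a, p⟩ | p) | (⟨a, p⟩ | p)) ((⟨b, q⟩ | q) | (⟨b, q⟩ | q)) <;>
    simp [labelEquiv, label, archForm, zForm, cent, blk, Matrix.one_apply, J, Prod.ext_iff]
  all_goals split_ifs <;> simp_all

lemma archJ_submatrix :
    (archJ m r).submatrix (labelEquiv m r) (labelEquiv m r) = zStruct m r := by
  ext ((⟨a, p⟩ | p) | (⟨a, p⟩ | p)) ((⟨b, q⟩ | q) | (⟨b, q⟩ | q)) <;>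
    simp [labelEquiv, label, archJ, zStruct, Jm, Matrix.one_apply, J]
  all_goals split_ifs <;> simp

end Cayley

/-! ### The real group in ball coordinates. -/

section Group
variable {α β : ℤ} {m r : ℕ}

/-- The ball coordinates of a complex matrix. -/
def ballCoord (X : Matrix (NIdx m r) (NIdx m r) ℂ) :
    Matrix (ZIdx m r ⊕ ZIdx m r) (ZIdx m r ⊕ ZIdx m r) ℂ :=
  cayInv m r * X.submatrix (labelEquiv m r) (labelEquiv m r) * cay m r

lemma cay_mul_ballCoord (X : Matrix (NIdx m r) (NIdx m r) ℂ) :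
    cay m r * ballCoord X = X.submatrix (labelEquiv m r) (labelEquiv m r) * cay m r := by
  rw [ballCoord, ← Matrix.mul_assoc, ← Matrix.mul_assoc, cay_mul_cayInv, Matrix.one_mul]

lemma ballCoord_mul (X Y : Matrix (NIdx m r) (NIdx m r) ℂ) :
    ballCoord (X * Y) = ballCoord X * ballCoord Y := by
  rw [ballCoord, ballCoord, ballCoord, ← Matrix.submatrix_mul_equiv _ _ _ (labelEquiv m r)]
  calc _ = cayInv m r * X.submatrix (labelEquiv m r) (labelEquiv m r) * 1 *
        Y.submatrix (labelEquiv m r) (labelEquiv m r) * cay m r := by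
        simp only [Matrix.mul_one, Matrix.mul_assoc]
    _ = _ := by rw [← cay_mul_cayInv]; simp only [Matrix.mul_assoc]

lemma ballCoord_one : ballCoord (1 : Matrix (NIdx m r) (NIdx m r) ℂ) = 1 := by
  rw [ballCoord, Matrix.submatrix_one_equiv, Matrix.mul_one, cayInv_mul_cay]

lemma det_ballCoord (X : Matrix (NIdx m r) (NIdx m r) ℂ) : (ballCoord X).det = X.det := by
  rw [ballCoord, Matrix.det_mul, Matrix.det_mul, mul_right_comm, ← Matrix.det_mul, cayInv_mul_cay,
    Matrix.det_one, one_mul, Matrix.det_submatrix_equiv_self]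

lemma IsArch.ballCoord_form {X : Matrix (NIdx m r) (NIdx m r) ℂ} (h : IsArch X) :
    (ballCoord X).conjTranspose * ballForm m r * ballCoord X = ballForm m r := by
  have h1 : (X.submatrix (labelEquiv m r) (labelEquiv m r)).conjTranspose * zForm m r *
      X.submatrix (labelEquiv m r) (labelEquiv m r) = zForm m r := by
    rw [← archForm_submatrix, Matrix.conjTranspose_submatrix, Matrix.submatrix_mul_equiv,
      Matrix.submatrix_mul_equiv, h.form]
  have h2 : (2 * Complex.I) • ((ballCoord X).conjTranspose * ballForm m r * ballCoord X) =
      (2 * Complex.I) • ballForm m r := by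
    calc _ = (ballCoord X).conjTranspose * ((2 * Complex.I) • ballForm m r) * ballCoord X := by
          simp
      _ = (cay m r * ballCoord X).conjTranspose * zForm m r * (cay m r * ballCoord X) := by
          rw [← cay_form, Matrix.conjTranspose_mul]; simp only [Matrix.mul_assoc]
      _ = (cay m r).conjTranspose * ((X.submatrix (labelEquiv m r) (labelEquiv m r)).conjTranspose *
            zForm m r * X.submatrix (labelEquiv m r) (labelEquiv m r)) * cay m r := by
          rw [cay_mul_ballCoord, Matrix.conjTranspose_mul]; simp only [Matrix.mul_assoc]
      _ = _ := by rw [h1, cay_form]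
  exact smul_right_injective _ (mul_ne_zero two_ne_zero Complex.I_ne_zero) h2

lemma IsArch.ballCoord_struct {X : Matrix (NIdx m r) (NIdx m r) ℂ} (h : IsArch X) :
    ballCoord X * ballStruct m r = ballStruct m r * cj (ballCoord X) := by
  have h1 : zStruct m r * cj (X.submatrix (labelEquiv m r) (labelEquiv m r)) =
      X.submatrix (labelEquiv m r) (labelEquiv m r) * zStruct m r := by
    have e : cj (X.submatrix (labelEquiv m r) (labelEquiv m r)) =
        (cj X).submatrix (labelEquiv m r) (labelEquiv m r) := rfl
    rw [← archJ_submatrix, e, Matrix.submatrix_mul_equiv, Matrix.submatrix_mul_equiv, h.struct]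
  have h2 : cay m r * (ballCoord X * ballStruct m r) =
      cay m r * (ballStruct m r * cj (ballCoord X)) := by
    calc _ = X.submatrix (labelEquiv m r) (labelEquiv m r) * (cay m r * ballStruct m r) := by
          rw [← Matrix.mul_assoc, cay_mul_ballCoord, Matrix.mul_assoc]
      _ = zStruct m r * cj (X.submatrix (labelEquiv m r) (labelEquiv m r) * cay m r) := by
          rw [← cay_struct, ← Matrix.mul_assoc, ← h1, cj_mul, Matrix.mul_assoc]
      _ = _ := by
          rw [← cay_mul_ballCoord, cj_mul, ← Matrix.mul_assoc, cay_struct, Matrix.mul_assoc]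
  have h3 := congrArg (fun Y => cayInv m r * Y) h2
  simpa only [← Matrix.mul_assoc, cayInv_mul_cay, Matrix.one_mul] using h3

/-- Compatibility with the antilinear structure determines the second block column from the first;
the hermitian form then gives the two relations of a `BallPair`. -/
lemma IsArch.ballCoord_eq {X : Matrix (NIdx m r) (NIdx m r) ℂ} (h : IsArch X) :
    ballCoord X = ballMat (ballCoord X).toBlocks₁₁ (ballCoord X).toBlocks₂₁ ∧
      BallPair (ballCoord X).toBlocks₁₁ (ballCoord X).toBlocks₂₁ := by
  have h1 := h.ballCoord_struct
  have h2 := h.ballCoord_form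
  generalize ballCoord X = W at *
  obtain ⟨A, B, C, D, rfl⟩ : ∃ A B C D, W = Matrix.fromBlocks A B C D :=
    ⟨_, _, _, _, (Matrix.fromBlocks_toBlocks W).symm⟩
  rw [cj_fromBlocks, ballStruct, Matrix.fromBlocks_multiply, Matrix.fromBlocks_multiply,
    Matrix.fromBlocks_inj] at h1
  simp only [Matrix.mul_zero, Matrix.zero_mul, zero_add, add_zero, Matrix.mul_smul,
    Matrix.smul_mul, Matrix.mul_one, Matrix.one_mul, neg_smul, Matrix.neg_mul] at h1
  have hB : B = -cj C := by
    refine smul_right_injective _ Complex.I_ne_zero ?_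
    simp only [smul_neg]
    exact h1.1
  have hD : D = cj A := smul_right_injective _ Complex.I_ne_zero h1.2.2.1
  subst hB hD
  simp only [Matrix.toBlocks_fromBlocks₁₁, Matrix.toBlocks_fromBlocks₂₁]
  refine ⟨rfl, ?_⟩
  rw [ballForm, Matrix.fromBlocks_conjTranspose, Matrix.fromBlocks_multiply,
    Matrix.fromBlocks_multiply, Matrix.fromBlocks_inj] at h2
  simp only [Matrix.mul_zero, zero_add, add_zero, Matrix.mul_one,
    Matrix.mul_neg, Matrix.neg_mul, Matrix.conjTranspose_neg, cj_conjTranspose] at h2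
  refine ⟨by rw [← h2.1, sub_eq_add_neg], ?_⟩
  have h3 := h2.2.2.1
  rw [← neg_add, neg_eq_zero] at h3
  rw [← h3]; abel

/-- Conjugating back by the Cayley matrix transports the form and the structure; the determinant
condition is automatic by `det_ballMat`. -/
lemma exists_isArch {A C : Matrix (ZIdx m r) (ZIdx m r) ℂ} (h : BallPair A C) :
    ∃ X : Matrix (NIdx m r) (NIdx m r) ℂ, IsArch X ∧ ballCoord X = ballMat A C := by
  set Y := cay m r * ballMat A C * cayInv m r with hY
  have hsub : (Y.submatrix (labelEquiv m r).symm (labelEquiv m r).symm).submatrix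
      (labelEquiv m r) (labelEquiv m r) = Y := by simp
  have hYc : Y * cay m r = cay m r * ballMat A C := by
    rw [hY, Matrix.mul_assoc, cayInv_mul_cay, Matrix.mul_one]
  have hb : ballCoord (Y.submatrix (labelEquiv m r).symm (labelEquiv m r).symm) = ballMat A C := by
    rw [ballCoord, hsub, Matrix.mul_assoc, hYc, ← Matrix.mul_assoc, cayInv_mul_cay, Matrix.one_mul]
  refine ⟨Y.submatrix (labelEquiv m r).symm (labelEquiv m r).symm, ⟨?_, ?_, ?_⟩, hb⟩
  · have hform : (ballMat A C).conjTranspose * ballForm m r * ballMat A C = ballForm m r := by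
      rw [ballMat, ballForm, Matrix.fromBlocks_conjTranspose, Matrix.fromBlocks_multiply,
        Matrix.fromBlocks_multiply]
      simp only [Matrix.mul_zero, zero_add, add_zero, Matrix.mul_one,
        Matrix.mul_neg, Matrix.neg_mul, Matrix.conjTranspose_neg, cj_conjTranspose, neg_neg]
      congr 1
      · rw [← h.unit, sub_eq_add_neg]
      · rw [← neg_add, h.skew_cj, neg_zero]
      · rw [← neg_add, add_comm, h.skew, neg_zero]
      · rw [← h.unit_cj]; abel
    have h2 : Y.conjTranspose * zForm m r * Y = zForm m r := by
      have e1 : (cay m r).conjTranspose * (Y.conjTranspose * zForm m r * Y) * cay m r =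
          (cay m r).conjTranspose * zForm m r * cay m r := by
        calc _ = (Y * cay m r).conjTranspose * zForm m r * (Y * cay m r) := by
              rw [Matrix.conjTranspose_mul Y (cay m r)]; simp only [Matrix.mul_assoc]
          _ = (ballMat A C).conjTranspose * ((cay m r).conjTranspose * zForm m r * cay m r) *
                ballMat A C := by
              rw [hYc, Matrix.conjTranspose_mul]; simp only [Matrix.mul_assoc]
          _ = _ := by
              rw [cay_form, Matrix.mul_smul, Matrix.smul_mul, hform]
      have e2 : (cayInv m r).conjTranspose * (cay m r).conjTranspose = 1 := by
        rw [← Matrix.conjTranspose_mul, cay_mul_cayInv, Matrix.conjTranspose_one]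
      have e3 := congrArg (fun Z => (cayInv m r).conjTranspose * Z * cayInv m r) e1
      generalize Y.conjTranspose * zForm m r * Y = Z at *
      calc Z = ((cayInv m r).conjTranspose * (cay m r).conjTranspose) * Z *
            (cay m r * cayInv m r) := by rw [e2, cay_mul_cayInv]; simp
        _ = ((cayInv m r).conjTranspose * (cay m r).conjTranspose) * zForm m r *
            (cay m r * cayInv m r) := by simpa only [Matrix.mul_assoc] using e3
        _ = _ := by rw [e2, cay_mul_cayInv]; simp
    have h3 : archForm m r = (zForm m r).submatrix (labelEquiv m r).symm (labelEquiv m r).symm := by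
      rw [← archForm_submatrix]; simp
    rw [h3, Matrix.conjTranspose_submatrix, Matrix.submatrix_mul_equiv, Matrix.submatrix_mul_equiv,
      h2]
  · have hs : ballMat A C * ballStruct m r = ballStruct m r * cj (ballMat A C) := by
      rw [ballMat, ballStruct, cj_fromBlocks, Matrix.fromBlocks_multiply,
        Matrix.fromBlocks_multiply]
      simp
    have h2 : zStruct m r * cj Y = Y * zStruct m r := by
      have e0 : cj (cay m r) * cj (cayInv m r) = 1 := by
        rw [← cj_mul, cay_mul_cayInv, cj_one]
      have e1 : cj Y = cj (cay m r) * cj (ballMat A C) * cj (cayInv m r) := by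
        rw [hY, cj_mul, cj_mul]
      calc zStruct m r * cj Y = zStruct m r * cj (cay m r) * cj (ballMat A C) * cj (cayInv m r) := by
            rw [e1]; simp only [Matrix.mul_assoc]
        _ = cay m r * (ballMat A C * ballStruct m r) * cj (cayInv m r) := by
            rw [cay_struct, hs]; simp only [Matrix.mul_assoc]
        _ = Y * (cay m r * ballStruct m r) * cj (cayInv m r) := by
            rw [← Matrix.mul_assoc, ← hYc]; simp only [Matrix.mul_assoc]
        _ = Y * zStruct m r * (cj (cay m r) * cj (cayInv m r)) := by
            rw [← cay_struct]; simp only [Matrix.mul_assoc]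
        _ = _ := by rw [e0, Matrix.mul_one]
    have h3 : archJ m r = (zStruct m r).submatrix (labelEquiv m r).symm (labelEquiv m r).symm := by
      rw [← archJ_submatrix]; simp
    have e : cj (Y.submatrix (labelEquiv m r).symm (labelEquiv m r).symm) =
        (cj Y).submatrix (labelEquiv m r).symm (labelEquiv m r).symm := rfl
    rw [h3, e, Matrix.submatrix_mul_equiv, Matrix.submatrix_mul_equiv, h2]
  · rw [← det_ballCoord, hb, det_ballMat h]

/-- The first block column of `g` in ball coordinates. -/
def bA (g : G α β m r ℝ) : Matrix (Fin (2 * m + r)) (Fin (2 * m + r)) ℂ :=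
  (ballCoord (arch g.val.val)).toBlocks₁₁.submatrix (num m r).symm (num m r).symm

/-- The lower left block of `g` in ball coordinates. -/
def bC (g : G α β m r ℝ) : Matrix (Fin (2 * m + r)) (Fin (2 * m + r)) ℂ :=
  (ballCoord (arch g.val.val)).toBlocks₂₁.submatrix (num m r).symm (num m r).symm

/-- The point of `𝔅` corresponding to `g z_0`. -/
def vec (g : G α β m r ℝ) : Coord (2 * m + r) := moebV (bA g) (bC g) 0

lemma cj_submatrix {ι κ : Type*} (M : Matrix ι ι ℂ) (e : κ → ι) :
    cj (M.submatrix e e) = (cj M).submatrix e e := rfl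

lemma BallPair.submatrix {ι κ : Type*} [Fintype ι] [DecidableEq ι] [Fintype κ] [DecidableEq κ]
    {A C : Matrix ι ι ℂ} (h : BallPair A C) (e : κ ≃ ι) :
    BallPair (A.submatrix e e) (C.submatrix e e) := by
  constructor
  · rw [Matrix.conjTranspose_submatrix, Matrix.conjTranspose_submatrix,
      Matrix.submatrix_mul_equiv, Matrix.submatrix_mul_equiv, ← Matrix.submatrix_one_equiv e,
      ← h.unit]
    rfl
  · rw [Matrix.transpose_submatrix, Matrix.transpose_submatrix,
      Matrix.submatrix_mul_equiv, Matrix.submatrix_mul_equiv]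
    ext i k
    exact congrFun (congrFun h.skew (e i)) (e k)

lemma ballPair_G (hα : α < 0) (hβ : β < 0) (g : G α β m r ℝ) : BallPair (bA g) (bC g) :=
  (isArch_arch hα hβ g).ballCoord_eq.2.submatrix (num m r).symm

lemma exists_G (hα : α < 0) (hβ : β < 0)
    {A C : Matrix (Fin (2 * m + r)) (Fin (2 * m + r)) ℂ} (h : BallPair A C) :
    ∃ g : G α β m r ℝ, bA g = A ∧ bC g = C := by
  obtain ⟨X, hX, h1⟩ := exists_isArch (h.submatrix (num m r))
  obtain ⟨g, hg⟩ := hX.exists_eq hα hβ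
  refine ⟨g, ?_, ?_⟩
  · rw [bA, hg, h1, ballMat, Matrix.toBlocks_fromBlocks₁₁]; simp
  · rw [bC, hg, h1, ballMat, Matrix.toBlocks_fromBlocks₂₁]; simp

lemma ballCoord_mul_G (hα : α < 0) (hβ : β < 0) (g h : G α β m r ℝ) :
    bA (g * h) = bA g * bA h - cj (bC g) * bC h ∧
      bC (g * h) = bC g * bA h + cj (bA g) * bC h := by
  have h1 : ballCoord (arch (g * h).val.val) =
      ballCoord (arch g.val.val) * ballCoord (arch h.val.val) := by
    rw [← ballCoord_mul, ← arch_mul hα hβ]; rfl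
  rw [(isArch_arch hα hβ g).ballCoord_eq.1, (isArch_arch hα hβ h).ballCoord_eq.1, ballMat, ballMat,
    Matrix.fromBlocks_multiply] at h1
  constructor
  · rw [bA, h1, Matrix.toBlocks_fromBlocks₁₁, bA, bA, bC, bC, cj_submatrix,
      Matrix.submatrix_mul_equiv, Matrix.submatrix_mul_equiv, Matrix.neg_mul, ← sub_eq_add_neg]
    rfl
  · rw [bC, h1, Matrix.toBlocks_fromBlocks₂₁, bA, bA, bC, bC, cj_submatrix,
      Matrix.submatrix_mul_equiv, Matrix.submatrix_mul_equiv]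
    rfl

lemma zero_mem_ball {n : ℕ} : (0 : Coord n) ∈ ball n := by
  rw [mem_ball_iff]
  have : skew (0 : Coord n) = 0 := (skewLin n).map_zero
  rw [this]
  exact IsBall.zero

lemma skew_zero {n : ℕ} : skew (0 : Coord n) = 0 := (skewLin n).map_zero

lemma vec_mem (hα : α < 0) (hβ : β < 0) (g : G α β m r ℝ) : vec g ∈ ball (2 * m + r) :=
  moebV_mem (ballPair_G hα hβ g) zero_mem_ball

lemma skew_vec (hα : α < 0) (hβ : β < 0) (g : G α β m r ℝ) : skew (vec g) = bC g * (bA g)⁻¹ := by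
  rw [vec, skew_moebV (ballPair_G hα hβ g) zero_mem_ball, skew_zero,
    (ballPair_G hα hβ g).moeb_zero]

lemma vec_mul (hα : α < 0) (hβ : β < 0) (g h : G α β m r ℝ) :
    vec (g * h) = moebV (bA g) (bC g) (vec h) := by
  obtain ⟨h1, h2⟩ := ballCoord_mul_G hα hβ g h
  have hb := mem_ball_iff.1 (zero_mem_ball (n := 2 * m + r))
  rw [vec, h1, h2, moebV, moeb_mul (ballPair_G hα hβ h) hb.2, moebV, vec,
    skew_moebV (ballPair_G hα hβ h) zero_mem_ball]

/-- The cocycle relation at the origin: `bA` plays the role of the automorphy factor in the bounded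
model. -/
lemma bA_mul (hα : α < 0) (hβ : β < 0) (g h : G α β m r ℝ) :
    bA (g * h) = den (bA g) (bC g) (skew (vec h)) * bA h := by
  rw [(ballCoord_mul_G hα hβ g h).1, den, skew_vec hα hβ, Matrix.sub_mul, Matrix.mul_assoc (cj _),
    Matrix.mul_assoc (bC h),
    Matrix.nonsing_inv_mul _ (ballPair_G hα hβ h).det_ne_zero.isUnit, Matrix.mul_one]

lemma exists_vec_eq (hα : α < 0) (hβ : β < 0) {v : Coord (2 * m + r)}
    (hv : v ∈ ball (2 * m + r)) : ∃ g : G α β m r ℝ, vec g = v := by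
  obtain ⟨A, hA⟩ := (mem_ball_iff.1 hv).exists_ballPair
  obtain ⟨g, h1, h2⟩ := exists_G hα hβ hA
  refine ⟨g, ?_⟩
  rw [vec, h1, h2, moebV, skew_zero, hA.moeb_zero, Matrix.mul_assoc,
    Matrix.mul_nonsing_inv _ hA.det_ne_zero.isUnit, Matrix.mul_one, unskew_skew]

/-- This is the transformation law of δ at the origin, where δ = 1 and `den` reduces to `bA`. -/
lemma norm_det_bA (hα : α < 0) (hβ : β < 0) (g : G α β m r ℝ) :
    delta (vec g) * ‖(bA g).det‖ ^ 2 = 1 := by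
  have h1 := delta_moebV (ballPair_G hα hβ g) zero_mem_ball
  rw [skew_zero] at h1
  have h2 : delta (0 : Coord (2 * m + r)) = 1 := by simp [delta, skew_zero]
  have h3 : den (bA g) (bC g) 0 = bA g := by simp [den]
  rw [h2, h3] at h1
  exact h1.symm

end Group

/-! ### The action on 𝔷 and its automorphy factor in ball coordinates. -/

lemma det_one_sub_ne_zero {ι : Type*} [Fintype ι] [DecidableEq ι] {c : Matrix ι ι ℂ}
    (h : (1 - c.conjTranspose * c).PosDef) : (1 - c).det ≠ 0 := by
  intro h0
  -- A vector fixed by c would make x*(1 - c*c)x vanish.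
  obtain ⟨x, hx, h1⟩ := Matrix.exists_mulVec_eq_zero_iff.2 h0
  have h2 : Matrix.mulVec c x = x := by
    rw [Matrix.sub_mulVec, Matrix.one_mulVec, sub_eq_zero] at h1
    exact h1.symm
  have h3 := (Matrix.posDef_iff_dotProduct_mulVec.1 h).2 hx
  rw [Matrix.sub_mulVec, Matrix.one_mulVec, ← Matrix.mulVec_mulVec, dotProduct_sub,
    Matrix.dotProduct_mulVec _ c.conjTranspose, Matrix.vecMul_conjTranspose, star_star, h2,
    sub_self] at h3
  exact lt_irrefl _ h3

section Action
variable {α β : ℤ} {m r : ℕ}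

/-- The Cayley transform of the point of `𝔷` with the given coordinates, without the factor `L`. -/
def cayVec (v : Coord (2 * m + r)) : Matrix (ZIdx m r) (ZIdx m r) ℂ :=
  L m r * (skew v).submatrix (num m r) (num m r)

lemma cayVec_zero : cayVec (0 : Coord (2 * m + r)) = 0 := by
  rw [cayVec, skew_zero, Matrix.submatrix_zero, Pi.zero_apply, Pi.zero_apply, Matrix.mul_zero]

lemma det_one_sub_cayVec {v : Coord (2 * m + r)} (hv : v ∈ ball (2 * m + r)) :
    (1 - cayVec v).det ≠ 0 := by
  refine det_one_sub_ne_zero ?_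
  rw [cayVec, Matrix.conjTranspose_mul, Matrix.mul_assoc, ← Matrix.mul_assoc _ (L m r),
    L_conjTranspose, L_mul_L, Matrix.one_mul, Matrix.conjTranspose_submatrix,
    Matrix.submatrix_mul_equiv, ← Matrix.submatrix_one_equiv (num m r)]
  exact Matrix.PosDef.submatrix hv (num m r).injective

lemma cayVec_injective : Function.Injective (cayVec : Coord (2 * m + r) → _) := by
  intro v w h
  have h1 := congrArg (fun Y => L m r * Y) h
  simp only [cayVec, ← Matrix.mul_assoc, L_mul_L, Matrix.one_mul] at h1
  have h2 : skew v = skew w := by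
    have := congrArg (fun Y => Y.submatrix (num m r).symm (num m r).symm) h1
    simpa using this
  rw [← unskew_skew v, h2, unskew_skew]

lemma toZ_eq (v : Coord (2 * m + r)) :
    toZ v = Complex.I • ((1 + cayVec v) * (1 - cayVec v)⁻¹) := by
  rw [toZ, L_conjTranspose]; rfl

lemma toZ_injOn : Set.InjOn (toZ : Coord (2 * m + r) → _) (ball (2 * m + r)) := by
  intro v hv w hw h
  -- Writing (1 + c)(1 - c)⁻¹ = 2(1 - c)⁻¹ - 1 leaves c in a single place, so it can be recovered.
  have h0 : ∀ u ∈ ball (2 * m + r), toZ u = Complex.I • ((2 : ℂ) • (1 - cayVec u)⁻¹ - 1) := by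
    intro u hu
    have h1 := Matrix.mul_nonsing_inv _ (det_one_sub_cayVec hu).isUnit
    rw [toZ_eq]
    congr 1
    generalize (1 - cayVec u)⁻¹ = d at h1 ⊢
    linear_combination (norm := (rw [two_smul]; noncomm_ring)) -h1
  rw [h0 v hv, h0 w hw] at h
  have h2 := sub_left_injective (smul_right_injective _ Complex.I_ne_zero h)
  have h3 := smul_right_injective _ (two_ne_zero (α := ℂ)) h2
  have h4 := Matrix.inv_inj h3 (det_one_sub_cayVec hv).isUnit
  exact cayVec_injective (sub_right_injective h4)

lemma cplx_mul_cay (g : G α β m r ℝ) :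
    cplx g * cay m r = cay m r * ballCoord (arch g.val.val) := (cay_mul_ballCoord _).symm

lemma cayVec_vec (hα : α < 0) (hβ : β < 0) (g : G α β m r ℝ) :
    cayVec (vec g) * (ballCoord (arch g.val.val)).toBlocks₁₁ =
      L m r * (ballCoord (arch g.val.val)).toBlocks₂₁ := by
  have h1 : skew (vec g) * bA g = bC g := by
    rw [skew_vec hα hβ, Matrix.mul_assoc,
      Matrix.nonsing_inv_mul _ (ballPair_G hα hβ g).det_ne_zero.isUnit, Matrix.mul_one]
  have hA : (bA g).submatrix (num m r) (num m r) = (ballCoord (arch g.val.val)).toBlocks₁₁ := by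
    rw [bA, Matrix.submatrix_submatrix, Equiv.symm_comp_self, Matrix.submatrix_id_id]
  have hC : (bC g).submatrix (num m r) (num m r) = (ballCoord (arch g.val.val)).toBlocks₂₁ := by
    rw [bC, Matrix.submatrix_submatrix, Equiv.symm_comp_self, Matrix.submatrix_id_id]
  rw [cayVec, Matrix.mul_assoc, ← hA, ← hC, Matrix.submatrix_mul_equiv, h1]

/-- The first block column of `cay` is (z₀, 1), so the first block column of g · cay = cay ·
ballCoord(g) gives numerator and denominator of g z₀. -/
lemma cplx_col (hα : α < 0) (hβ : β < 0) (g : G α β m r ℝ) :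
    (cplx g).toBlocks₁₁ * z0 m r + (cplx g).toBlocks₁₂ =
        Complex.I • ((1 + cayVec (vec g)) * (ballCoord (arch g.val.val)).toBlocks₁₁) ∧
      lam g (z0 m r) = (1 - cayVec (vec g)) * (ballCoord (arch g.val.val)).toBlocks₁₁ := by
  have h1 := cplx_mul_cay g
  rw [← Matrix.fromBlocks_toBlocks (cplx g),
    ← Matrix.fromBlocks_toBlocks (ballCoord (arch g.val.val)), cay, Matrix.fromBlocks_multiply,
    Matrix.fromBlocks_multiply, Matrix.fromBlocks_inj] at h1
  rw [Matrix.add_mul, Matrix.sub_mul, cayVec_vec hα hβ, lam, z0]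
  constructor
  · rw [Matrix.mul_one] at h1
    rw [h1.1]
    simp
  · have := h1.2.2.1
    rw [Matrix.mul_one] at this
    rw [this, Matrix.neg_mul, sub_eq_add_neg]

lemma det_bA (g : G α β m r ℝ) : (ballCoord (arch g.val.val)).toBlocks₁₁.det = (bA g).det :=
  (Matrix.det_submatrix_equiv_self (num m r).symm _).symm

lemma j_z0 (hα : α < 0) (hβ : β < 0) (g : G α β m r ℝ) :
    j g (z0 m r) = (1 - cayVec (vec g)).det * (bA g).det := by
  rw [j, (cplx_col hα hβ g).2, Matrix.det_mul, det_bA]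

lemma act_z0 (hα : α < 0) (hβ : β < 0) (g : G α β m r ℝ) :
    act g (z0 m r) = toZ (vec g) := by
  have h1 : IsUnit (ballCoord (arch g.val.val)).toBlocks₁₁.det := by
    rw [det_bA]; exact (ballPair_G hα hβ g).det_ne_zero.isUnit
  rw [act, (cplx_col hα hβ g).1, (cplx_col hα hβ g).2, toZ_eq, Matrix.mul_inv_rev,
    Matrix.smul_mul, Matrix.mul_assoc, ← Matrix.mul_assoc _ _ (1 - cayVec (vec g))⁻¹,
    Matrix.mul_nonsing_inv _ h1, Matrix.one_mul]

/-- Whatever element `lift` chooses, injectivity of the Cayley transform determines its point in the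
ball. -/
lemma vec_lift (hα : α < 0) (hβ : β < 0) {v : Coord (2 * m + r)} (hv : v ∈ ball (2 * m + r)) :
    vec (lift α β (toZ v)) = v := by
  have h : ∃ g : G α β m r ℝ, act g (z0 m r) = toZ v := by
    obtain ⟨g, hg⟩ := exists_vec_eq hα hβ hv
    exact ⟨g, by rw [act_z0 hα hβ, hg]⟩
  refine toZ_injOn (vec_mem hα hβ _) hv ?_
  rw [← act_z0 hα hβ, lift, dif_pos h]
  exact h.choose_spec

lemma mem_Kinf_iff (hα : α < 0) (hβ : β < 0) (g : G α β m r ℝ) :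
    g ∈ Kinf α β m r ↔ vec g = 0 := by
  have h0 : toZ (0 : Coord (2 * m + r)) = z0 m r := by
    rw [toZ_eq, cayVec_zero, z0]; simp
  have h1 : g ∈ Kinf α β m r ↔ act g (z0 m r) = z0 m r := Iff.rfl
  rw [h1, act_z0 hα hβ, ← h0]
  exact ⟨fun h => toZ_injOn (vec_mem hα hβ g) zero_mem_ball h, fun h => by rw [h]⟩

lemma j_of_mem_Kinf (hα : α < 0) (hβ : β < 0) {g : G α β m r ℝ} (hg : g ∈ Kinf α β m r) :
    j g (z0 m r) = (bA g).det := by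
  rw [j_z0 hα hβ, (mem_Kinf_iff hα hβ g).1 hg, cayVec_zero, sub_zero, Matrix.det_one, one_mul]

lemma ballCoord_arch_one (hα : α < 0) (hβ : β < 0) :
    ballCoord (arch (1 : G α β m r ℝ).val.val) = 1 := by
  rw [← ballCoord_one, ← arch_one hα hβ]; rfl

lemma bA_one (hα : α < 0) (hβ : β < 0) : bA (1 : G α β m r ℝ) = 1 := by
  rw [bA, ballCoord_arch_one hα hβ, ← Matrix.fromBlocks_one, Matrix.toBlocks_fromBlocks₁₁,
    Matrix.submatrix_one_equiv]

lemma vec_one (hα : α < 0) (hβ : β < 0) : vec (1 : G α β m r ℝ) = 0 := by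
  have h3 : bC (1 : G α β m r ℝ) = 0 := by
    rw [bC, ballCoord_arch_one hα hβ, ← Matrix.fromBlocks_one, Matrix.toBlocks_fromBlocks₂₁]; rfl
  have h4 : skew (vec (1 : G α β m r ℝ)) = 0 := by rw [skew_vec hα hβ, h3, Matrix.zero_mul]
  rw [← unskew_skew (vec _), h4]; rfl

lemma inv_mul_mem_Kinf (hα : α < 0) (hβ : β < 0) {g h : G α β m r ℝ} (e : vec g = vec h) :
    g⁻¹ * h ∈ Kinf α β m r := by
  rw [mem_Kinf_iff hα hβ, vec_mul hα hβ, ← e, ← vec_mul hα hβ, inv_mul_cancel, vec_one hα hβ]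

lemma bA_mul_of_mem_Kinf (hα : α < 0) (hβ : β < 0) (g : G α β m r ℝ) {κ : G α β m r ℝ}
    (hκ : κ ∈ Kinf α β m r) : bA (g * κ) = bA g * bA κ := by
  rw [bA_mul hα hβ, (mem_Kinf_iff hα hβ κ).1 hκ, skew_zero, den, Matrix.mul_zero, sub_zero]

end Action

/-! ### The automorphy factor of the doubled element. -/

section Doubling
variable {α β : ℤ} {m r : ℕ}

lemma blk_mul (a b c d e a' b' c' d' e' : ℂ) :
    blk m r a b c d e * blk m r a' b' c' d' e' =
      blk m r (a * a' + b * d') (a * b' + b * e') (c * c') (d * a' + e * d') (d * b' + e * e') := by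
  ext (p | p | p) (q | q | q) <;>
    simp [Matrix.mul_apply, blk, Fintype.sum_sum_type, ite_add_ite]

lemma blk_add (a b c d e a' b' c' d' e' : ℂ) :
    blk m r a b c d e + blk m r a' b' c' d' e' =
      blk m r (a + a') (b + b') (c + c') (d + d') (e + e') := by
  ext (p | p | p) (q | q | q) <;> simp [blk, ite_add_ite]

lemma blk_smul (t a b c d e : ℂ) :
    t • blk m r a b c d e = blk m r (t * a) (t * b) (t * c) (t * d) (t * e) := by
  ext (p | p | p) (q | q | q) <;> simp [blk]

lemma blk_one : blk m r 1 0 1 0 1 = (1 : Matrix (Idx m r) (Idx m r) ℂ) := by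
  ext (p | p | p) (q | q | q) <;> simp [blk, Matrix.one_apply]

lemma blk_zero : blk m r 0 0 0 0 0 = (0 : Matrix (Idx m r) (Idx m r) ℂ) := by
  ext (p | p | p) (q | q | q) <;> simp [blk]

lemma det_blk_lower (a c d e : ℂ) : (blk m r a 0 c d e).det = a ^ m * (c ^ r * e ^ m) := by
  have h : blk m r a 0 c d e = Matrix.fromBlocks (a • 1) 0
      (Matrix.fromRows 0 (d • 1)) (Matrix.fromBlocks (c • 1) 0 0 (e • 1)) := by
    ext (p | p | p) (q | q | q) <;> simp [blk, Matrix.one_apply]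
  rw [h, Matrix.det_fromBlocks_zero₁₂, Matrix.det_fromBlocks_zero₁₂, Matrix.det_smul,
    Matrix.det_smul, Matrix.det_smul]
  simp

lemma det_blk_upper (a b c e : ℂ) : (blk m r a b c 0 e).det = a ^ m * (c ^ r * e ^ m) := by
  rw [← Matrix.det_transpose, ← det_blk_lower a c b e]
  congr 1
  ext (p | p | p) (q | q | q) <;> simp [blk, eq_comm]

/-- The matrix over `ℂ + ℂJ` with the given components. -/
def quat (P Q : Matrix (Idx m r) (Idx m r) ℂ) : Matrix (NIdx m r) (NIdx m r) ℂ :=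
  cent P + J ⊗ₖ Q

lemma quat_mul (P Q P' Q' : Matrix (Idx m r) (Idx m r) ℂ) :
    quat P Q * quat P' Q' = quat (P * P' + (-1 : ℂ) • (Q * Q')) (P * Q' + Q * P') := by
  simp only [quat, cent, Matrix.add_mul, Matrix.mul_add, ← Matrix.mul_kronecker_mul, J_mul_J,
    Matrix.one_mul, Matrix.mul_one, Matrix.kronecker_add]
  rw [← neg_one_smul ℂ (1 : Matrix (Fin 2) (Fin 2) ℂ), Matrix.smul_kronecker,
    Matrix.kronecker_smul]
  abel

lemma quat_add (P Q P' Q' : Matrix (Idx m r) (Idx m r) ℂ) :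
    quat P Q + quat P' Q' = quat (P + P') (Q + Q') := by
  simp only [quat, cent, Matrix.kronecker_add]
  abel

lemma quat_smul (t : ℂ) (P Q : Matrix (Idx m r) (Idx m r) ℂ) :
    t • quat P Q = quat (t • P) (t • Q) := by
  simp only [quat, cent, Matrix.kronecker_smul, smul_add]

lemma cent_eq (P : Matrix (Idx m r) (Idx m r) ℂ) : cent P = quat P (blk m r 0 0 0 0 0) := by
  rw [quat, blk_zero, Matrix.kronecker_zero, add_zero]

lemma quat_one : quat (blk m r 1 0 1 0 1) (blk m r 0 0 0 0 0) = 1 := by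
  rw [← cent_eq, cent, blk_one, Matrix.one_kronecker_one]

lemma quat_zero : quat (blk m r 0 0 0 0 0) (blk m r 0 0 0 0 0) = 0 := by
  rw [← cent_eq, cent, blk_zero, Matrix.kronecker_zero]

/-- The inverse of `Rinf`. -/
def RinfInv (m r : ℕ) : Matrix (NIdx m r ⊕ NIdx m r) (NIdx m r ⊕ NIdx m r) ℂ :=
  Matrix.fromBlocks
    (quat (blk m r 1 0 1 0 0) (blk m r 0 0 0 0 0)) (quat (blk m r 0 0 (-1) (-1) 0) (blk m r 0 0 0 0 0))
    (quat (blk m r 0 1 0 0 0) (blk m r 0 0 (-1 / 2) 0 0))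
    (quat (blk m r 0 0 0 0 1) (blk m r 0 0 (-1 / 2) 0 0))

lemma Rinf_eq : Rinf m r = Matrix.fromBlocks
    (quat (blk m r 1 0 (1 / 2) 0 0) (blk m r 0 0 0 0 0)) (quat (blk m r 0 0 0 1 0) (blk m r 0 0 1 0 0))
    (quat (blk m r 0 (-1) (-1 / 2) 0 0) (blk m r 0 0 0 0 0))
    (quat (blk m r 0 0 0 0 1) (blk m r 0 0 1 0 0)) := by
  rw [← cent_eq, ← cent_eq]; rfl

lemma Rinf_mul_RinfInv : Rinf m r * RinfInv m r = 1 := by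
  refine Eq.trans ?_ Matrix.fromBlocks_one
  rw [Rinf_eq, RinfInv, Matrix.fromBlocks_multiply]
  simp only [quat_mul, quat_add, blk_mul, blk_add, blk_smul]
  norm_num [quat_one, quat_zero]

lemma Rinf_inv : (Rinf m r)⁻¹ = RinfInv m r := Matrix.inv_eq_right_inv Rinf_mul_RinfInv

lemma tauTilde_mul_rho (X Y : Matrix (NIdx m r) (NIdx m r) ℂ) :
    tauTilde m r * rho X Y =
      tau m r * RinfInv m r * Matrix.fromBlocks X 0 0 (kappa m r * Y) * Rinf m r := by
  have h : Matrix.fromBlocks X 0 0 (kappa m r * Y) =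
      Matrix.fromBlocks 1 0 0 (kappa m r) * Matrix.fromBlocks X 0 0 Y := by
    rw [Matrix.fromBlocks_multiply]; simp
  rw [tauTilde, rho, rho, Rinf_inv, h]
  calc _ = tau m r * RinfInv m r * Matrix.fromBlocks 1 0 0 (kappa m r) *
        (Rinf m r * RinfInv m r) * Matrix.fromBlocks X 0 0 Y * Rinf m r := by
        simp only [Matrix.mul_assoc]
    _ = _ := by rw [Rinf_mul_RinfInv]; simp only [Matrix.mul_assoc, Matrix.one_mul]

/-- `jN` sees only the lower block row, so the upper one is left unspecified. -/
lemma tau_mul_RinfInv : ∃ A B : Matrix (NIdx m r) (NIdx m r) ℂ, tau m r * RinfInv m r =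
    Matrix.fromBlocks A B (quat (blk m r 0 1 0 1 0) (blk m r 0 0 (-1 / 2) 0 0))
      (quat (blk m r (-1) 0 0 0 1) (blk m r 0 0 (-1 / 2) 0 0)) := by
  refine ⟨(RinfInv m r).toBlocks₁₁, (RinfInv m r).toBlocks₁₂, ?_⟩
  rw [RinfInv, Matrix.toBlocks_fromBlocks₁₁, Matrix.toBlocks_fromBlocks₁₂, tau,
    Matrix.fromBlocks_multiply, cent_eq]
  simp only [Matrix.one_mul, Matrix.zero_mul, add_zero, quat_mul, quat_add, blk_mul, blk_add,
    blk_smul]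
  norm_num

/-- After multiplication by κ_m the two lower blocks coincide, so this block can be factored out on
the left of the determinant. -/
lemma lower_mul_kappa :
    quat (blk m r (-1) 0 0 0 1) (blk m r 0 0 (-1 / 2) 0 0) * kappa m r =
      quat (blk m r 0 1 0 1 0) (blk m r 0 0 (-1 / 2) 0 0) := by
  rw [kappa, cent_eq]
  simp only [quat_mul, blk_mul, blk_add, blk_smul]
  norm_num

/-- The projection to an eigenspace of `φ_∞`. -/
def projPos (m r : ℕ) : Matrix (NIdx m r) (NIdx m r) ℂ :=
  (1 / 2 : ℂ) • (1 + (-Complex.I) • archForm m r)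

/-- The projection to the other eigenspace of `φ_∞`. -/
def projNeg (m r : ℕ) : Matrix (NIdx m r) (NIdx m r) ℂ :=
  (1 / 2 : ℂ) • (1 + Complex.I • archForm m r)

/-- A common column of the doubled base point. -/
def baseCol (m r : ℕ) : Matrix (NIdx m r) (NIdx m r) ℂ :=
  quat (blk m r Complex.I (-Complex.I) 0 1 1) (blk m r 0 0 1 0 0)

lemma archForm_quat : archForm m r = quat (blk m r 0 (-1) 0 1 0) (blk m r 0 0 1 0 0) := rfl

/-- R sends the doubled base point to the pair (P₊B, P₋B), with P₊, P₋ the two eigenprojections of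
φ_∞ and B one common invertible column. -/
lemma Rinf_mul_base :
    (Rinf m r).toBlocks₁₁ * (Complex.I • 1) + (Rinf m r).toBlocks₁₂ * S m r =
        projPos m r * baseCol m r ∧
      (Rinf m r).toBlocks₂₁ * (Complex.I • 1) + (Rinf m r).toBlocks₂₂ * S m r =
        projNeg m r * baseCol m r := by
  have hI : Complex.I / 2 * Complex.I = -(1 / 2) := half_I_mul_I
  have hI' : 1 / 2 * Complex.I * Complex.I = -(1 / 2) := by
    rw [mul_assoc, Complex.I_mul_I]; norm_num
  rw [Rinf_eq, projPos, projNeg, baseCol, archForm_quat, S, cent_eq, ← quat_one]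
  simp only [Matrix.toBlocks_fromBlocks₁₁, Matrix.toBlocks_fromBlocks₁₂,
    Matrix.toBlocks_fromBlocks₂₁, Matrix.toBlocks_fromBlocks₂₂, quat_mul, quat_smul, quat_add,
    blk_mul, blk_add, blk_smul]
  constructor
  · congr 2 <;> ring_nf <;> simp only [Complex.I_sq] <;> ring
  · congr 2 <;> ring_nf <;> simp only [Complex.I_sq] <;> ring

lemma S_inv : (S m r)⁻¹ = quat (blk m r 1 0 2 0 1) (blk m r 0 0 0 0 0) := by
  refine Matrix.inv_eq_right_inv ?_
  rw [S, cent_eq]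
  simp only [quat_mul, blk_mul, blk_add, blk_smul]
  norm_num [quat_one]

lemma lower_mul_baseCol : (S m r)⁻¹ * quat (blk m r 0 1 0 1 0) (blk m r 0 0 (-1 / 2) 0 0) *
    baseCol m r = cent (blk m r 1 1 1 Complex.I (-Complex.I)) := by
  rw [S_inv, baseCol, cent_eq]
  simp only [quat_mul, blk_mul, blk_add, blk_smul]
  norm_num

lemma det_cent_blk : (cent (blk m r 1 1 1 Complex.I (-Complex.I))).det = (-4) ^ m := by
  -- A lower times upper triangular factorization gives (-2i)^m; the Kronecker product with 1₂
  -- squares this to (-4)^m.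
  have h : blk m r 1 1 1 Complex.I (-Complex.I) =
      blk m r 1 0 1 Complex.I 1 * blk m r 1 1 1 0 (-2 * Complex.I) := by
    rw [blk_mul]
    congr 1 <;> ring
  rw [cent, Matrix.det_kronecker, h, Matrix.det_mul, det_blk_lower, det_blk_upper]
  simp only [Matrix.det_one, one_pow, one_mul, mul_one, Fintype.card_fin]
  rw [← pow_mul, mul_comm m 2, pow_mul]
  congr 1
  rw [mul_pow, Complex.I_sq]
  norm_num

lemma jN_eq (X Y : Matrix (NIdx m r) (NIdx m r) ℂ) :
    jN (tauTilde m r * rho X Y) =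
      (-4) ^ m * (X * projPos m r + Y * projNeg m r).det := by
  have h1 : (tauTilde m r * rho X Y).toBlocks₂₁ * (Complex.I • 1) +
      (tauTilde m r * rho X Y).toBlocks₂₂ * S m r =
      quat (blk m r 0 1 0 1 0) (blk m r 0 0 (-1 / 2) 0 0) *
        (X * projPos m r + Y * projNeg m r) * baseCol m r := by
    obtain ⟨h2, h3⟩ := Rinf_mul_base (m := m) (r := r)
    obtain ⟨A, B, h4⟩ := tau_mul_RinfInv (m := m) (r := r)
    rw [tauTilde_mul_rho, h4, ← Matrix.fromBlocks_toBlocks (Rinf m r), Matrix.fromBlocks_multiply,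
      Matrix.fromBlocks_multiply, Matrix.toBlocks_fromBlocks₂₁, Matrix.toBlocks_fromBlocks₂₂]
    simp only [Matrix.mul_zero, add_zero, zero_add, ← Matrix.mul_assoc _ (kappa m r),
      lower_mul_kappa]
    generalize quat (blk m r 0 1 0 1 0) (blk m r 0 0 (-1 / 2) 0 0) = T
    calc _ = T * (X * ((Rinf m r).toBlocks₁₁ * (Complex.I • 1) + (Rinf m r).toBlocks₁₂ * S m r) +
          Y * ((Rinf m r).toBlocks₂₁ * (Complex.I • 1) + (Rinf m r).toBlocks₂₂ * S m r)) := by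
          simp only [Matrix.add_mul, Matrix.mul_add, ← Matrix.mul_assoc]
          abel
      _ = _ := by
          rw [h2, h3]
          simp only [Matrix.add_mul, Matrix.mul_add, ← Matrix.mul_assoc]
  rw [jN, h1, ← det_cent_blk (m := m) (r := r), ← lower_mul_baseCol]
  simp only [Matrix.det_mul]
  ring

/-- In ball coordinates φ_∞ acts as i · diag(1, -1), so its eigenprojections are the coordinate
projections. -/
lemma ballCoord_projPos : ballCoord (projPos m r) = Matrix.fromBlocks 1 0 0 0 ∧
    ballCoord (projNeg m r) = Matrix.fromBlocks 0 0 0 1 := by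
  have hs : ∀ t : ℂ, ((1 / 2 : ℂ) • (1 + t • archForm m r)).submatrix
      (labelEquiv m r) (labelEquiv m r) = (1 / 2 : ℂ) • (1 + t • zForm m r) := by
    intro t
    rw [← archForm_submatrix, ← Matrix.submatrix_one_equiv (labelEquiv m r)]; rfl
  have hz : zForm m r * cay m r = cay m r * (Complex.I • ballForm m r) := by
    rw [zForm, cay, ballForm, Matrix.fromBlocks_smul, Matrix.fromBlocks_multiply,
      Matrix.fromBlocks_multiply]
    simp [smul_smul]
  have ht : ∀ t : ℂ, ballCoord ((1 / 2 : ℂ) • (1 + t • archForm m r)) =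
      (1 / 2 : ℂ) • (1 + (t * Complex.I) • ballForm m r) := by
    intro t
    rw [ballCoord, hs, Matrix.mul_assoc, Matrix.smul_mul, Matrix.add_mul, Matrix.smul_mul, hz,
      Matrix.one_mul, Matrix.mul_smul, Matrix.mul_smul, Matrix.mul_add, cayInv_mul_cay,
      Matrix.mul_smul, Matrix.mul_smul, ← Matrix.mul_assoc, cayInv_mul_cay, Matrix.one_mul,
      smul_smul]
  rw [projPos, projNeg, ht, ht, ballForm, neg_mul, Complex.I_mul_I, ← Matrix.fromBlocks_one,
    Matrix.fromBlocks_smul, Matrix.fromBlocks_smul, Matrix.fromBlocks_add, Matrix.fromBlocks_add,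
    Matrix.fromBlocks_smul, Matrix.fromBlocks_smul]
  constructor
  · congr 1
    · module
    · module
    · module
    · module
  · congr 1
    · module
    · module
    · module
    · module

lemma ballCoord_add (X Y : Matrix (NIdx m r) (NIdx m r) ℂ) :
    ballCoord (X + Y) = ballCoord X + ballCoord Y := by
  rw [ballCoord, ballCoord, ballCoord, ← Matrix.add_mul, ← Matrix.mul_add]; rfl

/-- Factoring out g, of determinant 1, leaves P₊ + (g⁻¹h)P₋. In ball coordinates this is block upper
triangular with diagonal 1, Ā, whence the conjugated determinant. -/
lemma jN_arch (hα : α < 0) (hβ : β < 0) (g h : G α β m r ℝ) :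
    jN (tauTilde m r * rho (arch g.val.val) (arch h.val.val)) =
      (-4) ^ m * starRingEnd ℂ (bA (g⁻¹ * h)).det := by
  have h1 : arch h.val.val = arch g.val.val * arch (g⁻¹ * h).val.val := by
    rw [← arch_mul hα hβ]
    congr 1
    have : h = g * (g⁻¹ * h) := by group
    conv_lhs => rw [this]
    rfl
  have h2 := (isArch_arch hα hβ (g⁻¹ * h)).ballCoord_eq.1
  rw [jN_eq, h1, Matrix.mul_assoc, ← Matrix.mul_add, Matrix.det_mul, (isArch_arch hα hβ g).det,
    one_mul, ← det_ballCoord, ballCoord_add, ballCoord_mul, ballCoord_projPos.1,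
    ballCoord_projPos.2, h2, ballMat, Matrix.fromBlocks_multiply, Matrix.fromBlocks_add]
  simp only [Matrix.mul_zero, Matrix.mul_one, add_zero, zero_add]
  rw [Matrix.det_fromBlocks_zero₂₁, Matrix.det_one, one_mul, det_cj, det_bA]

end Doubling

/-! ### Holomorphy of the determinants. -/

section Holomorphic
variable {E ι : Type*} [NormedAddCommGroup E] [NormedSpace ℂ E] [Fintype ι] [DecidableEq ι]

lemma differentiable_det {M : E → Matrix ι ι ℂ} (h : ∀ p q, Differentiable ℂ fun v => M v p q) :
    Differentiable ℂ fun v => (M v).det := by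
  simp only [Matrix.det_apply]
  fun_prop

lemma differentiable_skew_apply {n : ℕ} (p q : Fin n) :
    Differentiable ℂ fun v : Coord n => skew v p q := by
  simp only [skew, Matrix.of_apply]
  split_ifs <;> fun_prop

lemma differentiable_den {n : ℕ} (A C : Matrix (Fin n) (Fin n) ℂ) :
    Differentiable ℂ fun v : Coord n => (den A C (skew v)).det := by
  refine differentiable_det fun p q => ?_
  simp only [den, Matrix.sub_apply, Matrix.mul_apply]
  have := fun l => differentiable_skew_apply (n := n) l q
  fun_prop

lemma differentiable_det_one_sub_cayVec {m r : ℕ} :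
    Differentiable ℂ fun v : Coord (2 * m + r) => (1 - cayVec v).det := by
  refine differentiable_det fun p q => ?_
  simp only [cayVec, Matrix.sub_apply, Matrix.mul_apply, Matrix.submatrix_apply]
  have := fun l => differentiable_skew_apply l (num m r q)
  fun_prop

end Holomorphic

/-! ### The form as a holomorphic function on the ball, and evaluation of the integrand. -/

section Modular
variable {α β : ℤ} {m r k N : ℕ} {O : Subring (Quat α β ℚ)}
  {f : G α β m r AH × G α β m r ℝ → ℂ}

lemma baseChange_one (A : Type) [CommRing A] [Algebra ℚ A] : baseChange α β A 1 = 1 := by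
  ext <;> simp [baseChange]

lemma one_map_baseChange (A : Type) [CommRing A] [Algebra ℚ A] :
    (1 : Matrix (Idx m r) (Idx m r) (Quat α β ℚ)).map (baseChange α β A) = 1 :=
  Matrix.map_one _ (by ext <;> simp [baseChange]) (baseChange_one A)

lemma one_mem_K1 : (1 : G α β m r AH) ∈ K1 m r O N := by
  have h1 : ∀ p q : Idx m r, (1 : Matrix (Idx m r) (Idx m r) (Quat α β AH)) p q ∈ hatOrder O := by
    intro p q
    by_cases h : p = q
    · rw [h, Matrix.one_apply_eq]
      refine AddSubgroup.subset_closure ⟨1, fun v => ?_, 1, O.one_mem, ?_⟩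
      · exact one_mem (v.adicCompletionIntegers ℚ)
      · rw [baseChange_one, one_smul]
    · rw [Matrix.one_apply_ne h]
      exact zero_mem _
  have h0 : (0 : Quat α β AH) ∈ hatIdeal O N := ⟨0, zero_mem _, (smul_zero _).symm⟩
  have h2 : ∀ p q : Idx m r,
      ((1 : Matrix (Idx m r) (Idx m r) (Quat α β AH)) - 1) p q ∈ hatIdeal O N := by
    intro p q
    rw [sub_self]
    exact h0
  have h3 : ∀ p q : Idx m r, p ≠ q →
      (1 : Matrix (Idx m r) (Idx m r) (Quat α β AH)) p q ∈ hatIdeal O N := by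
    intro p q h
    rw [Matrix.one_apply_ne h]
    exact h0
  refine ⟨h1, fun p q => ?_, fun p q => h2 _ _, fun p q => h2 _ _, fun p q => h2 _ _,
    fun p q => h3 _ _ (by simp), fun p q => h3 _ _ (by simp), fun p q => h3 _ _ (by simp)⟩
  rw [inv_one]
  exact h1 p q

lemma IsModularForm.apply_mul (hf : IsModularForm k O N f) (gh : G α β m r AH)
    (g : G α β m r ℝ) {κ : G α β m r ℝ} (hκ : κ ∈ Kinf α β m r) :
    f (gh, g * κ) = (j κ (z0 m r) ^ k)⁻¹ * f (gh, g) := by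
  have := hf.equivariant 1 1 1 (one_map_baseChange AH).symm (one_map_baseChange ℝ).symm gh g 1
    one_mem_K1 κ hκ
  simpa only [one_mul, mul_one] using this

/-- By `j_z0` the factors j(h, z₀) and det `bA` differ by det(1 - c), which is holomorphic and
nonvanishing on the ball. K_∞-equivariance makes the value independent of the chosen lift. -/
lemma IsModularForm.exists_holomorphic_one (hf : IsModularForm k O N f) (hα : α < 0) (hβ : β < 0)
    (gh : G α β m r AH) : ∃ H : Coord (2 * m + r) → ℂ,
      DifferentiableOn ℂ H (ball (2 * m + r)) ∧
        ∀ h : G α β m r ℝ, H (vec h) = (bA h).det ^ k * f (gh, h) := by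
  refine ⟨fun v => ((1 - cayVec v).det ^ k)⁻¹ *
    (j (lift α β (toZ v)) (z0 m r) ^ k * f (gh, lift α β (toZ v))),
    (((differentiable_det_one_sub_cayVec.pow k).differentiableOn).inv
      fun v hv => pow_ne_zero k (det_one_sub_cayVec hv)).mul (hf.holomorphic gh), fun h => ?_⟩
  have hv := vec_mem hα hβ h
  simp only
  have h1 : vec (lift α β (toZ (vec h))) = vec h := vec_lift hα hβ hv
  generalize lift α β (toZ (vec h)) = h' at *
  have hκ := inv_mul_mem_Kinf hα hβ h1
  have h2 : h = h' * (h'⁻¹ * h) := by group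
  have h3 := hf.apply_mul gh h' hκ
  have h4 := bA_mul_of_mem_Kinf hα hβ h' hκ
  rw [j_of_mem_Kinf hα hβ hκ] at h3
  rw [← h2] at h3 h4
  have hd := (ballPair_G hα hβ (h'⁻¹ * h)).det_ne_zero
  have hc := det_one_sub_cayVec hv
  rw [j_z0 hα hβ, h1, h3, h4, Matrix.det_mul, mul_pow, mul_pow]
  field_simp

/-- Pull back the case g = 1 along the holomorphic action of g and divide by the cocycle `bA_mul`.
-/
lemma IsModularForm.exists_holomorphic (hf : IsModularForm k O N f) (hα : α < 0) (hβ : β < 0)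
    (gh : G α β m r AH) (g : G α β m r ℝ) : ∃ F : Coord (2 * m + r) → ℂ,
      DifferentiableOn ℂ F (ball (2 * m + r)) ∧
        ∀ h : G α β m r ℝ, F (vec h) = (bA h).det ^ k * f (gh, g * h) := by
  obtain ⟨H, hH, h1⟩ := hf.exists_holomorphic_one hα hβ gh
  have hb := ballPair_G hα hβ g
  have hd : ∀ v ∈ ball (2 * m + r), (den (bA g) (bC g) (skew v)).det ≠ 0 :=
    fun v hv => det_den_ne_zero hb hv
  refine ⟨fun v => ((den (bA g) (bC g) (skew v)).det ^ k)⁻¹ * H (moebV (bA g) (bC g) v),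
    ((((differentiable_den _ _).pow k).differentiableOn).inv
      fun v hv => pow_ne_zero k (hd v hv)).mul
      (hH.comp (fun v hv => (hasFDerivWithinAt_moebV hb hv).differentiableWithinAt)
        fun v hv => moebV_mem hb hv), fun h => ?_⟩
  have := hd _ (vec_mem hα hβ h)
  simp only
  rw [← vec_mul hα hβ, h1, bA_mul hα hβ, Matrix.det_mul, mul_pow]
  field_simp

lemma cpow_half_eq {x d : ℝ} (hx : 0 < x) (h : d * x ^ 2 = 1) (w : ℂ) :
    (d : ℂ) ^ (w / 2) = (x : ℂ) ^ (-w) := by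
  have hd : d = (x ^ 2)⁻¹ := eq_inv_of_mul_eq_one_left h
  have hd0 : 0 < d := by rw [hd]; positivity
  have h1 : Real.log d = -2 * Real.log x := by rw [hd, Real.log_inv, Real.log_pow]; ring
  rw [Complex.cpow_def_of_ne_zero (by exact_mod_cast hd0.ne'),
    Complex.cpow_def_of_ne_zero (by exact_mod_cast hx.ne'), ← Complex.ofReal_log hd0.le,
    ← Complex.ofReal_log hx.le, h1]
  congr 1
  push_cast
  ring

/-- The constant of the archimedean integral. -/
def archConst (m k : ℕ) (s : ℂ) : ℂ :=
  (((-4) ^ m) ^ k)⁻¹ * (((4 ^ m : ℕ) : ℂ)) ^ ((k : ℂ) - s)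

lemma phiInf_eq (hα : α < 0) (hβ : β < 0) (g h : G α β m r ℝ) (s : ℂ) :
    phiInf k (tauTilde m r * rho (arch g.val.val) (arch (g * h).val.val)) s =
      archConst m k s * (delta (vec h) : ℂ) ^ ((s + k) / 2) * (bA h).det ^ k := by
  rw [phiInf, jN_arch hα hβ, inv_mul_cancel_left,
    cpow_half_eq (norm_pos_iff.2 (ballPair_G hα hβ h).det_ne_zero) (norm_det_bA hα hβ h)]
  have hD := (ballPair_G hα hβ h).det_ne_zero
  generalize (bA h).det = D at *
  have hx : ((‖D‖ : ℝ) : ℂ) ≠ 0 := by exact_mod_cast norm_ne_zero_iff.2 hD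
  have h1 : ((‖(-4 : ℂ) ^ m * starRingEnd ℂ D‖ : ℝ) : ℂ) ^ ((k : ℂ) - s) =
      (((4 ^ m : ℕ) : ℂ)) ^ ((k : ℂ) - s) * ((‖D‖ : ℝ) : ℂ) ^ ((k : ℂ) - s) := by
    rw [← Complex.ofReal_natCast (4 ^ m), ← Complex.mul_cpow_ofReal_nonneg (Nat.cast_nonneg _)
      (norm_nonneg D)]
    simp
  -- With |D|² = D̄D, the factor D̄^{-k}|D|^{k-s} becomes D^k |D|^{-(s+k)}: the antiholomorphic
  -- power turns into a holomorphic one.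
  have h2 : ((‖D‖ : ℝ) : ℂ) ^ ((k : ℂ) - s) =
      (starRingEnd ℂ D * D) ^ k * ((‖D‖ : ℝ) : ℂ) ^ (-(s + k)) := by
    rw [Complex.conj_mul', ← pow_mul, ← Complex.cpow_natCast, ← Complex.cpow_add _ _ hx]
    congr 1
    push_cast
    ring
  have hc : starRingEnd ℂ D ≠ 0 := by simpa using hD
  rw [h1, h2, archConst, mul_pow, mul_pow]
  field_simp

/-- The lift of the moved point is g h for some h with h·0 = v. The density δ^{1-n} merges with
δ^{(s+k)/2} into the Hua exponent. -/
lemma integrand_lift (hα : α < 0) (hβ : β < 0) (gh : G α β m r AH) (g : G α β m r ℝ)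
    {F : Coord (2 * m + r) → ℂ}
    (hF : ∀ h : G α β m r ℝ, F (vec h) = (bA h).det ^ k * f (gh, g * h)) (s : ℂ)
    {v : Coord (2 * m + r)} (hv : v ∈ ball (2 * m + r)) :
    delta v ^ (1 - ((2 * m + r : ℕ) : ℤ)) •
        integrand k f gh g s (lift α β (toZ (moebV (bA g) (bC g) v))) =
      huaFun (2 * m + r) ((s + k) / 2 - (2 * m + r : ℕ) + 1) v * (archConst m k s * F v) := by
  have hb := ballPair_G hα hβ g
  have h1 := vec_lift hα hβ (moebV_mem hb hv)
  generalize lift α β (toZ (moebV (bA g) (bC g) v)) = h' at *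
  obtain ⟨h, rfl⟩ : ∃ h, h' = g * h := ⟨g⁻¹ * h', by group⟩
  rw [vec_mul hα hβ] at h1
  have h2 : vec h = v := moebV_injOn hb (vec_mem hα hβ h) hv h1
  have hd : (delta v : ℂ) ≠ 0 := by exact_mod_cast (delta_pos hv).ne'
  have h3 : ((s + k) / 2 - (2 * m + r : ℕ) + 1 : ℂ) =
      ((1 - ((2 * m + r : ℕ) : ℤ) : ℤ) : ℂ) + (s + k) / 2 := by push_cast; ring
  rw [integrand, phiInf_eq hα hβ, h2, ← h2, hF, h2, huaFun, Set.indicator_of_mem hv, h3,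
    Complex.cpow_add _ _ hd, Complex.cpow_intCast, Complex.real_smul, Complex.ofReal_zpow]
  ring

lemma indicator_huaFun_mul {n : ℕ} (l : ℂ) (F : Coord n → ℂ) :
    (ball n).indicator (fun v => huaFun n l v * F v) = fun v => huaFun n l v * F v := by
  funext v
  by_cases hv : v ∈ ball n
  · rw [Set.indicator_of_mem hv]
  · rw [Set.indicator_of_notMem hv, huaFun, Set.indicator_of_notMem hv, zero_mul]

lemma integrableGK_iff (hα : α < 0) (hβ : β < 0) (gh : G α β m r AH) (g : G α β m r ℝ)
    {F : Coord (2 * m + r) → ℂ}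
    (hF : ∀ h : G α β m r ℝ, F (vec h) = (bA h).det ^ k * f (gh, g * h)) (s : ℂ) :
    IntegrableGK (integrand k f gh g s) ↔ Integrable fun v =>
      huaFun (2 * m + r) ((s + k) / 2 - (2 * m + r : ℕ) + 1) v * (archConst m k s * F v) := by
  rw [IntegrableGK, ← integrable_comp_moebV (ballPair_G hα hβ g), integrable_invMeasure,
    integrableOn_congr_fun (fun v hv => integrand_lift hα hβ gh g hF s hv)
      isOpen_ball.measurableSet, ← integrable_indicator_iff isOpen_ball.measurableSet]
  rw [indicator_huaFun_mul]

lemma integralGK_eq (hα : α < 0) (hβ : β < 0) (gh : G α β m r AH) (g : G α β m r ℝ)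
    {F : Coord (2 * m + r) → ℂ}
    (hF : ∀ h : G α β m r ℝ, F (vec h) = (bA h).det ^ k * f (gh, g * h)) (s : ℂ) :
    integralGK (integrand k f gh g s) = ∫ v,
      huaFun (2 * m + r) ((s + k) / 2 - (2 * m + r : ℕ) + 1) v * (archConst m k s * F v) := by
  rw [integralGK, ← integral_comp_moebV (ballPair_G hα hβ g), integral_invMeasure,
    setIntegral_congr_fun isOpen_ball.measurableSet
      (fun v hv => integrand_lift hα hβ gh g hF s hv)]
  exact setIntegral_eq_integral_of_forall_compl_eq_zero fun v hv => by
    rw [huaFun, Set.indicator_of_notMem hv, zero_mul]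

/-- Split the integrand as δ^{s/2-n+1} times the bounded function δ^{k/2}F; the first factor is the
Hua integrand of weight 0, hence the condition on Re s alone. -/
lemma integrable_hua_mul_of_bounded {n : ℕ} (hn : 1 < n) {s : ℂ} (hs : 2 * (n : ℝ) - 3 < s.re)
    {F : Coord n → ℂ} (hF : DifferentiableOn ℂ F (ball n)) {C : ℝ}
    (hC : ∀ v ∈ ball n, ‖(delta v : ℂ) ^ ((k : ℂ) / 2) * F v‖ ≤ C) :
    Integrable fun v => huaFun n ((s + k) / 2 - n + 1) v * F v := by
  have hn' : (2 : ℝ) ≤ n := by exact_mod_cast hn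
  have h1 := (hua_integral n 0 s (by simp; linarith) (by simpa using hs)).1
  refine (h1.norm.const_mul C).mono' ?_ (Filter.Eventually.of_forall fun v => ?_)
  · rw [← indicator_huaFun_mul, aestronglyMeasurable_indicator_iff isOpen_ball.measurableSet]
    exact (measurable_huaFun _).aestronglyMeasurable.mul
      (hF.continuousOn.aestronglyMeasurable isOpen_ball.measurableSet)
  · by_cases hv : v ∈ ball n
    · have hd : (delta v : ℂ) ≠ 0 := by exact_mod_cast (delta_pos hv).ne'
      have h3 : ((s + k) / 2 - n + 1 : ℂ) = ((s + (0 : ℕ)) / 2 - n + 1) + (k : ℂ) / 2 := by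
        push_cast; ring
      rw [huaFun, huaFun, Set.indicator_of_mem hv, Set.indicator_of_mem hv, h3,
        Complex.cpow_add _ _ hd, mul_assoc, norm_mul, mul_comm]
      exact mul_le_mul_of_nonneg_right (hC v hv) (norm_nonneg _)
    · rw [huaFun, Set.indicator_of_notMem hv, zero_mul, norm_zero]
      have h4 : huaFun n ((s + (0 : ℕ)) / 2 - n + 1) v = 0 := Set.indicator_of_notMem hv _
      rw [h4, norm_zero, mul_zero]

/-- Consequently δ^{k/2}F has the absolute value of f, and boundedness of f carries over. -/
lemma norm_delta_mul (hα : α < 0) (hβ : β < 0) (h : G α β m r ℝ) :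
    ‖(delta (vec h) : ℂ) ^ ((k : ℂ) / 2) * (bA h).det ^ k‖ = 1 := by
  have hD := (ballPair_G hα hβ h).det_ne_zero
  have hx := norm_pos_iff.2 hD
  rw [cpow_half_eq hx (norm_det_bA hα hβ h), norm_mul, norm_pow, Complex.cpow_neg,
    Complex.cpow_natCast, norm_inv, norm_pow, Complex.norm_real, norm_norm]
  exact inv_mul_cancel₀ (pow_ne_zero _ hx.ne')

end Modular

/-! ### Algebraicity and holomorphy of the constant. -/

lemma isAlgebraic_natCast_cpow (b : ℕ) (q : ℚ) : IsAlgebraic ℚ ((b : ℂ) ^ (q : ℂ)) := by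
  -- Raising to the denominator of q leaves an integral power of b, which is rational.
  refine IsAlgebraic.of_pow q.den_pos ?_
  have h : ((q.den : ℕ) : ℂ) * (q : ℂ) = ((q.num : ℤ) : ℂ) := by
    exact_mod_cast Rat.den_mul_eq_num q
  rw [← Complex.cpow_nat_mul, h, Complex.cpow_intCast]
  have := isAlgebraic_algebraMap (A := ℂ) ((b : ℚ) ^ q.num)
  simpa using this

lemma isAlgebraic_archConst (m k : ℕ) (q : ℚ) : IsAlgebraic ℚ (archConst m k (q : ℂ)) := by
  refine IsAlgebraic.mul ?_ ?_
  · have := isAlgebraic_algebraMap (A := ℂ) ((((-4 : ℚ) ^ m) ^ k)⁻¹)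
    simpa using this
  · have := isAlgebraic_natCast_cpow (4 ^ m) ((k : ℚ) - q)
    simpa using this

lemma differentiable_archConst (m k : ℕ) : Differentiable ℂ (archConst m k) := by
  refine (differentiable_const _).mul ?_
  refine Differentiable.const_cpow (by fun_prop) (Or.inl ?_)
  exact_mod_cast pow_ne_zero m (by norm_num)

end QMF

end

theorem mainTheorem6 (m r k : ℕ) (hm : 1 < m) :
    ∃ a : ℂ → ℂ, Differentiable ℂ a ∧ (∀ q : ℚ, IsAlgebraic ℚ (a (q : ℂ))) ∧
      ∀ (α β : ℤ), α < 0 → β < 0 →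
      ∀ (O : Subring (QMF.Quat α β ℚ)), QMF.IsMaximalOrder O →
      ∀ (N : ℕ), 0 < N →
      ∀ (f : QMF.G α β m r QMF.AH × QMF.G α β m r ℝ → ℂ), QMF.IsModularForm k O N f →
      ∀ (hh : QMF.G α β m r QMF.AH) (g : QMF.G α β m r ℝ) (s : ℂ),
        2 * ((2 * m + r : ℕ) : ℝ) + 1 < (k : ℝ) + s.re →
        (QMF.IntegrableGK (QMF.integrand k f hh g s) →
          QMF.integralGK (QMF.integrand k f hh g s) =
            a s * QMF.gammaFactor (2 * m + r) k s * f (hh, g)) ∧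
        (2 * ((2 * m + r : ℕ) : ℝ) - 3 < s.re →
          (∃ C : ℝ, ∀ h : QMF.G α β m r ℝ, ‖f (hh, h)‖ ≤ C) →
          QMF.IntegrableGK (QMF.integrand k f hh g s)) := by
  refine ⟨QMF.archConst m k, QMF.differentiable_archConst m k, QMF.isAlgebraic_archConst m k, ?_⟩
  intro α β hα hβ O _ N _ f hf hh g s hs
  obtain ⟨F, hF, h1⟩ := hf.exists_holomorphic hα hβ hh g
  rw [QMF.integrableGK_iff hα hβ hh g h1, QMF.integralGK_eq hα hβ hh g h1]
  refine ⟨fun hi => ?_, fun hs' hC => ?_⟩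
  · have hn : (0 : ℝ) ≤ ((2 * m + r : ℕ) : ℝ) := Nat.cast_nonneg _
    have hre : (s + k).re = k + s.re := by simp [add_comm]
    -- The origin is the point of the identity element, where det `bA` = 1.
    have h0 : F 0 = f (hh, g) := by
      rw [← QMF.vec_one hα hβ, h1, QMF.bA_one hα hβ, Matrix.det_one, one_pow, one_mul, mul_one]
    rw [QMF.integral_hua_mul (hF.const_mul _) hi,
      (QMF.hua_integral _ k s (by linarith) (by linarith)).2, h0]
    ring
  · obtain ⟨C, hC⟩ := hC
    have h2 : MeasureTheory.Integrable fun v => QMF.huaFun (2 * m + r)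
        ((s + k) / 2 - (2 * m + r : ℕ) + 1) v * F v := by
      refine QMF.integrable_hua_mul_of_bounded (by omega) hs' hF (C := C) fun v hv => ?_
      obtain ⟨h, rfl⟩ := QMF.exists_vec_eq hα hβ hv
      rw [h1, ← mul_assoc, norm_mul, QMF.norm_delta_mul hα hβ, one_mul]
      exact hC _
    simpa only [mul_left_comm] using h2.const_mul (QMF.archConst m k s)
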